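/- **Setting.** Let $(M,c_M,D^M)$ and $(N,c_N,D^N)$ be oriented Weyl spaces of even dimension: $c_M$, $c_N$ are conformal structures (conformal classes of smooth Riemannian metrics) and $D^M$, $D^N$ are Weyl connections, that is, smooth torsion-free connections which preserve the conformal structures. Let $\varphi:M\hookrightarrow N$ be a smooth injective conformal immersion; if $\dim M=\dim N$ assume that $\varphi$ preserves the orientations. Let $(TM)^\perp$ be the normal bundle, oriented such that $TN|_M=TM\oplus(TM)^\perp$ is orientation preserving, and let $\Pi:TN|_M\to(TM)^\perp$ be the orthogonal projection. Let $Q_M$, $Q_N$, $Q$ be the bundles of positive maximal isotropic subspaces of $T^{\mathbb C}M$, $T^{\mathbb C}N$, $((TM)^\perp)^{\mathbb C}$, that is, of the eigenspaces, corresponding to $-\mathrm i$, of the positive orthogonal complex structures on $TM$, $TN$, $(TM)^\perp$, respectively; $Q$ is a bundle over $M$. The fibres of these bundles are complex manifolds (complex submanifolds of Grassmannians). Let $Q_M+Q=\{(p,q)\mid p\in Q_M,\,q\in Q \text{ over the same point of } M\}$ be their fibre product over $M$. Endow $Q_N$ with the connection induced by $D^N$, and $Q_M+Q$ with the connection induced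 by $D^M$ on $Q_M$ and by $\Pi\circ D^N$ on $Q$. Denote by $\pi$ the projection of $Q_N$ (respectively, $Q_M+Q$) onto its base and by $\mathscr H$ the horizontal distribution. Let $\mathscr G_0\subseteq\mathscr H^{\mathbb C}$ be the complex distribution characterised by $\mathrm d\pi(\mathscr G_{0})=p$ at the point $p\in Q_N$ (respectively, $(p,q)\in Q_M+Q$). Let $\mathcal J_N$ and $\mathcal J'_N$ (respectively, $\mathcal J$ and $\mathcal J'$) be the almost complex structures on $Q_N$ (respectively, $Q_M+Q$) whose eigenbundles corresponding to $-\mathrm i$ are $\mathscr G_0\oplus(\ker\mathrm d\pi)^{0,1}$ and $\mathscr G_0\oplus(\ker\mathrm d\pi)^{1,0}$, respectively. A map between almost complex manifolds is holomorphic if its differential maps the eigenbundle corresponding to $-\mathrm i$ into the eigenbundle corresponding to $-\mathrm i$. Let $\varPhi:Q_M+Q\to Q_N$ be defined by $\varPhi(p,q)=p\oplus q$. **Proposition.** (i) If $M$ is an umbilical submanifold of $(N,c_N)$, that is, the trace-free part of its second fundamental form $\Pi(D^N_XY)$ is zero, then $\varPhi:(Q_M+Q,\mathcal J)\to(Q_N,\mathcal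 J_N)$ is holomorphic. Conversely, if $(\dim M,\dim N)\neq(2,4)$ and $\varPhi:(Q_M+Q,\mathcal J)\to(Q_N,\mathcal J_N)$ is holomorphic, then $M$ is an umbilical submanifold of $(N,c_N)$. (ii) If $\dim M\geq4$ then $\varPhi:(Q_M+Q,\mathcal J')\to(Q_N,\mathcal J'_N)$ is holomorphic if and only if $\varphi$ is geodesic, that is, $D^N_X(\mathrm d\varphi\,Y)=\mathrm d\varphi(D^M_XY)$ for all vector fields $X$, $Y$ on $M$. -/

import Mathlib

open scoped Manifold ContDiff Topology TensorProduct Bundle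

noncomputable section

namespace TwistorWeyl

/-! ### Linear algebra -/

section LinearAlgebra

variable {V : Type*} [AddCommGroup V] [Module ℝ V]

/-- The eigenspace, corresponding to `-i`, of the complexification of `J`. If `J` is an orthogonal
complex structure, this is the maximal isotropic subspace of `V ⊗ ℂ` determined by `J`. -/
def minusISpace (J : V →ₗ[ℝ] V) : Submodule ℂ (ℂ ⊗[ℝ] V) :=
  Module.End.eigenspace (J.baseChange ℂ) (-Complex.I)

/-- A basis of the form `(e₀, J e₀, e₂, J e₂, …)`. -/
def IsAdapted {d : ℕ} (J : V →ₗ[ℝ] V) (b : Fin d → V) : Prop :=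
  ∀ i j : Fin d, Even i.val → j.val = i.val + 1 → J (b i) = b j

end LinearAlgebra

/-! ### Distributions on the total space of a vector bundle -/

section Total

variable {d : ℕ} {M : Type*} [TopologicalSpace M] [ChartedSpace (EuclideanSpace ℝ (Fin d)) M]
  {F : Type*} [NormedAddCommGroup F] [NormedSpace ℝ F]
  {V : M → Type*} [TopologicalSpace (Bundle.TotalSpace F V)]
  [∀ x, AddCommMonoid (V x)] [∀ x, Module ℝ (V x)] [∀ x, TopologicalSpace (V x)]
  [FiberBundle F V]

/-- `v`, a tangent vector at `z` to the total space, is the vertical vector corresponding to the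
element `A` of the fibre: the velocity at `0` of `t ↦ z + t A`. -/
def IsVerticalLift (z : Bundle.TotalSpace F V) (A : V z.proj)
    (v : TangentSpace ((𝓡 d).prod 𝓘(ℝ, F)) z) : Prop :=
  tangentMap 𝓘(ℝ, ℝ) ((𝓡 d).prod 𝓘(ℝ, F))
    (fun t : ℝ => Bundle.TotalSpace.mk' F z.proj (z.2 + t • A)) ⟨(0 : ℝ), (1 : ℝ)⟩ = ⟨z, v⟩

/-- The horizontal space at `z` of a connection on the bundle, the connection being given by the
relation `parallel s x X` (meaning `∇_X s = 0` at `x`): it is formed of the vectors `ds(X)`, where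
`s` is a smooth local section through `z` with `∇_X s = 0`. -/
def horizontalSpace (parallel : (Π x : M, V x) → (x : M) → TangentSpace (𝓡 d) x → Prop)
    (z : Bundle.TotalSpace F V) : Submodule ℝ (TangentSpace ((𝓡 d).prod 𝓘(ℝ, F)) z) :=
  Submodule.span ℝ {v | ∃ (s : Π x : M, V x) (X : TangentSpace (𝓡 d) z.proj),
    ContMDiffAt (𝓡 d) ((𝓡 d).prod 𝓘(ℝ, F)) ∞ (fun x => Bundle.TotalSpace.mk' F x (s x)) z.proj ∧
    parallel s z.proj X ∧
    tangentMap (𝓡 d) ((𝓡 d).prod 𝓘(ℝ, F)) (fun x => Bundle.TotalSpace.mk' F x (s x))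
      ⟨z.proj, X⟩ = ⟨z, v⟩}

/-- `{W ∈ H ⊗ ℂ | dπ(W) ∈ p}`, where `π` is the bundle projection. -/
def horizontalLift (z : Bundle.TotalSpace F V)
    (H : Submodule ℝ (TangentSpace ((𝓡 d).prod 𝓘(ℝ, F)) z))
    (p : Submodule ℂ (ℂ ⊗[ℝ] TangentSpace (𝓡 d) z.proj)) :
    Submodule ℂ (ℂ ⊗[ℝ] TangentSpace ((𝓡 d).prod 𝓘(ℝ, F)) z) :=
  H.baseChange ℂ ⊓ p.comap
    ((mfderiv ((𝓡 d).prod 𝓘(ℝ, F)) (𝓡 d)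
      (Bundle.TotalSpace.proj : Bundle.TotalSpace F V → M) z).toLinearMap.baseChange ℂ)

/-- For `K` a real space of vertical vectors at `z` with complex structure `𝕁` and
`ε = i`: the space spanned by all `v + i 𝕁 v`, which is the eigenspace of `𝕁` corresponding to `-i`,
that is, the `(0,1)`-part of the complexification of `K`. For `ε = -i`: the `(1,0)`-part. -/
def verticalPart (z : Bundle.TotalSpace F V) (K : Set (V z.proj)) (𝕁 : V z.proj → V z.proj)
    (ε : ℂ) : Submodule ℂ (ℂ ⊗[ℝ] TangentSpace ((𝓡 d).prod 𝓘(ℝ, F)) z) :=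
  Submodule.span ℂ {W | ∃ A ∈ K, ∃ v w : TangentSpace ((𝓡 d).prod 𝓘(ℝ, F)) z,
    IsVerticalLift z A v ∧ IsVerticalLift z (𝕁 A) w ∧ W = (1 : ℂ) ⊗ₜ[ℝ] v + ε ⊗ₜ[ℝ] w}

end Total

/-- Let `S ⊆ Z` and `S' ⊆ Z'` be submanifolds endowed with complex distributions `𝒢` and `𝒢'`,
and let `Φ : Z → Z'` be differentiable along `S`. Then `Φ : (S, 𝒢) → (S', 𝒢')` is holomorphic if
`Φ(S) ⊆ S'` and `dΦ(𝒢) ⊆ 𝒢'`. -/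
def IsHolomorphic {E : Type*} [NormedAddCommGroup E] [NormedSpace ℝ E]
    {H : Type*} [TopologicalSpace H] (I : ModelWithCorners ℝ E H)
    {E' : Type*} [NormedAddCommGroup E'] [NormedSpace ℝ E']
    {H' : Type*} [TopologicalSpace H'] (I' : ModelWithCorners ℝ E' H')
    {Z : Type*} [TopologicalSpace Z] [ChartedSpace H Z]
    {Z' : Type*} [TopologicalSpace Z'] [ChartedSpace H' Z']
    (S : Set Z) (𝒢 : Π z : Z, Submodule ℂ (ℂ ⊗[ℝ] TangentSpace I z))
    (S' : Set Z') (𝒢' : Π z : Z', Submodule ℂ (ℂ ⊗[ℝ] TangentSpace I' z))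
    (Φ : Z → Z') : Prop :=
  Set.MapsTo Φ S S' ∧ ∀ z ∈ S, MDifferentiableAt I I' Φ z ∧
    ∀ W ∈ 𝒢 z, (mfderiv I I' Φ z).toLinearMap.baseChange ℂ W ∈ 𝒢' (Φ z)

/-! ### Oriented conformal manifolds and Weyl spaces -/

section Weyl

variable {d : ℕ} {M : Type*} [TopologicalSpace M] [ChartedSpace (EuclideanSpace ℝ (Fin d)) M]
  [IsManifold (𝓡 d) ∞ M]

/-- Smooth Riemannian metrics on `M`. A metric is used only as a representative of its conformal
class: all the notions below depend only on this class. -/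
abbrev Metric (d : ℕ) (M : Type*) [TopologicalSpace M]
    [ChartedSpace (EuclideanSpace ℝ (Fin d)) M] [IsManifold (𝓡 d) ∞ M] :=
  Bundle.ContMDiffRiemannianMetric (𝓡 d) ∞ (EuclideanSpace ℝ (Fin d))
    (TangentSpace (𝓡 d) : M → Type _)

/-- Affine connections on `M`; `D Y x X` is `D_X Y` at `x`. -/
abbrev Connection (d : ℕ) (M : Type*) [TopologicalSpace M]
    [ChartedSpace (EuclideanSpace ℝ (Fin d)) M] [IsManifold (𝓡 d) ∞ M] :=
  CovariantDerivative (𝓡 d) (EuclideanSpace ℝ (Fin d)) (TangentSpace (𝓡 d) : M → Type _)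

/-- `Y` is a vector field which is smooth at `x`. -/
def SmoothFieldAt (Y : Π x : M, TangentSpace (𝓡 d) x) (x : M) : Prop :=
  ContMDiffAt (𝓡 d) ((𝓡 d).prod 𝓘(ℝ, EuclideanSpace ℝ (Fin d))) ∞
    (fun y => Bundle.TotalSpace.mk' (EuclideanSpace ℝ (Fin d)) y (Y y)) x

/-- An orientation of the manifold: a choice of orientations of the tangent spaces which is locally
constant in the local trivializations of the tangent bundle. -/
def IsManifoldOrientation (o : Π x : M, Orientation ℝ (TangentSpace (𝓡 d) x) (Fin d)) : Prop :=
  ∀ x₀ : M, ∀ᶠ x in 𝓝 x₀,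
    ∀ (h₀ : x₀ ∈ (trivializationAt (EuclideanSpace ℝ (Fin d))
        (TangentSpace (𝓡 d) : M → Type _) x₀).baseSet)
      (h : x ∈ (trivializationAt (EuclideanSpace ℝ (Fin d))
        (TangentSpace (𝓡 d) : M → Type _) x₀).baseSet),
    Orientation.map (Fin d) ((trivializationAt (EuclideanSpace ℝ (Fin d))
        (TangentSpace (𝓡 d) : M → Type _) x₀).linearEquivAt ℝ x h) (o x) =
    Orientation.map (Fin d) ((trivializationAt (EuclideanSpace ℝ (Fin d))
        (TangentSpace (𝓡 d) : M → Type _) x₀).linearEquivAt ℝ x₀ h₀) (o x₀)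

/-- `D` is a Weyl connection of the conformal class of `g`: it is smooth, torsion-free and it
preserves the conformal class, that is, `D g = α ⊗ g` for some one-form `α`. -/
structure IsWeylConnection (g : Metric d M) (D : Connection d M) : Prop where
  smooth : D.ContMDiffCovariantDerivative ∞
  torsionFree : ∀ (X Y : Π x : M, TangentSpace (𝓡 d) x) (x : M),
    SmoothFieldAt X x → SmoothFieldAt Y x →
    D Y x (X x) - D X x (Y x) = VectorField.mlieBracket (𝓡 d) X Y x
  conformal : ∃ α : Π x : M, TangentSpace (𝓡 d) x →L[ℝ] ℝ,
    ∀ (Y Z : Π x : M, TangentSpace (𝓡 d) x) (x : M), SmoothFieldAt Y x → SmoothFieldAt Z x →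
    ∀ X : TangentSpace (𝓡 d) x,
    NormedSpace.fromTangentSpace _
        (mfderiv (𝓡 d) 𝓘(ℝ, ℝ) (fun y => g.inner y (Y y) (Z y)) x X)
      - g.inner x (D Y x X) (Z x) - g.inner x (Y x) (D Z x X) = α x X * g.inner x (Y x) (Z x)

/-! ### The bundle of positive maximal isotropic spaces of a Weyl space -/

/-- The bundle of endomorphisms of the tangent bundle. -/
abbrev EndTangent (d : ℕ) (M : Type*) [TopologicalSpace M]
    [ChartedSpace (EuclideanSpace ℝ (Fin d)) M] : M → Type _ :=
  fun x => TangentSpace (𝓡 d) x →L[ℝ] TangentSpace (𝓡 d) x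

/-- The model fibre of `EndTangent`. -/
abbrev EndModel (d : ℕ) := EuclideanSpace ℝ (Fin d) →L[ℝ] EuclideanSpace ℝ (Fin d)

/-- The set of positive orthogonal complex structures on `T_xM`; equivalently, by associating to
`J` its eigenspace `minusISpace J`, the set of positive maximal isotropic subspaces of
`T_xM ⊗ ℂ`. -/
def posComplexStructures (g : Metric d M)
    (o : Π x : M, Orientation ℝ (TangentSpace (𝓡 d) x) (Fin d)) (x : M) :
    Set (EndTangent d M x) :=
  {J | (∀ v, J (J v) = -v) ∧ (∀ v w, g.inner x (J v) (J w) = g.inner x v w) ∧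
    ∃ b : Module.Basis (Fin d) ℝ (TangentSpace (𝓡 d) x),
      b.orientation = o x ∧ IsAdapted J.toLinearMap b}

/-- The total space of the bundle of positive maximal isotropic spaces, as a submanifold of the
total space of the bundle of endomorphisms. -/
def twistorSet (g : Metric d M)
    (o : Π x : M, Orientation ℝ (TangentSpace (𝓡 d) x) (Fin d)) :
    Set (Bundle.TotalSpace (EndModel d) (EndTangent d M)) :=
  {z | z.2 ∈ posComplexStructures g o z.proj}

/-- The covariant derivative `(D_X s)(Y) = D_X(s Y) - s(D_X Y)` of the section `s` of the bundle of
endomorphisms is zero at `x`. -/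
def EndParallel (D : Connection d M) (s : Π x : M, EndTangent d M x) (x : M)
    (X : TangentSpace (𝓡 d) x) : Prop :=
  ∀ Y : Π x : M, TangentSpace (𝓡 d) x, SmoothFieldAt Y x →
    D (fun y => s y (Y y)) x X = s x (D Y x X)

/-- The tangent space at `J` to the manifold of orthogonal complex structures on `T_xM`: the
skew-adjoint endomorphisms which anticommute with `J`. It is a complex vector space, where
multiplication by `i` is `A ↦ J A`; this is the complex structure given by the embedding
`J ↦ minusISpace J` into the complex Grassmannian. -/
def fibreTangent (g : Metric d M) (x : M) (J : EndTangent d M x) : Set (EndTangent d M x) :=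
  {A | (∀ v w, g.inner x (A v) w = -g.inner x v (A w)) ∧ ∀ v, A (J v) = -J (A v)}

/-- With `ε = i`: the distribution `𝒢`, the eigenbundle corresponding to `-i` of the almost complex
structure `𝒥` on the bundle of positive maximal isotropic spaces. With `ε = -i`: the same
for `𝒢'` and `𝒥'`. -/
def twistorDistribution (g : Metric d M) (D : Connection d M) (ε : ℂ)
    (z : Bundle.TotalSpace (EndModel d) (EndTangent d M)) :
    Submodule ℂ (ℂ ⊗[ℝ] TangentSpace ((𝓡 d).prod 𝓘(ℝ, EndModel d)) z) :=
  horizontalLift z (horizontalSpace (EndParallel D) z) (minusISpace z.2.toLinearMap) ⊔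
    verticalPart z (fibreTangent g z.proj z.2) (fun A => z.2 ∘L A) ε

end Weyl

/-! ### Immersions -/

section Immersion

variable {m k : ℕ}
  {M : Type*} [TopologicalSpace M] [ChartedSpace (EuclideanSpace ℝ (Fin m)) M]
  [IsManifold (𝓡 m) ∞ M]
  {N : Type*} [TopologicalSpace N] [ChartedSpace (EuclideanSpace ℝ (Fin (m + k))) N]
  [IsManifold (𝓡 (m + k)) ∞ N]

/-- The differential of `φ`. -/
abbrev dif (φ : C^∞⟮𝓡 m, M; 𝓡 (m + k), N⟯) (x : M) :
    TangentSpace (𝓡 m) x →L[ℝ] TangentSpace (𝓡 (m + k)) (φ x) :=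
  mfderiv (𝓡 m) (𝓡 (m + k)) φ x

/-- `φ` is a conformal immersion: `φ^* g_N` is, at each point, a positive multiple of `g_M`. -/
def IsConformalImmersion (gM : Metric m M) (gN : Metric (m + k) N)
    (φ : C^∞⟮𝓡 m, M; 𝓡 (m + k), N⟯) : Prop :=
  ∀ x : M, ∃ r : ℝ, 0 < r ∧ ∀ v w : TangentSpace (𝓡 m) x,
    gN.inner (φ x) (dif φ x v) (dif φ x w) = r * gM.inner x v w

/-- The normal space `(T_xM)^⊥ ⊆ T_{φ(x)}N`. -/
def normalSpace (gN : Metric (m + k) N) (φ : C^∞⟮𝓡 m, M; 𝓡 (m + k), N⟯) (x : M) :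
    Submodule ℝ (TangentSpace (𝓡 (m + k)) (φ x)) where
  carrier := {w | ∀ v : TangentSpace (𝓡 m) x, gN.inner (φ x) w (dif φ x v) = 0}
  add_mem' := by
    intro a b ha hb v
    have ha' := ha v
    have hb' := hb v
    simp [ha', hb']
  zero_mem' := by intro v; simp
  smul_mem' := by
    intro c a ha v
    have ha' := ha v
    simp [ha']

/-- The map `T_{φ(x)}N → T_xM` which associates to `w` the unique `v` such that
`g_N(dφ v, dφ u) = g_N(w, dφ u)` for every `u`: the orthogonal projection onto `dφ(T_xM)`, followed
by the inverse of `dφ`. -/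
def tangentialPart (gN : Metric (m + k) N) (φ : C^∞⟮𝓡 m, M; 𝓡 (m + k), N⟯) (x : M) :
    TangentSpace (𝓡 (m + k)) (φ x) →L[ℝ] TangentSpace (𝓡 m) x :=
  let R : TangentSpace (𝓡 (m + k)) (φ x) →L[ℝ] (TangentSpace (𝓡 m) x →L[ℝ] ℝ) :=
    (ContinuousLinearMap.precomp ℝ (dif φ x)) ∘L gN.inner (φ x)
  (R ∘L dif φ x).inverse ∘L R

/-- The orthogonal projection `Π` onto the normal space. -/
def normalProj (gN : Metric (m + k) N) (φ : C^∞⟮𝓡 m, M; 𝓡 (m + k), N⟯) (x : M) :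
    TangentSpace (𝓡 (m + k)) (φ x) →L[ℝ] TangentSpace (𝓡 (m + k)) (φ x) :=
  ContinuousLinearMap.id ℝ _ - dif φ x ∘L tangentialPart gN φ x

/-- `U`, a vector field along `φ` (that is, a section of `φ^*TN`), is smooth at `x`. -/
def SmoothAlongAt (φ : C^∞⟮𝓡 m, M; 𝓡 (m + k), N⟯)
    (U : Π x : M, TangentSpace (𝓡 (m + k)) (φ x)) (x : M) : Prop :=
  ContMDiffAt (𝓡 m) ((𝓡 (m + k)).prod 𝓘(ℝ, EuclideanSpace ℝ (Fin (m + k)))) ∞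
    (fun y => Bundle.TotalSpace.mk' (EuclideanSpace ℝ (Fin (m + k)))
      (E := (TangentSpace (𝓡 (m + k)) : N → Type _)) (φ y) (U y)) x

/-- The covariant derivative at `x`, along `X`, of the vector field `U` along `φ`, with respect to
the connection induced by `D` on `φ^*TN`. If `(F_i)` is the local frame of `N` given by the
trivialization of `TN` at `φ(x)` and `U = ∑ u_i (F_i ∘ φ)`, this is
`∑ X(u_i) F_i + ∑ u_i D_{dφ(X)} F_i`. -/
def covAlong (D : Connection (m + k) N) (φ : C^∞⟮𝓡 m, M; 𝓡 (m + k), N⟯)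
    (U : Π x : M, TangentSpace (𝓡 (m + k)) (φ x)) (x : M) (X : TangentSpace (𝓡 m) x) :
    TangentSpace (𝓡 (m + k)) (φ x) :=
  let e := trivializationAt (EuclideanSpace ℝ (Fin (m + k)))
    (TangentSpace (𝓡 (m + k)) : N → Type _) (φ x)
  let frame : Fin (m + k) → Π y : N, TangentSpace (𝓡 (m + k)) y :=
    fun i y => e.symm y (EuclideanSpace.single i (1 : ℝ))
  let u : Fin (m + k) → M → ℝ := fun i y => (e ⟨φ y, U y⟩).2 i
  ∑ i, (NormedSpace.fromTangentSpace _ (mfderiv (𝓡 m) 𝓘(ℝ, ℝ) (u i) x X) • frame i (φ x) +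
    u i x • D (frame i) (φ x) (dif φ x X))

/-- `M` is an umbilical submanifold: the second fundamental form `Π(D_X Y)` is
equal to `g_M ⊗ ξ` for some normal vector `ξ` at each point; this does not depend on the Weyl
connection `D` of `N`. -/
def IsUmbilical (gM : Metric m M) (gN : Metric (m + k) N) (D : Connection (m + k) N)
    (φ : C^∞⟮𝓡 m, M; 𝓡 (m + k), N⟯) : Prop :=
  ∀ x : M, ∃ ξ ∈ normalSpace gN φ x, ∀ (Y : Π x : M, TangentSpace (𝓡 m) x),
    SmoothFieldAt Y x → ∀ X : TangentSpace (𝓡 m) x,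
    normalProj gN φ x (covAlong D φ (fun y => dif φ y (Y y)) x X) = gM.inner x X (Y x) • ξ

/-- `φ : (M, D_M) → (N, D_N)` is geodesic: `(D dφ)(X, Y) = D_N,X (dφ Y) - dφ(D_M,X Y)` is zero. -/
def IsGeodesicMap (DM : Connection m M) (DN : Connection (m + k) N)
    (φ : C^∞⟮𝓡 m, M; 𝓡 (m + k), N⟯) : Prop :=
  ∀ (x : M) (Y : Π x : M, TangentSpace (𝓡 m) x), SmoothFieldAt Y x →
    ∀ X : TangentSpace (𝓡 m) x,
    covAlong DN φ (fun y => dif φ y (Y y)) x X = dif φ x (DM Y x X)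

/-- The basis `c` of the normal space is positive: `(dφ(b), c)` is positive on `N` for every positive
basis `b` of `T_xM`. -/
def IsPositiveNormalBasis (gN : Metric (m + k) N)
    (oM : Π x : M, Orientation ℝ (TangentSpace (𝓡 m) x) (Fin m))
    (oN : Π y : N, Orientation ℝ (TangentSpace (𝓡 (m + k)) y) (Fin (m + k)))
    (φ : C^∞⟮𝓡 m, M; 𝓡 (m + k), N⟯) (x : M)
    (c : Module.Basis (Fin k) ℝ (normalSpace gN φ x)) : Prop :=
  ∀ b : Module.Basis (Fin m) ℝ (TangentSpace (𝓡 m) x), b.orientation = oM x →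
    ∃ a : Module.Basis (Fin (m + k)) ℝ (TangentSpace (𝓡 (m + k)) (φ x)),
      a.orientation = oN (φ x) ∧
      ⇑a = Fin.append (fun i => dif φ x (b i))
        (fun j => (c j : TangentSpace (𝓡 (m + k)) (φ x)))

/-- `φ` preserves the orientations (used only for `dim M = dim N`). -/
def PreservesOrientation
    (oM : Π x : M, Orientation ℝ (TangentSpace (𝓡 m) x) (Fin m))
    (oN : Π y : N, Orientation ℝ (TangentSpace (𝓡 (m + k)) y) (Fin (m + k)))
    (φ : C^∞⟮𝓡 m, M; 𝓡 (m + k), N⟯) : Prop :=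
  ∀ (x : M) (hk : m = m + k) (b : Module.Basis (Fin m) ℝ (TangentSpace (𝓡 m) x)),
    b.orientation = oM x →
    ∃ a : Module.Basis (Fin (m + k)) ℝ (TangentSpace (𝓡 (m + k)) (φ x)),
      a.orientation = oN (φ x) ∧ ∀ i, a (Fin.cast hk i) = dif φ x (b i)

/-- The endomorphisms of the normal space, extended by zero on `dφ(T_xM)`. -/
def normalEnd (gN : Metric (m + k) N) (φ : C^∞⟮𝓡 m, M; 𝓡 (m + k), N⟯) (x : M) :
    Set (EndTangent (m + k) N (φ x)) :=
  {K | (∀ v : TangentSpace (𝓡 m) x, K (dif φ x v) = 0) ∧ ∀ w, K w ∈ normalSpace gN φ x}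

/-- The set of positive orthogonal complex structures on the normal space; equivalently (through
the eigenspaces corresponding to `-i`) the set of its positive maximal isotropic spaces. -/
def posNormalComplexStructures (gN : Metric (m + k) N)
    (oM : Π x : M, Orientation ℝ (TangentSpace (𝓡 m) x) (Fin m))
    (oN : Π y : N, Orientation ℝ (TangentSpace (𝓡 (m + k)) y) (Fin (m + k)))
    (φ : C^∞⟮𝓡 m, M; 𝓡 (m + k), N⟯) (x : M) : Set (EndTangent (m + k) N (φ x)) :=
  {K | K ∈ normalEnd gN φ x ∧
    (∀ w ∈ normalSpace gN φ x, K (K w) = -w) ∧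
    (∀ w ∈ normalSpace gN φ x, ∀ w' ∈ normalSpace gN φ x,
      gN.inner (φ x) (K w) (K w') = gN.inner (φ x) w w') ∧
    ∃ c : Module.Basis (Fin k) ℝ (normalSpace gN φ x), IsPositiveNormalBasis gN oM oN φ x c ∧
      IsAdapted K.toLinearMap (fun j => (c j : TangentSpace (𝓡 (m + k)) (φ x)))}

/-- The vector bundle `End(TM) ⊕ φ^*(End(TN))` over `M`. -/
abbrev SumBundle (φ : C^∞⟮𝓡 m, M; 𝓡 (m + k), N⟯) : M → Type _ :=
  EndTangent m M ×ᵇ (φ *ᵖ (EndTangent (m + k) N))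

/-- The model fibre of `SumBundle`. -/
abbrev SumModel (m k : ℕ) := EndModel m × EndModel (m + k)

/-- The endomorphism of `T_{φ(x)}N` underlying the second component of an element of
`SumBundle`. -/
def normalComponent (φ : C^∞⟮𝓡 m, M; 𝓡 (m + k), N⟯) (x : M) (A : SumBundle φ x) :
    EndTangent (m + k) N (φ x) := A.2

/-- The total space of `Q_M + Q`, as a submanifold of the total space of `SumBundle`. -/
def sumTwistorSet (gM : Metric m M) (gN : Metric (m + k) N)
    (oM : Π x : M, Orientation ℝ (TangentSpace (𝓡 m) x) (Fin m))
    (oN : Π y : N, Orientation ℝ (TangentSpace (𝓡 (m + k)) y) (Fin (m + k)))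
    (φ : C^∞⟮𝓡 m, M; 𝓡 (m + k), N⟯) :
    Set (Bundle.TotalSpace (SumModel m k) (SumBundle φ)) :=
  {z | z.2.1 ∈ posComplexStructures gM oM z.proj ∧
    normalComponent φ z.proj z.2 ∈ posNormalComplexStructures gN oM oN φ z.proj}

/-- The section `(s, t)` of `End(TM) ⊕ End((TM)^⊥)` is parallel at `x` along `X`, with respect to
the connections induced by `D_M` and `Π ∘ D_N`. -/
def SumParallel (gN : Metric (m + k) N) (DM : Connection m M) (DN : Connection (m + k) N)
    (φ : C^∞⟮𝓡 m, M; 𝓡 (m + k), N⟯) (s : Π x : M, SumBundle φ x) (x : M)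
    (X : TangentSpace (𝓡 m) x) : Prop :=
  (∀ᶠ y in 𝓝 x, normalComponent φ y (s y) ∈ normalEnd gN φ y) ∧
  EndParallel DM (fun y => (s y).1) x X ∧
  ∀ U : Π x : M, TangentSpace (𝓡 (m + k)) (φ x), SmoothAlongAt φ U x →
    (∀ᶠ y in 𝓝 x, U y ∈ normalSpace gN φ y) →
    normalProj gN φ x (covAlong DN φ (fun y => normalComponent φ y (s y) (U y)) x X) =
      normalComponent φ x (s x) (normalProj gN φ x (covAlong DN φ U x X))

/-- The tangent space to the fibre of `Q_M + Q` at `(J, K)`. -/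
def sumFibreTangent (gM : Metric m M) (gN : Metric (m + k) N)
    (φ : C^∞⟮𝓡 m, M; 𝓡 (m + k), N⟯) (x : M) (J : SumBundle φ x) : Set (SumBundle φ x) :=
  {A | A.1 ∈ fibreTangent gM x J.1 ∧
    normalComponent φ x A ∈ normalEnd gN φ x ∧
    normalComponent φ x A ∈ fibreTangent gN (φ x) (normalComponent φ x J)}

/-- With `ε = i`: the eigenbundle corresponding to `-i` of the almost complex structure `𝒥` on
`Q_M + Q`. With `ε = -i`: the same for `𝒥'`. -/
def sumTwistorDistribution (gM : Metric m M) (gN : Metric (m + k) N)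
    (DM : Connection m M) (DN : Connection (m + k) N)
    (φ : C^∞⟮𝓡 m, M; 𝓡 (m + k), N⟯) (ε : ℂ)
    (z : Bundle.TotalSpace (SumModel m k) (SumBundle φ)) :
    Submodule ℂ (ℂ ⊗[ℝ] TangentSpace ((𝓡 m).prod 𝓘(ℝ, SumModel m k)) z) :=
  horizontalLift z (horizontalSpace (SumParallel gN DM DN φ) z)
      (minusISpace z.2.1.toLinearMap) ⊔
    verticalPart z (sumFibreTangent gM gN φ z.proj z.2)
      (fun A => (z.2.1 ∘L A.1,
        (normalComponent φ z.proj z.2 ∘L normalComponent φ z.proj A :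
          EndTangent (m + k) N (φ z.proj)))) ε

/-- The map `(p, q) ↦ p ⊕ q`. In terms of orthogonal complex structures, it associates to
`J` on `T_xM` and `K` on `(T_xM)^⊥` their direct sum, on `T_{φ(x)}N = dφ(T_xM) ⊕ (T_xM)^⊥`. -/
def directSumMap (gN : Metric (m + k) N) (φ : C^∞⟮𝓡 m, M; 𝓡 (m + k), N⟯)
    (z : Bundle.TotalSpace (SumModel m k) (SumBundle φ)) :
    Bundle.TotalSpace (EndModel (m + k)) (EndTangent (m + k) N) :=
  ⟨φ z.proj, dif φ z.proj ∘L z.2.1 ∘L tangentialPart gN φ z.proj + normalComponent φ z.proj z.2⟩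

end Immersion

end TwistorWeyl

end

open scoped Manifold ContDiff Topology TensorProduct Bundle

set_option linter.unusedSectionVars false

noncomputable section

namespace TwistorWeyl

open Bundle Filter

/-! ### Topologies of the total spaces -/

section Topologies

variable {d : ℕ} {M : Type*} [TopologicalSpace M] [ChartedSpace (EuclideanSpace ℝ (Fin d)) M]
  [IsManifold (𝓡 d) ∞ M]

/-! A positive maximal isotropic space is represented by the orthogonal complex structure `J` of
which it is the `-i` eigenspace. The connection splits a tangent vector of the endomorphism bundle
into its base part and its vertical component `vert`. Let `ε = σ i` with `σ = 1` for the first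
almost complex structure and `σ = -1` for the second. If `a + i b` lies in the distribution at `J`,
then `b` projects to `J` of the projection of `a`, and `vert b = σ J ∘ vert a`; conversely these
relations suffice when `vert a` is tangent to the fibre (`ofReIm_mem_twistorDistribution`,
`vert_of_mem_twistorDistribution`).

Put `S = J ⊕ K` and let `H = D dφ` be the `hessian`. On vertical vectors the direct sum map is
complex linear, so only horizontal vectors matter. The image of a horizontal vector over `X` has
vertical component `L_X` with `L_X (dφ v) = H(X, J v) - S H(X, v)`, with zero normal-normal block
and skew mixed blocks (`sumVert_horizontal`). Hence `L_X` is skew, anticommutes with `S`, and is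
determined by its values on `dφ(TM)`. Holomorphicity becomes the algebraic condition `H(J u, J v) -
S H(J u, v) = σ (S H(u, J v) + H(u, v))` for all admissible `J`, `K`
(`directSumMap_holomorphicAt_iff`).

Torsion-freeness makes `H` symmetric. Differentiating the conformality relation shows that the
symmetric part of `g(H(X, ·), dφ ·)` is a multiple `c(X)` of the metric of `M`. The Koszul trick
then expresses the whole tangential part of `H` through the one-form `c`, and the tangential parts
of the left side and of the bracket on the right turn out to be the same for every `J`
(`hessian_tangential`).

For `σ = 1` only the normal part remains. Let `II` be the normal part of `H`. On the diagonal the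
condition reads `II(Ju, Ju) = II(u, u) + 2 K II(u, Ju)`. An umbilical `II` satisfies the full normal
condition. Conversely the last term is removed by comparing structures with opposite values: `J u =
v` and `J' u = -v` if `dim M ≥ 4`, or `K w = n` and `K' w = -n` if the normal space has dimension at
least 4. If `dim M = 2` and the codimension is 2, orientation leaves one `J` and one `K`, and the
argument is not available. Then `II` takes equal values on orthogonal vectors of equal length, so it
is a multiple of the metric (`exists_eq_smul_of_orthogonal`).

For `σ = -1` the normal part says `II(Ju, Ju) = -II(u, u)`. Three pairwise orthogonal vectors of
equal length force `II = 0`. The tangential parts are equal and opposite, which forces `c = 0`.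
Hence `H = 0`, which is geodesy; the converse is immediate. -/

@[reducible]
def totalTangentTopology :
    TopologicalSpace (TotalSpace (EuclideanSpace ℝ (Fin d)) (TangentSpace (𝓡 d) (M := M))) :=
  inferInstance

@[reducible]
def totalEndTopology : TopologicalSpace (TotalSpace (EndModel d) (EndTangent d M)) :=
  inferInstance

@[reducible]
def totalSumTopology {m k : ℕ}
    {M : Type*} [TopologicalSpace M] [ChartedSpace (EuclideanSpace ℝ (Fin m)) M]
    [IsManifold (𝓡 m) ∞ M]
    {N : Type*} [TopologicalSpace N] [ChartedSpace (EuclideanSpace ℝ (Fin (m + k))) N]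
    [IsManifold (𝓡 (m + k)) ∞ N] (φ : C^∞⟮𝓡 m, M; 𝓡 (m + k), N⟯) :
    TopologicalSpace (TotalSpace (SumModel m k) (SumBundle φ)) :=
  inferInstance

end Topologies

attribute [local instance] totalTangentTopology totalEndTopology totalSumTopology

/-! ### The complexification of a real vector space -/

section ComplexTensor

variable {V V' : Type*} [AddCommGroup V] [Module ℝ V] [AddCommGroup V'] [Module ℝ V']

/-- The element `a + i b` of the complexification of `V`. -/
def ofReIm (a b : V) : ℂ ⊗[ℝ] V := (1 : ℂ) ⊗ₜ[ℝ] a + Complex.I ⊗ₜ[ℝ] b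

theorem ofReIm_add (a b a' b' : V) :
    ofReIm a b + ofReIm a' b' = ofReIm (a + a') (b + b') := by
  simp only [ofReIm, TensorProduct.tmul_add]; abel

theorem smul_ofReIm (c : ℂ) (a b : V) :
    c • ofReIm a b = ofReIm (c.re • a - c.im • b) (c.im • a + c.re • b) := by
  have h1 : c * 1 = c.re • (1 : ℂ) + c.im • Complex.I := by
    apply Complex.ext <;> simp
  have h2 : c * Complex.I = (-c.im) • (1 : ℂ) + c.re • Complex.I := by
    apply Complex.ext <;> simp
  simp only [ofReIm, smul_add, TensorProduct.smul_tmul', smul_eq_mul, h1, h2]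
  simp only [TensorProduct.add_tmul, TensorProduct.smul_tmul, TensorProduct.tmul_add, sub_eq_add_neg,
    neg_smul, TensorProduct.tmul_neg, TensorProduct.neg_tmul]
  abel

theorem exists_ofReIm (W : ℂ ⊗[ℝ] V) : ∃ a b : V, W = ofReIm a b := by
  induction W with
  | zero => exact ⟨0, 0, by simp [ofReIm]⟩
  | tmul c v =>
    refine ⟨c.re • v, c.im • v, ?_⟩
    have := smul_ofReIm c v 0
    simpa [ofReIm, TensorProduct.smul_tmul'] using this
  | add x y hx hy =>
    obtain ⟨a, b, rfl⟩ := hx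
    obtain ⟨a', b', rfl⟩ := hy
    exact ⟨_, _, ofReIm_add _ _ _ _⟩

theorem ofReIm_inj {a b a' b' : V} : ofReIm a b = ofReIm a' b' ↔ a = a' ∧ b = b' := by
  refine ⟨fun h => ⟨?_, ?_⟩, fun h => by rw [h.1, h.2]⟩
  · have := congrArg (fun W => TensorProduct.lid ℝ V (LinearMap.rTensor V Complex.reLm W)) h
    simpa [ofReIm] using this
  · have := congrArg (fun W => TensorProduct.lid ℝ V (LinearMap.rTensor V Complex.imLm W)) h
    simpa [ofReIm] using this

theorem baseChange_ofReIm (f : V →ₗ[ℝ] V') (a b : V) :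
    f.baseChange ℂ (ofReIm a b) = ofReIm (f a) (f b) := by
  simp [ofReIm]

/-- Compare real and imaginary parts in `J a + i J b = -i (a + i b) = b - i a`. -/
theorem ofReIm_mem_minusISpace (J : V →ₗ[ℝ] V) (a b : V) :
    ofReIm a b ∈ minusISpace J ↔ J a = b ∧ J b = -a := by
  rw [minusISpace, Module.End.mem_eigenspace_iff, baseChange_ofReIm, smul_ofReIm, ofReIm_inj]
  simp

theorem ofReIm_mem_baseChange {H : Submodule ℝ V} {a b : V} :
    ofReIm a b ∈ H.baseChange ℂ ↔ a ∈ H ∧ b ∈ H := by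
  constructor
  · intro h
    have key : ∀ W ∈ H.baseChange ℂ, ∃ a ∈ H, ∃ b ∈ H, W = ofReIm a b := by
      intro W hW
      rw [Submodule.baseChange_eq_span] at hW
      induction hW using Submodule.span_induction with
      | mem x hx =>
        obtain ⟨v, hv, rfl⟩ := hx
        exact ⟨v, hv, 0, H.zero_mem, by simp [ofReIm]⟩
      | zero => exact ⟨0, H.zero_mem, 0, H.zero_mem, by simp [ofReIm]⟩
      | add x y _ _ hx hy =>
        obtain ⟨a, ha, b, hb, rfl⟩ := hx
        obtain ⟨a', ha', b', hb', rfl⟩ := hy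
        exact ⟨_, H.add_mem ha ha', _, H.add_mem hb hb', ofReIm_add _ _ _ _⟩
      | smul c x _ hx =>
        obtain ⟨a, ha, b, hb, rfl⟩ := hx
        exact ⟨_, H.sub_mem (H.smul_mem _ ha) (H.smul_mem _ hb), _,
          H.add_mem (H.smul_mem _ ha) (H.smul_mem _ hb), smul_ofReIm _ _ _⟩
    obtain ⟨a', ha, b', hb, h⟩ := key _ h
    obtain ⟨rfl, rfl⟩ := ofReIm_inj.1 h
    exact ⟨ha, hb⟩
  · rintro ⟨ha, hb⟩
    exact add_mem (Submodule.tmul_mem_baseChange_of_mem _ ha)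
      (Submodule.tmul_mem_baseChange_of_mem _ hb)

end ComplexTensor

/-! ### Existence of orthogonal complex structures -/

section Orthogonal

variable {V : Type*} [AddCommGroup V] [Module ℝ V]

/-- The complex structure `J` with `J b₀ = b₁`, `J b₂ = b₃`, and so on. -/
def basisComplexStructure {d : ℕ} (hd : Even d) (b : Module.Basis (Fin d) ℝ V) : V →ₗ[ℝ] V :=
  b.constr ℝ fun i => if h : Even i.val then
      b ⟨i.val + 1, by obtain ⟨a, ha⟩ := hd; obtain ⟨c, hc⟩ := h; have := i.2; omega⟩
    else -b ⟨i.val - 1, by have := i.2; omega⟩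

variable {d : ℕ} (hd : Even d) (b : Module.Basis (Fin d) ℝ V)

theorem basisComplexStructure_isAdapted : IsAdapted (basisComplexStructure hd b) b := by
  intro i j hi hj
  rw [basisComplexStructure, Module.Basis.constr_basis, dif_pos hi]
  congr 1
  exact Fin.ext hj.symm

theorem basisComplexStructure_odd {i j : Fin d} (hi : Even i.val) (hj : j.val = i.val + 1) :
    basisComplexStructure hd b (b j) = -b i := by
  have : ¬ Even j.val := by rw [hj]; exact Nat.not_even_iff_odd.2 hi.add_one
  rw [basisComplexStructure, Module.Basis.constr_basis, dif_neg this]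
  congr 2
  exact Fin.ext (by simp [hj])

theorem even_or_odd_pair {d : ℕ} (hd : Even d) (i : Fin d) :
    (Even i.val ∧ ∃ j : Fin d, j.val = i.val + 1) ∨
      ∃ j : Fin d, Even j.val ∧ i.val = j.val + 1 := by
  rcases Nat.even_or_odd i.val with h | h
  · left
    refine ⟨h, ⟨i.val + 1, ?_⟩, rfl⟩
    obtain ⟨a, ha⟩ := hd; obtain ⟨c, hc⟩ := h; have := i.2; omega
  · right
    obtain ⟨c, hc⟩ := h
    exact ⟨⟨i.val - 1, by have := i.2; omega⟩, ⟨c, by simp; omega⟩, by simp; omega⟩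

theorem basisComplexStructure_sq (v : V) :
    basisComplexStructure hd b (basisComplexStructure hd b v) = -v := by
  have : basisComplexStructure hd b ∘ₗ basisComplexStructure hd b = -LinearMap.id := by
    refine b.ext fun i => ?_
    simp only [LinearMap.comp_apply, LinearMap.neg_apply, LinearMap.id_apply]
    rcases even_or_odd_pair hd i with ⟨hi, j, hj⟩ | ⟨j, hj, hi⟩
    · rw [basisComplexStructure_isAdapted hd b i j hi hj, basisComplexStructure_odd hd b hi hj]
    · rw [basisComplexStructure_odd hd b hj hi, map_neg,
        basisComplexStructure_isAdapted hd b j i hj hi]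
  exact LinearMap.congr_fun this v

/-- The basis is permuted up to sign and its Gram matrix is scalar. When the two indices have
different parity, both entries of the Gram matrix vanish. -/
theorem basisComplexStructure_orthogonal (g : V →ₗ[ℝ] V →ₗ[ℝ] ℝ) (c : ℝ)
    (hb : ∀ i j, g (b i) (b j) = if i = j then c else 0) (v w : V) :
    g (basisComplexStructure hd b v) (basisComplexStructure hd b w) = g v w := by
  have : g.compl₁₂ (basisComplexStructure hd b) (basisComplexStructure hd b) = g := by
    refine LinearMap.ext_basis b b fun i k => ?_
    simp only [LinearMap.compl₁₂_apply]
    rcases even_or_odd_pair hd i with ⟨hi, j, hj⟩ | ⟨j, hj, hi⟩ <;>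
    rcases even_or_odd_pair hd k with ⟨hk, l, hl⟩ | ⟨l, hl, hk⟩
    · rw [basisComplexStructure_isAdapted hd b i j hi hj,
        basisComplexStructure_isAdapted hd b k l hk hl, hb, hb]
      simp only [Fin.ext_iff, hj, hl]; congr 1; simp
    · rw [basisComplexStructure_isAdapted hd b i j hi hj,
        basisComplexStructure_odd hd b hl hk, map_neg, hb, hb]
      obtain ⟨a, ha⟩ := hi
      obtain ⟨a', ha'⟩ := hl
      rw [if_neg (by rw [Fin.ext_iff]; omega), if_neg (by rw [Fin.ext_iff]; omega), neg_zero]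
    · rw [basisComplexStructure_odd hd b hj hi,
        basisComplexStructure_isAdapted hd b k l hk hl, map_neg, LinearMap.neg_apply, hb, hb]
      obtain ⟨a, ha⟩ := hk
      obtain ⟨a', ha'⟩ := hj
      rw [if_neg (by rw [Fin.ext_iff]; omega), if_neg (by rw [Fin.ext_iff]; omega), neg_zero]
    · rw [basisComplexStructure_odd hd b hj hi, basisComplexStructure_odd hd b hl hk]
      simp only [map_neg, LinearMap.neg_apply, neg_neg, hb, Fin.ext_iff, hi, hk]
      congr 1; simp
  exact LinearMap.congr_fun₂ this v w

/-- The basis obtained from `b` by changing the sign of `b n`. -/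
def flipBasis (b : Module.Basis (Fin d) ℝ V) (n : Fin d) : Module.Basis (Fin d) ℝ V :=
  b.unitsSMul (Function.update 1 n (-1))

theorem flipBasis_self (n : Fin d) : flipBasis b n n = -b n := by
  simp [flipBasis, Module.Basis.unitsSMul_apply]

theorem flipBasis_of_ne {n i : Fin d} (h : i ≠ n) : flipBasis b n i = b i := by
  simp [flipBasis, Module.Basis.unitsSMul_apply, Function.update_of_ne h]

/-- A set of bases which is closed, up to changing the sign of any vector of the basis. -/
def IsSignClosed (Pos : Module.Basis (Fin d) ℝ V → Prop) : Prop :=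
  ∀ b n, Pos b ∨ Pos (flipBasis b n)

/-- `J` is an orthogonal complex structure with an adapted basis in `Pos`. -/
def IsPosStructure (g : V →ₗ[ℝ] V →ₗ[ℝ] ℝ) (Pos : Module.Basis (Fin d) ℝ V → Prop)
    (J : V →ₗ[ℝ] V) : Prop :=
  (∀ v, J (J v) = -v) ∧ (∀ v w, g (J v) (J w) = g v w) ∧ ∃ b, Pos b ∧ IsAdapted J b

/-- Rescaling reduces this to the extension of an orthonormal family. The common square length `c`
is kept arbitrary so that the basis can start with a given vector `u`, without normalising it. -/
theorem exists_orthogonal_basis [FiniteDimensional ℝ V] (hdim : Module.finrank ℝ V = d)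
    (g : V →ₗ[ℝ] V →ₗ[ℝ] ℝ) (hsymm : ∀ v w, g v w = g w v) (hpos : ∀ v, v ≠ 0 → 0 < g v v)
    (s : Set (Fin d)) (u : Fin d → V) (c : ℝ) (hc : 0 < c)
    (hu : ∀ i ∈ s, ∀ j ∈ s, g (u i) (u j) = if i = j then c else 0) :
    ∃ b : Module.Basis (Fin d) ℝ V, (∀ i ∈ s, b i = u i) ∧
      ∀ i j, g (b i) (b j) = if i = j then c else 0 := by
  let core : InnerProductSpace.Core ℝ V :=
    { inner := fun v w => g v w
      conj_inner_symm := fun v w => hsymm _ _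
      re_inner_nonneg := fun v => by
        by_cases h : v = 0
        · simp [h]
        · exact (hpos v h).le
      add_left := fun _ _ _ => by simp
      smul_left := fun _ _ _ => by simp
      definite := fun v h => by
        by_contra hv
        exact (hpos v hv).ne' h }
  let _ : NormedAddCommGroup V := core.toNormedAddCommGroup
  let _ : InnerProductSpace ℝ V := InnerProductSpace.ofCore core.toCore
  have hin : ∀ v w : V, inner ℝ v w = g v w := fun _ _ => rfl
  have hsq : √c * √c = c := Real.mul_self_sqrt hc.le
  have hs0 : √c ≠ 0 := (Real.sqrt_pos.2 hc).ne'
  have horth : Orthonormal ℝ (s.domRestrict fun i => (√c)⁻¹ • u i) := by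
    rw [orthonormal_iff_ite]
    intro i j
    have := hu i i.2 j j.2
    rw [Set.domRestrict_apply, Set.domRestrict_apply, inner_smul_left, inner_smul_right, hin, this]
    simp only [Subtype.ext_iff]
    split_ifs
    · simp only [conj_trivial]
      field_simp
      rw [pow_two, hsq]
    · simp
  obtain ⟨b, hb⟩ := horth.exists_orthonormalBasis_extension_of_card_eq
    (by simpa using hdim)
  refine ⟨b.toBasis.isUnitSMul (w := fun _ => √c) (fun _ => hs0.isUnit), fun i hi => ?_,
    fun i j => ?_⟩
  · simp only [Module.Basis.isUnitSMul_apply, OrthonormalBasis.coe_toBasis, hb i hi, smul_smul]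
    rw [mul_inv_cancel₀ hs0, one_smul]
  · have := orthonormal_iff_ite.1 b.orthonormal i j
    rw [hin] at this
    simp only [Module.Basis.isUnitSMul_apply, OrthonormalBasis.coe_toBasis, map_smul,
      LinearMap.smul_apply, smul_eq_mul, this]
    split_ifs
    · rw [mul_one, hsq]
    · simp

theorem flipBasis_orthogonal {g : V →ₗ[ℝ] V →ₗ[ℝ] ℝ} {c : ℝ}
    (hb : ∀ i j, g (b i) (b j) = if i = j then c else 0) (n i j : Fin d) :
    g (flipBasis b n i) (flipBasis b n j) = if i = j then c else 0 := by
  by_cases hi : i = n <;> by_cases hj : j = n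
  · subst hi; subst hj; simp [flipBasis_self, hb]
  · subst hi; rw [flipBasis_self, flipBasis_of_ne _ hj]; simp [hb, Ne.symm hj]
  · subst hj; rw [flipBasis_self, flipBasis_of_ne _ hi]; simp [hb, hi]
  · rw [flipBasis_of_ne _ hi, flipBasis_of_ne _ hj, hb]

/-! ### Orthogonal complex structures with a prescribed value and a prescribed orientation. -/

section Existence

variable [FiniteDimensional ℝ V] (hdim : Module.finrank ℝ V = d)
  {g : V →ₗ[ℝ] V →ₗ[ℝ] ℝ} (hsymm : ∀ v w, g v w = g w v) (hpos : ∀ v, v ≠ 0 → 0 < g v v)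
include hd hdim hsymm hpos

omit hd in
theorem exists_orthogonal_basis_pair (h2 : 2 ≤ d) {u v : V} (hu : u ≠ 0) (huv : g u v = 0)
    (hn : g v v = g u u) :
    ∃ b : Module.Basis (Fin d) ℝ V, b ⟨0, by omega⟩ = u ∧ b ⟨1, by omega⟩ = v ∧
      ∀ i j, g (b i) (b j) = if i = j then g u u else 0 := by
  obtain ⟨b, hb, hbo⟩ := exists_orthogonal_basis hdim g hsymm hpos
    {⟨0, by omega⟩, ⟨1, by omega⟩} (fun i => if i.val = 0 then u else v) (g u u) (hpos u hu)
    (by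
      have hvu : g v u = 0 := by rw [hsymm, huv]
      rintro i (rfl | rfl) j (rfl | rfl) <;> simp [huv, hvu, hn])
  exact ⟨b, by simpa using hb ⟨0, by omega⟩ (by simp), by simpa using hb ⟨1, by omega⟩ (by simp),
    hbo⟩

/-- A basis starting with `u, v` may have the wrong orientation. Replacing `v` by `-v` repairs it,
at the price of the sign; in dimension 2 there is no other freedom. -/
theorem exists_posStructure_or (h2 : 2 ≤ d) {Pos : Module.Basis (Fin d) ℝ V → Prop}
    (hPos : IsSignClosed Pos) {u v : V} (hu : u ≠ 0) (huv : g u v = 0) (hn : g v v = g u u) :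
    ∃ J, IsPosStructure g Pos J ∧ (J u = v ∨ J u = -v) := by
  obtain ⟨b, hb0, hb1, hb⟩ := exists_orthogonal_basis_pair hdim hsymm hpos h2 hu huv hn
  rcases hPos b ⟨1, by omega⟩ with h | h
  · refine ⟨basisComplexStructure hd b, ⟨basisComplexStructure_sq hd b,
      basisComplexStructure_orthogonal hd b g _ hb, b, h, basisComplexStructure_isAdapted hd b⟩,
      Or.inl ?_⟩
    rw [← hb0, ← hb1]
    exact basisComplexStructure_isAdapted hd b _ _ (by simp) rfl
  · set b' := flipBasis b ⟨1, by omega⟩ with hb'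
    refine ⟨basisComplexStructure hd b', ⟨basisComplexStructure_sq hd b',
      basisComplexStructure_orthogonal hd b' g _ (flipBasis_orthogonal b hb _), b', h,
      basisComplexStructure_isAdapted hd b'⟩, Or.inr ?_⟩
    have := basisComplexStructure_isAdapted hd b' ⟨0, by omega⟩ ⟨1, by omega⟩ (by simp) rfl
    rwa [hb', flipBasis_self, flipBasis_of_ne _ (by simp), hb0, hb1] at this

/-- From dimension 4 on, the orientation can be corrected on the fourth basis vector, which leaves
the pair `u, v` untouched. Hence both `v` and `-v` are attained as values at `u`. -/
theorem exists_posStructure (h4 : 4 ≤ d) {Pos : Module.Basis (Fin d) ℝ V → Prop}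
    (hPos : IsSignClosed Pos) {u v : V} (hu : u ≠ 0) (huv : g u v = 0) (hn : g v v = g u u) :
    ∃ J, IsPosStructure g Pos J ∧ J u = v := by
  obtain ⟨b, hb0, hb1, hb⟩ := exists_orthogonal_basis_pair hdim hsymm hpos (by omega) hu huv hn
  have key : ∃ b : Module.Basis (Fin d) ℝ V, Pos b ∧ b ⟨0, by omega⟩ = u ∧ b ⟨1, by omega⟩ = v ∧
      ∀ i j, g (b i) (b j) = if i = j then g u u else 0 := by
    rcases hPos b ⟨3, by omega⟩ with h | h
    · exact ⟨b, h, hb0, hb1, hb⟩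
    · exact ⟨_, h, by rw [flipBasis_of_ne _ (by simp), hb0],
        by rw [flipBasis_of_ne _ (by simp), hb1], flipBasis_orthogonal b hb _⟩
  clear hb0 hb1 hb b
  obtain ⟨b, h, hb0, hb1, hb⟩ := key
  refine ⟨basisComplexStructure hd b, ⟨basisComplexStructure_sq hd b,
    basisComplexStructure_orthogonal hd b g _ hb, b, h, basisComplexStructure_isAdapted hd b⟩, ?_⟩
  rw [← hb0, ← hb1]
  exact basisComplexStructure_isAdapted hd b _ _ (by simp) rfl

omit hd in
theorem exists_orthogonal_vector (h2 : 2 ≤ d) {u : V} (hu : u ≠ 0) :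
    ∃ v, g u v = 0 ∧ g v v = g u u := by
  obtain ⟨b, hb, hbo⟩ := exists_orthogonal_basis hdim g hsymm hpos
    {⟨0, by omega⟩} (fun i => u) (g u u) (hpos u hu) (by rintro i rfl j rfl; simp)
  refine ⟨b ⟨1, by omega⟩, ?_, by simp [hbo]⟩
  rw [← hb ⟨0, by omega⟩ (by simp), hbo]
  simp

omit hd in
theorem exists_orthogonal_triple (h3 : 3 ≤ d) {u : V} (hu : u ≠ 0) :
    ∃ v w, v ≠ 0 ∧ g u v = 0 ∧ g u w = 0 ∧ g v w = 0 ∧ g v v = g u u ∧ g w w = g u u := by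
  obtain ⟨b, hb, hbo⟩ := exists_orthogonal_basis hdim g hsymm hpos
    {⟨0, by omega⟩} (fun i => u) (g u u) (hpos u hu) (by rintro i rfl j rfl; simp)
  refine ⟨b ⟨1, by omega⟩, b ⟨2, by omega⟩, b.ne_zero _, ?_, ?_, by simp [hbo], by simp [hbo],
    by simp [hbo]⟩
  · rw [← hb ⟨0, by omega⟩ (by simp), hbo]; simp
  · rw [← hb ⟨0, by omega⟩ (by simp), hbo]; simp

theorem exists_posStructure_of_two_le (h2 : 2 ≤ d) {Pos : Module.Basis (Fin d) ℝ V → Prop}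
    (hPos : IsSignClosed Pos) : ∃ J, IsPosStructure g Pos J := by
  have : Nontrivial V := Module.nontrivial_of_finrank_pos (R := ℝ) (by omega)
  obtain ⟨u, hu⟩ := exists_ne (0 : V)
  obtain ⟨v, huv, hn⟩ := exists_orthogonal_vector hdim hsymm hpos h2 hu
  obtain ⟨J, hJ, -⟩ := exists_posStructure_or hd hdim hsymm hpos h2 hPos hu huv hn
  exact ⟨J, hJ⟩

end Existence

end Orthogonal

/-! ### Tangent vectors of the total space of a vector bundle -/

section TangentMap

variable {E : Type*} [NormedAddCommGroup E] [NormedSpace ℝ E]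
    {H : Type*} [TopologicalSpace H] {I : ModelWithCorners ℝ E H}
    {E' : Type*} [NormedAddCommGroup E'] [NormedSpace ℝ E']
    {H' : Type*} [TopologicalSpace H'] {I' : ModelWithCorners ℝ E' H'}
    {Z : Type*} [TopologicalSpace Z] [ChartedSpace H Z]
    {Z' : Type*} [TopologicalSpace Z'] [ChartedSpace H' Z']
    {F : Type*} [NormedAddCommGroup F] [NormedSpace ℝ F]

/-- The differential of a map with values in a normed space. -/
def vderiv (I : ModelWithCorners ℝ E H) (G : Z → F) (z : Z) : TangentSpace I z →L[ℝ] F :=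
  (NormedSpace.fromTangentSpace (𝕜 := ℝ) (G z)).toContinuousLinearMap ∘L mfderiv I 𝓘(ℝ, F) G z

/-- The hypothesis is an equality in the tangent bundle, as in `IsVerticalLift` and
`horizontalSpace`; stating the chain rule in this form avoids transport along `f p.1 = z`. -/
theorem vderiv_of_tangentMap_eq {f : Z → Z'} {p : TangentBundle I Z} {z : Z'}
    {v : TangentSpace I' z} (h : tangentMap I I' f p = ⟨z, v⟩) {G : Z' → F}
    (hf : MDifferentiableAt I I' f p.1) (hG : MDifferentiableAt I' 𝓘(ℝ, F) G z) :
    vderiv I' G z v = vderiv I (fun x => G (f x)) p.1 p.2 := by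
  have hz : f p.1 = z := congrArg TotalSpace.proj h
  subst hz
  have hv : mfderiv I I' f p.1 p.2 = v := by
    simpa [tangentMap] using h
  subst hv
  have := mfderiv_comp p.1 hG hf
  simp only [vderiv, ContinuousLinearMap.comp_apply]
  change _ = NormedSpace.fromTangentSpace _ (mfderiv I 𝓘(ℝ, F) (G ∘ f) p.1 p.2)
  rw [this]
  rfl

theorem vderiv_comp {f : Z → Z'} {x : Z} {G : Z' → F} (hf : MDifferentiableAt I I' f x)
    (hG : MDifferentiableAt I' 𝓘(ℝ, F) G (f x)) (X : TangentSpace I x) :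
    vderiv I' G (f x) (mfderiv I I' f x X) = vderiv I (fun y => G (f y)) x X :=
  vderiv_of_tangentMap_eq (p := ⟨x, X⟩) rfl hf hG

theorem vderiv_congr {G G' : Z → F} {z : Z} (h : G =ᶠ[𝓝 z] G') : vderiv I G z = vderiv I G' z := by
  ext v
  have h1 := h.mfderiv_eq (I := I) (I' := 𝓘(ℝ, F))
  exact congrArg (fun L : TangentSpace I z →L[ℝ] F => L v) h1

theorem vderiv_clm_comp {F' : Type*} [NormedAddCommGroup F'] [NormedSpace ℝ F'] (L : F →L[ℝ] F')
    {G : Z → F} {z : Z} (hG : MDifferentiableAt I 𝓘(ℝ, F) G z) (v : TangentSpace I z) :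
    vderiv I (fun y => L (G y)) z v = L (vderiv I G z v) := by
  have h := vderiv_comp (I' := 𝓘(ℝ, F)) hG (L.mdifferentiableAt (x := G z)) v
  rw [← h]
  simp only [vderiv, ContinuousLinearMap.comp_apply]
  rw [L.hasMFDerivAt.mfderiv]
  rfl

end TangentMap

section Total

variable {d : ℕ} {M : Type*} [TopologicalSpace M] [ChartedSpace (EuclideanSpace ℝ (Fin d)) M]
  {F : Type*} [NormedAddCommGroup F] [NormedSpace ℝ F]
  {V : M → Type*} [TopologicalSpace (Bundle.TotalSpace F V)]
  [∀ x, AddCommMonoid (V x)] [∀ x, Module ℝ (V x)] [∀ x, TopologicalSpace (V x)]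
  [FiberBundle F V]

/-- The projection of a tangent vector of the total space onto the base. -/
def basePart (z : TotalSpace F V) :
    TangentSpace ((𝓡 d).prod 𝓘(ℝ, F)) z →L[ℝ] TangentSpace (𝓡 d) z.proj :=
  mfderiv ((𝓡 d).prod 𝓘(ℝ, F)) (𝓡 d) (TotalSpace.proj : TotalSpace F V → M) z

/-- The second component of the element of `TotalSpace F V`, in the preferred trivialization
at `x`. -/
def trivSnd (x : M) (z : TotalSpace F V) : F := (trivializationAt F V x z).2

/-- The fibre component, in the preferred trivialization, of a tangent vector of the total space. -/
def fibrePart (z : TotalSpace F V) : TangentSpace ((𝓡 d).prod 𝓘(ℝ, F)) z →L[ℝ] F :=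
  vderiv ((𝓡 d).prod 𝓘(ℝ, F)) (trivSnd z.proj) z

theorem mdifferentiableAt_trivSnd (z : TotalSpace F V) :
    MDifferentiableAt ((𝓡 d).prod 𝓘(ℝ, F)) 𝓘(ℝ, F) (trivSnd z.proj : TotalSpace F V → F) z :=
  ((mdifferentiableAt_totalSpace (𝓡 d) (fun z : TotalSpace F V => z)).1
    (mdifferentiableAt_id (I := (𝓡 d).prod 𝓘(ℝ, F)) (x := z))).2

theorem mdifferentiableAt_proj (z : TotalSpace F V) :
    MDifferentiableAt ((𝓡 d).prod 𝓘(ℝ, F)) (𝓡 d) (TotalSpace.proj : TotalSpace F V → M) z :=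
  ((mdifferentiableAt_totalSpace (𝓡 d) (fun z : TotalSpace F V => z)).1
    (mdifferentiableAt_id (I := (𝓡 d).prod 𝓘(ℝ, F)) (x := z))).1

end Total
section Total2

variable {d : ℕ} {M : Type*} [TopologicalSpace M] [ChartedSpace (EuclideanSpace ℝ (Fin d)) M]
  [IsManifold (𝓡 d) 1 M]
  {F : Type*} [NormedAddCommGroup F] [NormedSpace ℝ F]
  {V : M → Type*} [TopologicalSpace (Bundle.TotalSpace F V)]
  [∀ x, AddCommMonoid (V x)] [∀ x, Module ℝ (V x)] [∀ x, TopologicalSpace (V x)]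
  [FiberBundle F V] [VectorBundle ℝ F V] [ContMDiffVectorBundle 1 F V (𝓡 d)]

/-- The chart of the total space has injective differential, and near `z` it is the base chart
paired with the trivialization. The two components thus form a complete set of coordinates for
tangent vectors. -/
theorem tangent_total_ext {z : TotalSpace F V} {v w : TangentSpace ((𝓡 d).prod 𝓘(ℝ, F)) z}
    (h1 : basePart z v = basePart z w) (h2 : fibrePart z v = fibrePart z w) : v = w := by
  have hinj : Function.Injective (mfderiv ((𝓡 d).prod 𝓘(ℝ, F)) 𝓘(ℝ, EuclideanSpace ℝ (Fin d) × F)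
      (extChartAt ((𝓡 d).prod 𝓘(ℝ, F)) z) z) :=
    (isInvertible_mfderiv_extChartAt (mem_extChartAt_source z)).injective
  apply hinj
  have hf : MDifferentiableAt ((𝓡 d).prod 𝓘(ℝ, F)) 𝓘(ℝ, EuclideanSpace ℝ (Fin d))
      (fun z' : TotalSpace F V => extChartAt (𝓡 d) z.proj z'.proj) z :=
    (mdifferentiableAt_extChartAt (mem_chart_source _ z.proj)).comp z (mdifferentiableAt_proj z)
  have hev : (extChartAt ((𝓡 d).prod 𝓘(ℝ, F)) z : TotalSpace F V → _) =ᶠ[𝓝 z]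
      fun z' => (extChartAt (𝓡 d) z.proj z'.proj, trivSnd z.proj z') := by
    have : (trivializationAt F V z.proj).source ∈ 𝓝 z :=
      (trivializationAt F V z.proj).open_source.mem_nhds
        ((trivializationAt F V z.proj).mem_source.2 (FiberBundle.mem_baseSet_trivializationAt' _))
    filter_upwards [this] with z' hz'
    rw [FiberBundle.extChartAt]
    simp only [PartialEquiv.coe_trans, Function.comp_apply, PartialEquiv.prod_coe,
      PartialEquiv.refl_coe, trivSnd]
    congr 2
    exact (trivializationAt F V z.proj).coe_fst hz'
  have hG : MDifferentiableAt ((𝓡 d).prod 𝓘(ℝ, F)) 𝓘(ℝ, EuclideanSpace ℝ (Fin d) × F)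
      (extChartAt ((𝓡 d).prod 𝓘(ℝ, F)) z) z := mdifferentiableAt_extChartAt (mem_chart_source _ z)
  have e1 : vderiv ((𝓡 d).prod 𝓘(ℝ, F))
      (fun z' : TotalSpace F V => extChartAt (𝓡 d) z.proj z'.proj) z v =
    vderiv ((𝓡 d).prod 𝓘(ℝ, F))
      (fun z' : TotalSpace F V => extChartAt (𝓡 d) z.proj z'.proj) z w := by
    have hψ := mdifferentiableAt_extChartAt (I := 𝓡 d) (mem_chart_source _ z.proj)
    rw [← vderiv_comp (mdifferentiableAt_proj z) hψ, ← vderiv_comp (mdifferentiableAt_proj z) hψ]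
    exact congrArg _ h1
  have key : vderiv ((𝓡 d).prod 𝓘(ℝ, F)) (extChartAt ((𝓡 d).prod 𝓘(ℝ, F)) z) z v =
      vderiv ((𝓡 d).prod 𝓘(ℝ, F)) (extChartAt ((𝓡 d).prod 𝓘(ℝ, F)) z) z w := by
    apply Prod.ext
    · have hfst := vderiv_clm_comp (ContinuousLinearMap.fst ℝ (EuclideanSpace ℝ (Fin d)) F) hG
      have := vderiv_congr (I := (𝓡 d).prod 𝓘(ℝ, F)) (hev.fun_comp Prod.fst)
      simp only [Function.comp_def] at this
      refine (hfst v).symm.trans (Eq.trans ?_ (hfst w))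
      exact (DFunLike.congr_fun this v).trans (e1.trans (DFunLike.congr_fun this w).symm)
    · have hsnd := vderiv_clm_comp (ContinuousLinearMap.snd ℝ (EuclideanSpace ℝ (Fin d)) F) hG
      have := vderiv_congr (I := (𝓡 d).prod 𝓘(ℝ, F)) (hev.fun_comp Prod.snd)
      simp only [Function.comp_def] at this
      refine (hsnd v).symm.trans (Eq.trans ?_ (hsnd w))
      exact (DFunLike.congr_fun this v).trans (h2.trans (DFunLike.congr_fun this w).symm)
  exact key

theorem tangentMap_snd_eq {M₀ : Type*} [TopologicalSpace M₀] {E₀ H₀ : Type*} [NormedAddCommGroup E₀]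
    [NormedSpace ℝ E₀] [TopologicalSpace H₀] {I₀ : ModelWithCorners ℝ E₀ H₀} [ChartedSpace H₀ M₀]
    {f : M₀ → TotalSpace F V} {p : TangentBundle I₀ M₀} {z : TotalSpace F V}
    {v : TangentSpace ((𝓡 d).prod 𝓘(ℝ, F)) z}
    (hf : MDifferentiableAt I₀ ((𝓡 d).prod 𝓘(ℝ, F)) f p.1)
    (h : tangentMap I₀ ((𝓡 d).prod 𝓘(ℝ, F)) f p = ⟨z, v⟩) :
    tangentMap I₀ (𝓡 d) (fun x => (f x).proj) p = ⟨z.proj, basePart z v⟩ ∧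
    vderiv I₀ (fun x => trivSnd z.proj (f x)) p.1 p.2 = fibrePart z v := by
  constructor
  · have hz : f p.1 = z := congrArg TotalSpace.proj h
    subst hz
    have hv : mfderiv I₀ ((𝓡 d).prod 𝓘(ℝ, F)) f p.1 p.2 = v := by
      simpa [tangentMap] using h
    subst hv
    have := mfderiv_comp p.1 (mdifferentiableAt_proj (f p.1)) hf
    simp only [tangentMap]
    change TotalSpace.mk _ (mfderiv I₀ (𝓡 d) (TotalSpace.proj ∘ f) p.1 p.2) = _
    rw [this]
    rfl
  · exact (vderiv_of_tangentMap_eq h hf (mdifferentiableAt_trivSnd z)).symm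

end Total2
-- Vertical vectors in a trivialization.
section Vertical

variable {d : ℕ} {M : Type*} [TopologicalSpace M] [ChartedSpace (EuclideanSpace ℝ (Fin d)) M]
  [IsManifold (𝓡 d) 1 M]
  {F : Type*} [NormedAddCommGroup F] [NormedSpace ℝ F]
  {V : M → Type*} [TopologicalSpace (Bundle.TotalSpace F V)]
  [∀ x, AddCommGroup (V x)] [∀ x, Module ℝ (V x)] [∀ x, TopologicalSpace (V x)]
  [FiberBundle F V] [VectorBundle ℝ F V] [ContMDiffVectorBundle 1 F V (𝓡 d)]

theorem trivSnd_eq_continuousLinearMapAt {x y : M} (h : y ∈ (trivializationAt F V x).baseSet)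
    (A : V y) :
    trivSnd x ⟨y, A⟩ = (trivializationAt F V x).continuousLinearMapAt ℝ y A := by
  rw [Bundle.Trivialization.continuousLinearMapAt_apply,
    Bundle.Trivialization.coe_linearMapAt_of_mem _ h]
  rfl

theorem mem_baseSet_self (x : M) : x ∈ (trivializationAt F V x).baseSet :=
  FiberBundle.mem_baseSet_trivializationAt' x

theorem hasDerivAt_vderiv {f : ℝ → F} {f' : F} {t : ℝ} (h : HasDerivAt f f' t) :
    MDifferentiableAt 𝓘(ℝ, ℝ) 𝓘(ℝ, F) f t ∧ vderiv 𝓘(ℝ, ℝ) f t (1 : ℝ) = f' := by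
  have := h.hasFDerivAt.hasMFDerivAt
  refine ⟨this.mdifferentiableAt, ?_⟩
  simp only [vderiv]
  rw [this.mfderiv]
  change (ContinuousLinearMap.toSpanSingleton ℝ f') 1 = f'
  simp

/-- The line `t ↦ z + t A` has constant projection and is affine in the trivialization, so both
components of its velocity are explicit. They determine the velocity by `tangent_total_ext`. -/
theorem isVerticalLift_iff (z : TotalSpace F V) (A : V z.proj)
    (v : TangentSpace ((𝓡 d).prod 𝓘(ℝ, F)) z) :
    IsVerticalLift z A v ↔ basePart z v = 0 ∧ fibrePart z v = trivSnd z.proj ⟨z.proj, A⟩ := by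
  set c : ℝ → TotalSpace F V := fun t => TotalSpace.mk' F z.proj (z.2 + t • A) with hcdef
  have hc0 : c 0 = z := by simp [hcdef]
  have hlin : ∀ t : ℝ, trivSnd z.proj (c t) =
      trivSnd z.proj z + t • trivSnd z.proj (⟨z.proj, A⟩ : TotalSpace F V) := by
    intro t
    have hz : trivSnd z.proj z = trivSnd z.proj (⟨z.proj, z.2⟩ : TotalSpace F V) := rfl
    rw [hz]
    simp only [hcdef, TotalSpace.mk']
    rw [trivSnd_eq_continuousLinearMapAt (mem_baseSet_self _),
      trivSnd_eq_continuousLinearMapAt (mem_baseSet_self _),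
      trivSnd_eq_continuousLinearMapAt (mem_baseSet_self _), map_add, map_smul]
  have hder : HasDerivAt (fun t => trivSnd z.proj (c t))
      (trivSnd z.proj (⟨z.proj, A⟩ : TotalSpace F V)) 0 := by
    rw [funext hlin]
    simpa using ((hasDerivAt_id (0 : ℝ)).smul_const
      (trivSnd z.proj (⟨z.proj, A⟩ : TotalSpace F V))).const_add (trivSnd z.proj z)
  have hc : MDifferentiableAt 𝓘(ℝ, ℝ) ((𝓡 d).prod 𝓘(ℝ, F)) c 0 := by
    rw [mdifferentiableAt_totalSpace]
    exact ⟨mdifferentiableAt_const, (hasDerivAt_vderiv hder).1⟩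
  obtain ⟨w, hw⟩ : ∃ w : TangentSpace ((𝓡 d).prod 𝓘(ℝ, F)) z,
      tangentMap 𝓘(ℝ, ℝ) ((𝓡 d).prod 𝓘(ℝ, F)) c ⟨(0 : ℝ), (1 : ℝ)⟩ = ⟨z, w⟩ := by
    have : (tangentMap 𝓘(ℝ, ℝ) ((𝓡 d).prod 𝓘(ℝ, F)) c ⟨(0 : ℝ), (1 : ℝ)⟩).proj = z := hc0
    generalize tangentMap 𝓘(ℝ, ℝ) ((𝓡 d).prod 𝓘(ℝ, F)) c ⟨(0 : ℝ), (1 : ℝ)⟩ = q at this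
    subst this
    exact ⟨q.2, rfl⟩
  obtain ⟨h1, h2⟩ := tangentMap_snd_eq hc hw
  have h1' : basePart z w = 0 := by
    have hconst : mfderiv 𝓘(ℝ, ℝ) (𝓡 d) (fun t : ℝ => (c t).proj) 0 = 0 := mfderiv_const
    simp only [tangentMap] at h1
    have := (TotalSpace.mk.injEq _ _ _ _ ▸ h1).2
    have := eq_of_heq this
    rw [← this]
    exact congrArg (fun L => L (1 : ℝ)) hconst
  have h2' : fibrePart z w = trivSnd z.proj (⟨z.proj, A⟩ : TotalSpace F V) := by
    rw [← h2]
    exact (hasDerivAt_vderiv hder).2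
  have hiff : IsVerticalLift z A v ↔ w = v := by
    unfold IsVerticalLift
    change tangentMap 𝓘(ℝ, ℝ) ((𝓡 d).prod 𝓘(ℝ, F)) c ⟨(0 : ℝ), (1 : ℝ)⟩ = ⟨z, v⟩ ↔ _
    rw [hw]
    simp
  rw [hiff, ← h1', ← h2']
  constructor
  · rintro rfl; exact ⟨rfl, rfl⟩
  · rintro ⟨ha, hb⟩; exact (tangent_total_ext ha hb).symm

end Vertical

/-! ### Coordinates of tangent vectors -/

section Coordinates

variable {d : ℕ} {M : Type*} [TopologicalSpace M] [ChartedSpace (EuclideanSpace ℝ (Fin d)) M]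
  [IsManifold (𝓡 d) ∞ M]
  {F : Type*} [NormedAddCommGroup F] [NormedSpace ℝ F]

/-- The preferred trivialization of the tangent bundle at `x`. -/
abbrev tangentTriv (x : M) := trivializationAt (EuclideanSpace ℝ (Fin d))
  (TangentSpace (𝓡 d) : M → Type _) x

/-- The coordinates of the tangent vectors at `y`, in the preferred chart at `x`. -/
def co (x y : M) : TangentSpace (𝓡 d) y →L[ℝ] EuclideanSpace ℝ (Fin d) :=
  (tangentTriv x).continuousLinearMapAt ℝ y

/-- The tangent vector at `y` with given coordinates, in the preferred chart at `x`. -/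
def sy (x y : M) : EuclideanSpace ℝ (Fin d) →L[ℝ] TangentSpace (𝓡 d) y :=
  (tangentTriv x).symmL ℝ y

theorem co_sy {x y : M} (h : y ∈ (tangentTriv (d := d) x).baseSet) (v : EuclideanSpace ℝ (Fin d)) :
    co x y (sy x y v) = v :=
  (tangentTriv x).continuousLinearMapAt_symmL (R := ℝ) h v

theorem sy_co {x y : M} (h : y ∈ (tangentTriv (d := d) x).baseSet) (v : TangentSpace (𝓡 d) y) :
    sy x y (co x y v) = v :=
  (tangentTriv x).symmL_continuousLinearMapAt (R := ℝ) h v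

theorem mem_tangentTriv (x : M) : x ∈ (tangentTriv (d := d) x).baseSet :=
  FiberBundle.mem_baseSet_trivializationAt' x

theorem eventually_mem_tangentTriv (x : M) : ∀ᶠ y in 𝓝 x, y ∈ (tangentTriv (d := d) x).baseSet :=
  (tangentTriv x).open_baseSet.mem_nhds (mem_tangentTriv x)

@[simp] theorem co_sy_self (x : M) (v : EuclideanSpace ℝ (Fin d)) : co x x (sy x x v) = v :=
  co_sy (mem_tangentTriv x) v

@[simp] theorem sy_co_self (x : M) (v : TangentSpace (𝓡 d) x) : sy x x (co x x v) = v :=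
  sy_co (mem_tangentTriv x) v

theorem tangentTriv_apply {x y : M} (h : y ∈ (tangentTriv (d := d) x).baseSet)
    (v : TangentSpace (𝓡 d) y) : (tangentTriv x ⟨y, v⟩).2 = co x y v :=
  trivSnd_eq_continuousLinearMapAt h v

/-- At its own centre the preferred trivialization is the identity, so a tangent vector at `x` and
its coordinates are the same element of the model space. -/
theorem co_self (x : M) (v : TangentSpace (𝓡 d) x) : co x x v = v := by
  have := tangentTriv_apply (mem_tangentTriv x) v
  rw [← this, TangentBundle.trivializationAt_apply]
  simp only [OpenPartialHomeomorph.extend]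
  have h2 := tangentCoordChange_self (I := 𝓡 d) (x := x) (z := x) (v := v)
    (mem_extChartAt_source x)
  simpa [tangentCoordChange_def] using h2

/-- The coordinate line with velocity `X` at `x`. -/
def curve (x : M) (X : TangentSpace (𝓡 d) x) (t : ℝ) : M :=
  (extChartAt (𝓡 d) x).symm (extChartAt (𝓡 d) x x + t • co x x X)

@[simp] theorem curve_zero (x : M) (X : TangentSpace (𝓡 d) x) : curve x X 0 = x := by
  simp [curve]

theorem tendsto_line (x : M) (X : TangentSpace (𝓡 d) x) :
    Tendsto (fun t : ℝ => extChartAt (𝓡 d) x x + t • co x x X) (𝓝 0)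
      (𝓝 (extChartAt (𝓡 d) x x)) := by
  have : Continuous (fun t : ℝ => extChartAt (𝓡 d) x x + t • co x x X) := by fun_prop
  simpa using this.tendsto 0

theorem extChartAt_curve (x : M) (X : TangentSpace (𝓡 d) x) :
    ∀ᶠ t in 𝓝 (0 : ℝ), extChartAt (𝓡 d) x (curve x X t) = extChartAt (𝓡 d) x x + t • co x x X := by
  filter_upwards [(tendsto_line x X).eventually (extChartAt_target_mem_nhds (I := 𝓡 d) x)] with t ht
  exact (extChartAt (𝓡 d) x).right_inv ht

theorem hasDerivAt_comp_curve {f : M → F} {x : M} (hf : MDifferentiableAt (𝓡 d) 𝓘(ℝ, F) f x)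
    (X : TangentSpace (𝓡 d) x) :
    HasDerivAt (fun t => f (curve x X t)) (vderiv (𝓡 d) f x X) 0 := by
  have h : HasFDerivAt (fun e => f ((extChartAt (𝓡 d) x).symm e)) (vderiv (𝓡 d) f x)
      (extChartAt (𝓡 d) x x) := by
    have h1 : HasFDerivWithinAt (fun e => f ((extChartAt (𝓡 d) x).symm e)) (vderiv (𝓡 d) f x)
      (Set.range (𝓡 d)) (extChartAt (𝓡 d) x x) := hf.hasMFDerivAt.2
    rw [ModelWithCorners.range_eq_univ] at h1
    exact h1.hasFDerivAt univ_mem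
  have hl : HasDerivAt (fun t : ℝ => extChartAt (𝓡 d) x x + t • co x x X) (co x x X) 0 := by
    simpa using ((hasDerivAt_id (0 : ℝ)).smul_const (co x x X)).const_add (extChartAt (𝓡 d) x x)
  have h' : HasFDerivAt (fun e => f ((extChartAt (𝓡 d) x).symm e)) (vderiv (𝓡 d) f x)
      (extChartAt (𝓡 d) x x + (0 : ℝ) • co x x X) := by simpa using h
  have := h'.comp_hasDerivAt (0 : ℝ) hl
  have h3 : vderiv (𝓡 d) f x (co x x X) = vderiv (𝓡 d) f x X := congrArg _ (co_self x X)
  exact h3 ▸ this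

/-- A function which is affine along the coordinate lines. -/
theorem exists_affine_function (x : M) (X : TangentSpace (𝓡 d) x) :
    ∃ h : M → ℝ, ContMDiffAt (𝓡 d) 𝓘(ℝ, ℝ) ∞ h x ∧ h x = 0 ∧
      (X ≠ 0 → vderiv (𝓡 d) h x X = 1) := by
  -- The function serves to correct the derivative of a section along `X` without changing its value
  -- at `x`; for `X = 0` there is nothing to correct.
  by_cases hX : X = 0
  · exact ⟨fun _ => 0, contMDiffAt_const, rfl, fun h => absurd hX h⟩
  have hcX : co x x X ≠ 0 := fun h => hX (by rw [← sy_co_self x X, h, map_zero])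
  obtain ⟨f, hf⟩ := SeparatingDual.exists_eq_one (R := ℝ) hcX
  have hsm : ContMDiffAt (𝓡 d) 𝓘(ℝ, ℝ) ∞
      (fun y => f (extChartAt (𝓡 d) x y - extChartAt (𝓡 d) x x)) x :=
    f.contDiff.contMDiff.contMDiffAt.comp x
      ((contMDiffAt_extChartAt (I := 𝓡 d) (x := x)).sub contMDiffAt_const)
  refine ⟨_, hsm, by simp, fun _ => ?_⟩
  have h1 := hasDerivAt_comp_curve (hsm.mdifferentiableAt (by simp)) X
  have h2 : HasDerivAt (fun t : ℝ => t) 1 0 := hasDerivAt_id 0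
  refine h1.unique (h2.congr_of_eventuallyEq ?_)
  filter_upwards [extChartAt_curve x X] with t ht
  rw [ht]
  simp [hf]

end Coordinates

/-! ### Vector fields and connections in coordinates. -/

section Christoffel

variable {d : ℕ} {M : Type*} [TopologicalSpace M] [ChartedSpace (EuclideanSpace ℝ (Fin d)) M]
  [IsManifold (𝓡 d) ∞ M]

/-- Differentiability of vector fields. -/
def DiffFieldAt (Y : Π x : M, TangentSpace (𝓡 d) x) (x : M) : Prop :=
  MDifferentiableAt (𝓡 d) ((𝓡 d).prod 𝓘(ℝ, EuclideanSpace ℝ (Fin d)))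
    (fun y => Bundle.TotalSpace.mk' (EuclideanSpace ℝ (Fin d)) y (Y y)) x

theorem SmoothFieldAt.diff {Y : Π x : M, TangentSpace (𝓡 d) x} {x : M} (h : SmoothFieldAt Y x) :
    DiffFieldAt Y x := ContMDiffAt.mdifferentiableAt h (by simp)

theorem diffFieldAt_iff {Y : Π x : M, TangentSpace (𝓡 d) x} {x : M} : DiffFieldAt Y x ↔
    MDifferentiableAt (𝓡 d) 𝓘(ℝ, EuclideanSpace ℝ (Fin d)) (fun y => co x y (Y y)) x := by
  rw [DiffFieldAt, mdifferentiableAt_section]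
  refine Filter.EventuallyEq.mdifferentiableAt_iff ?_
  filter_upwards [eventually_mem_tangentTriv (d := d) x] with y hy
  exact tangentTriv_apply hy _

theorem smoothFieldAt_iff {Y : Π x : M, TangentSpace (𝓡 d) x} {x : M} : SmoothFieldAt Y x ↔
    ContMDiffAt (𝓡 d) 𝓘(ℝ, EuclideanSpace ℝ (Fin d)) ∞ (fun y => co x y (Y y)) x := by
  rw [SmoothFieldAt]
  refine (contMDiffAt_section x).trans (Filter.EventuallyEq.contMDiffAt_iff ?_)
  filter_upwards [eventually_mem_tangentTriv (d := d) x] with y hy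
  exact tangentTriv_apply hy _

theorem smoothFieldAt_const (x : M) (v : EuclideanSpace ℝ (Fin d)) :
    SmoothFieldAt (fun y => sy x y v) x := by
  rw [smoothFieldAt_iff]
  refine (contMDiffAt_const (c := v)).congr_of_eventuallyEq ?_
  filter_upwards [eventually_mem_tangentTriv (d := d) x] with y hy
  exact co_sy hy v

theorem exists_smoothField (x : M) (v : TangentSpace (𝓡 d) x) :
    ∃ Y : Π x : M, TangentSpace (𝓡 d) x, SmoothFieldAt Y x ∧ Y x = v :=
  ⟨fun y => sy x y (co x x v), smoothFieldAt_const x _, sy_co_self x v⟩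

theorem connection_add (D : Connection d M) {Y Y' : Π x : M, TangentSpace (𝓡 d) x} {x : M}
    (h : DiffFieldAt Y x) (h' : DiffFieldAt Y' x) :
    D (fun y => Y y + Y' y) x = D Y x + D Y' x :=
  D.isCovariantDerivativeOnUniv.add h h'

theorem connection_smul (D : Connection d M) {Y : Π x : M, TangentSpace (𝓡 d) x} {x : M}
    (h : DiffFieldAt Y x) (a : ℝ) : D (fun y => a • Y y) x = a • D Y x :=
  D.isCovariantDerivativeOnUniv.smul_const a h

/-- The Christoffel symbols of `D`, at `x`, in the preferred chart at `x`. -/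
def christoffel (D : Connection d M) (x : M) :
    TangentSpace (𝓡 d) x →ₗ[ℝ] TangentSpace (𝓡 d) x →ₗ[ℝ] TangentSpace (𝓡 d) x :=
  LinearMap.mk₂ ℝ (fun X v => D (fun y => sy x y (co x x v)) x X)
    (fun _ _ _ => map_add _ _ _) (fun _ _ _ => map_smul _ _ _)
    (fun X v w => by
      have := connection_add D (smoothFieldAt_const x (co x x v)).diff
        (smoothFieldAt_const x (co x x w)).diff
      simp only [map_add]
      rw [this]; rfl)
    (fun a X v => by
      have := connection_smul D (smoothFieldAt_const x (co x x v)).diff a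
      simp only [map_smul]
      rw [this]; rfl)

theorem christoffel_apply (D : Connection d M) (x : M) (X v : TangentSpace (𝓡 d) x) :
    christoffel D x X v = D (fun y => sy x y (co x x v)) x X := rfl

theorem euclidean_eq_sum (v : EuclideanSpace ℝ (Fin d)) :
    v = ∑ i, v i • EuclideanSpace.single i (1 : ℝ) := by
  ext j
  simp [Finset.sum_apply, Pi.single_apply]

theorem sum_frame (D : Connection d M) (x : M) (X : TangentSpace (𝓡 d) x)
    (δ u : EuclideanSpace ℝ (Fin d)) :
    ∑ i, (δ i • sy x x (EuclideanSpace.single i (1 : ℝ)) +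
      u i • D (fun y => sy x y (EuclideanSpace.single i (1 : ℝ))) x X) =
    sy x x δ + christoffel D x X (sy x x u) := by
  rw [Finset.sum_add_distrib]
  congr 1
  · conv_rhs => rw [euclidean_eq_sum δ]
    simp [map_sum, map_smul]
  · conv_rhs => rw [euclidean_eq_sum u]
    simp only [map_sum, map_smul, christoffel_apply, co_sy_self]

theorem connection_sum (D : Connection d M) {ι : Type*} (s : Finset ι)
    (Y : ι → Π x : M, TangentSpace (𝓡 d) x) {x : M} (h : ∀ i, DiffFieldAt (Y i) x) :
    DiffFieldAt (fun y => ∑ i ∈ s, Y i y) x ∧ D (fun y => ∑ i ∈ s, Y i y) x = ∑ i ∈ s, D (Y i) x := by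
  classical
  induction s using Finset.induction_on with
  | empty =>
    have := connection_smul D (smoothFieldAt_const x 0).diff 0
    simp only [zero_smul] at this
    refine ⟨?_, by simpa using this⟩
    have h0 := (smoothFieldAt_const (d := d) x 0).diff
    simpa using h0
  | insert a s ha ih =>
    have e : (fun y => ∑ i ∈ insert a s, Y i y) = fun y => Y a y + ∑ i ∈ s, Y i y := by
      funext y; rw [Finset.sum_insert ha]
    rw [e, connection_add D (h a) ih.1, ih.2, Finset.sum_insert ha]
    refine ⟨?_, rfl⟩
    rw [diffFieldAt_iff]
    simp only [map_add]
    exact (diffFieldAt_iff.1 (h a)).add (diffFieldAt_iff.1 ih.1)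

/-- By locality `Y` may be replaced by its expansion in the frame of fields with constant
coordinates, to which the Leibniz rule applies. -/
theorem connection_eq (D : Connection d M) {Y : Π x : M, TangentSpace (𝓡 d) x} {x : M}
    (hY : DiffFieldAt Y x) (X : TangentSpace (𝓡 d) x) :
    D Y x X = sy x x (vderiv (𝓡 d) (fun y => co x y (Y y)) x X) + christoffel D x X (Y x) := by
  have hY' := diffFieldAt_iff.1 hY
  set u : Fin d → M → ℝ := fun i y => co x y (Y y) i with hu
  have hui : ∀ i, MDifferentiableAt (𝓡 d) 𝓘(ℝ, ℝ) (u i) x := fun i =>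
    ((EuclideanSpace.proj (𝕜 := ℝ) i).mdifferentiableAt).comp x hY'
  have hdu : ∀ i, vderiv (𝓡 d) (u i) x X = (vderiv (𝓡 d) (fun y => co x y (Y y)) x X) i := fun i =>
    vderiv_clm_comp (EuclideanSpace.proj (𝕜 := ℝ) i) hY' X
  set G : Fin d → Π y : M, TangentSpace (𝓡 d) y :=
    fun i y => u i y • sy x y (EuclideanSpace.single i (1 : ℝ)) with hG
  have hGd : ∀ i, DiffFieldAt (G i) x := by
    intro i
    rw [diffFieldAt_iff]
    simp only [hG, map_smul]
    exact (hui i).smul (diffFieldAt_iff.1 (smoothFieldAt_const x _).diff)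
  have hGD : ∀ i, D (G i) x X = (vderiv (𝓡 d) (fun y => co x y (Y y)) x X) i •
      sy x x (EuclideanSpace.single i (1 : ℝ)) +
      co x x (Y x) i • D (fun y => sy x y (EuclideanSpace.single i (1 : ℝ))) x X := by
    intro i
    have := D.isCovariantDerivativeOnUniv.leibniz (g := u i)
      (smoothFieldAt_const x (EuclideanSpace.single i (1 : ℝ))).diff (hui i)
    have h2 := DFunLike.congr_fun this X
    refine h2.trans ?_
    rw [add_comm, ← hdu]
    rfl
  have hev : ∀ᶠ y in 𝓝 x, Y y = ∑ i, G i y := by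
    filter_upwards [eventually_mem_tangentTriv (d := d) x] with y hy
    conv_lhs => rw [← sy_co hy (Y y), euclidean_eq_sum (co x y (Y y))]
    simp only [map_sum, map_smul, hG, hu]
  have hsum := connection_sum D Finset.univ G hGd
  rw [D.isCovariantDerivativeOnUniv.congr_of_eventuallyEq hY hsum.1 univ_mem hev, hsum.2]
  rw [sum_apply]
  simp only [hGD]
  rw [sum_frame, sy_co_self]

end Christoffel

/-! ### Connections on the bundle of endomorphisms -/

section EndBundle

variable {d : ℕ} {M : Type*} [TopologicalSpace M] [ChartedSpace (EuclideanSpace ℝ (Fin d)) M]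
  [IsManifold (𝓡 d) ∞ M]
  {F F' : Type*} [NormedAddCommGroup F] [NormedSpace ℝ F] [NormedAddCommGroup F'] [NormedSpace ℝ F']

/-- The product rule, read off from the one-variable rule along the coordinate line with velocity
`X`. -/
theorem vderiv_clm_apply {A : M → F →L[ℝ] F'} {u : M → F} {x : M}
    (hA : MDifferentiableAt (𝓡 d) 𝓘(ℝ, F →L[ℝ] F') A x)
    (hu : MDifferentiableAt (𝓡 d) 𝓘(ℝ, F) u x) (X : TangentSpace (𝓡 d) x) :
    vderiv (𝓡 d) (fun y => A y (u y)) x X =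
      vderiv (𝓡 d) A x X (u x) + A x (vderiv (𝓡 d) u x X) := by
  have h1 := (hasDerivAt_comp_curve hA X).clm_apply (hasDerivAt_comp_curve hu X)
  simp only [curve_zero] at h1
  exact (hasDerivAt_comp_curve (hA.clm_apply hu) X).unique h1

theorem trivSnd_end {x y : M} (A : EndTangent d M y) :
    trivSnd x (⟨y, A⟩ : TotalSpace (EndModel d) (EndTangent d M)) = co x y ∘L A ∘L sy x y := by
  rw [trivSnd, hom_trivializationAt_apply]
  rfl

/-- The vertical component of a tangent vector to the bundle of endomorphisms, with respect to the
connection induced by `D`. -/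
def vert (D : Connection d M) (z : TotalSpace (EndModel d) (EndTangent d M)) :
    TangentSpace ((𝓡 d).prod 𝓘(ℝ, EndModel d)) z →ₗ[ℝ]
      TangentSpace (𝓡 d) z.proj →ₗ[ℝ] TangentSpace (𝓡 d) z.proj :=
  LinearMap.mk₂ ℝ (fun v w => sy z.proj z.proj (fibrePart z v (co z.proj z.proj w)) +
      (christoffel D z.proj (basePart z v) (z.2 w) - z.2 (christoffel D z.proj (basePart z v) w)))
    (fun v v' w => by
      simp only [ContinuousLinearMap.map_add, add_apply, LinearMap.map_add, LinearMap.add_apply]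
      abel)
    (fun a v w => by
      simp only [ContinuousLinearMap.map_smul, smul_apply, LinearMap.map_smul,
        LinearMap.smul_apply, smul_add, smul_sub])
    (fun v w w' => by
      simp only [ContinuousLinearMap.map_add, LinearMap.map_add]
      abel)
    (fun a v w => by
      simp only [ContinuousLinearMap.map_smul, LinearMap.map_smul, smul_add, smul_sub])

/-- This is the coordinate formula `ds(X) + [Γ_X, s]` for the covariant derivative of an
endomorphism. It makes sense for an arbitrary tangent vector of the total space, not only for those
tangent to a section. -/
theorem vert_apply (D : Connection d M) (z : TotalSpace (EndModel d) (EndTangent d M))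
    (v : TangentSpace ((𝓡 d).prod 𝓘(ℝ, EndModel d)) z) (w : TangentSpace (𝓡 d) z.proj) :
    vert D z v w = sy z.proj z.proj (fibrePart z v (co z.proj z.proj w)) +
      (christoffel D z.proj (basePart z v) (z.2 w) -
        z.2 (christoffel D z.proj (basePart z v) w)) := rfl

/-- For a fixed base part, `vert` and `fibrePart` differ by a fixed Christoffel term, so `vert` can
replace the fibre coordinate. -/
theorem tangent_ext_vert {D : Connection d M} {z : TotalSpace (EndModel d) (EndTangent d M)}
    {v w : TangentSpace ((𝓡 d).prod 𝓘(ℝ, EndModel d)) z} (h1 : basePart z v = basePart z w)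
    (h2 : vert D z v = vert D z w) : v = w := by
  refine tangent_total_ext h1 ?_
  ext1 e
  have := LinearMap.congr_fun h2 (sy z.proj z.proj e)
  rw [vert_apply, vert_apply, h1, co_sy_self] at this
  have h3 := congrArg (co z.proj z.proj) (add_right_cancel this)
  simpa using h3

theorem isVerticalLift_end_iff (D : Connection d M)
    (z : TotalSpace (EndModel d) (EndTangent d M)) (A : EndTangent d M z.proj)
    (v : TangentSpace ((𝓡 d).prod 𝓘(ℝ, EndModel d)) z) :
    IsVerticalLift z A v ↔ basePart z v = 0 ∧ vert D z v = A.toLinearMap := by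
  rw [isVerticalLift_iff]
  refine and_congr_right fun h => ?_
  rw [trivSnd_end]
  constructor
  · intro h2
    ext w
    rw [vert_apply, h, h2]
    simp
  · intro h2
    ext1 e
    have := LinearMap.congr_fun h2 (sy z.proj z.proj e)
    rw [vert_apply, h, co_sy_self] at this
    have h3 := congrArg (co z.proj z.proj) this
    simpa using h3

/-- Differentiability of sections of the bundle of endomorphisms. -/
theorem mdifferentiableAt_end_iff {s : Π x : M, EndTangent d M x} {x : M} :
    MDifferentiableAt (𝓡 d) ((𝓡 d).prod 𝓘(ℝ, EndModel d))
      (fun y => TotalSpace.mk' (EndModel d) y (s y)) x ↔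
    MDifferentiableAt (𝓡 d) 𝓘(ℝ, EndModel d) (fun y => co x y ∘L s y ∘L sy x y) x := by
  refine (mdifferentiableAt_section (𝓡 d) s (b₀ := x)).trans ?_
  refine Filter.EventuallyEq.mdifferentiableAt_iff (Eventually.of_forall fun y => ?_)
  exact trivSnd_end (s y)

theorem contMDiffAt_end_iff {s : Π x : M, EndTangent d M x} {x : M} :
    ContMDiffAt (𝓡 d) ((𝓡 d).prod 𝓘(ℝ, EndModel d)) ∞
      (fun y => TotalSpace.mk' (EndModel d) y (s y)) x ↔
    ContMDiffAt (𝓡 d) 𝓘(ℝ, EndModel d) ∞ (fun y => co x y ∘L s y ∘L sy x y) x := by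
  refine (contMDiffAt_section x).trans ?_
  refine Filter.EventuallyEq.contMDiffAt_iff (Eventually.of_forall fun y => ?_)
  exact trivSnd_end (s y)

theorem endSection_parts {s : Π x : M, EndTangent d M x} {x : M}
    (hs : MDifferentiableAt (𝓡 d) ((𝓡 d).prod 𝓘(ℝ, EndModel d))
      (fun y => TotalSpace.mk' (EndModel d) y (s y)) x) (X : TangentSpace (𝓡 d) x) :
    basePart (⟨x, s x⟩ : TotalSpace (EndModel d) (EndTangent d M))
      (mfderiv (𝓡 d) ((𝓡 d).prod 𝓘(ℝ, EndModel d))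
        (fun y => TotalSpace.mk' (EndModel d) y (s y)) x X) = X ∧
    fibrePart (⟨x, s x⟩ : TotalSpace (EndModel d) (EndTangent d M))
      (mfderiv (𝓡 d) ((𝓡 d).prod 𝓘(ℝ, EndModel d))
        (fun y => TotalSpace.mk' (EndModel d) y (s y)) x X) =
      vderiv (𝓡 d) (fun y => co x y ∘L s y ∘L sy x y) x X := by
  obtain ⟨h1, h2⟩ := tangentMap_snd_eq (p := ⟨x, X⟩) hs rfl
  constructor
  · have h3 : tangentMap (𝓡 d) (𝓡 d) (fun y : M => y) ⟨x, X⟩ = ⟨x, X⟩ := by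
      have : tangentMap (𝓡 d) (𝓡 d) (id : M → M) = id := tangentMap_id
      exact congrFun this _
    have h4 := h1.symm.trans h3
    have := (TotalSpace.mk.injEq _ _ _ _ ▸ h4).2
    exact eq_of_heq this
  · rw [← h2]
    refine DFunLike.congr_fun (vderiv_congr (Eventually.of_forall fun y => ?_)) X
    exact (trivSnd_end (s y)).symm

theorem apply_diffField {s : Π x : M, EndTangent d M x} {Y : Π x : M, TangentSpace (𝓡 d) x} {x : M}
    (hs : MDifferentiableAt (𝓡 d) 𝓘(ℝ, EndModel d) (fun y => co x y ∘L s y ∘L sy x y) x)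
    (hY : DiffFieldAt Y x) (X : TangentSpace (𝓡 d) x) :
    DiffFieldAt (fun y => s y (Y y)) x ∧
    vderiv (𝓡 d) (fun y => co x y (s y (Y y))) x X =
      vderiv (𝓡 d) (fun y => co x y ∘L s y ∘L sy x y) x X (co x x (Y x)) +
      co x x (s x (sy x x (vderiv (𝓡 d) (fun y => co x y (Y y)) x X))) := by
  have hY' := diffFieldAt_iff.1 hY
  have hev : (fun y => co x y (s y (Y y))) =ᶠ[𝓝 x]
      fun y => (co x y ∘L s y ∘L sy x y) (co x y (Y y)) := by
    filter_upwards [eventually_mem_tangentTriv (d := d) x] with y hy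
    simp only [ContinuousLinearMap.comp_apply, sy_co hy]
  refine ⟨diffFieldAt_iff.2 ((hs.clm_apply hY').congr_of_eventuallyEq hev), ?_⟩
  rw [vderiv_congr hev, vderiv_clm_apply hs hY']
  simp only [ContinuousLinearMap.comp_apply]

/-- This identifies `vert` on the velocity of a section with its covariant derivative: the terms
with the derivative of the coordinates of `Y` cancel. -/
theorem vert_endSection (D : Connection d M) {s : Π x : M, EndTangent d M x} {x : M}
    (hs : MDifferentiableAt (𝓡 d) ((𝓡 d).prod 𝓘(ℝ, EndModel d))
      (fun y => TotalSpace.mk' (EndModel d) y (s y)) x) (X : TangentSpace (𝓡 d) x)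
    {Y : Π x : M, TangentSpace (𝓡 d) x} (hY : DiffFieldAt Y x) :
    vert D (⟨x, s x⟩ : TotalSpace (EndModel d) (EndTangent d M))
      (mfderiv (𝓡 d) ((𝓡 d).prod 𝓘(ℝ, EndModel d))
        (fun y => TotalSpace.mk' (EndModel d) y (s y)) x X) (Y x) =
      D (fun y => s y (Y y)) x X - s x (D Y x X) := by
  obtain ⟨h1, h2⟩ := endSection_parts hs X
  obtain ⟨h3, h4⟩ := apply_diffField (mdifferentiableAt_end_iff.1 hs) hY X
  rw [vert_apply, h1, h2, connection_eq D hY, connection_eq D h3, h4]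
  simp only [map_add, sy_co_self]
  abel

theorem endParallel_iff (D : Connection d M) {s : Π x : M, EndTangent d M x} {x : M}
    (hs : MDifferentiableAt (𝓡 d) ((𝓡 d).prod 𝓘(ℝ, EndModel d))
      (fun y => TotalSpace.mk' (EndModel d) y (s y)) x) (X : TangentSpace (𝓡 d) x) :
    EndParallel D s x X ↔ vert D (⟨x, s x⟩ : TotalSpace (EndModel d) (EndTangent d M))
      (mfderiv (𝓡 d) ((𝓡 d).prod 𝓘(ℝ, EndModel d))
        (fun y => TotalSpace.mk' (EndModel d) y (s y)) x X) = 0 := by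
  constructor
  · intro h
    ext w
    obtain ⟨Y, hY, rfl⟩ := exists_smoothField x w
    rw [vert_endSection D hs X hY.diff, h Y hY, sub_self]; rfl
  · intro h Y hY
    have := vert_endSection D hs X hY.diff
    rw [h] at this
    exact (sub_eq_zero.1 this.symm)

/-- Every endomorphism of a tangent space extends to a smooth section which is parallel along a
given vector. -/
theorem exists_endParallel (D : Connection d M) (x : M) (S : EndTangent d M x)
    (X : TangentSpace (𝓡 d) x) : ∃ s : Π x : M, EndTangent d M x,
    ContMDiffAt (𝓡 d) ((𝓡 d).prod 𝓘(ℝ, EndModel d)) ∞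
      (fun y => TotalSpace.mk' (EndModel d) y (s y)) x ∧ s x = S ∧ EndParallel D s x X := by
  obtain ⟨h, hsm, h0, h1⟩ := exists_affine_function x X
  -- `C` is `[Γ_X, S]` in coordinates. Since `h x = 0` and `dh(X) = 1` for `X ≠ 0`, subtracting `h •
  -- C` keeps the value `S` and cancels the Christoffel term of the covariant derivative.
  set C : EndModel d := LinearMap.toContinuousLinearMap
    ((co x x).toLinearMap ∘ₗ (christoffel D x X ∘ₗ S.toLinearMap -
      S.toLinearMap ∘ₗ christoffel D x X) ∘ₗ (sy x x).toLinearMap) with hC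
  set σ : M → EndModel d := fun y => (co x x ∘L S ∘L sy x x) - h y • C with hσ
  have hσsm : ContMDiffAt (𝓡 d) 𝓘(ℝ, EndModel d) ∞ σ x :=
    contMDiffAt_const.sub (hsm.smul contMDiffAt_const)
  set s : Π x : M, EndTangent d M x := fun y => sy x y ∘L σ y ∘L co x y with hs
  have hev : (fun y => co x y ∘L s y ∘L sy x y) =ᶠ[𝓝 x] σ := by
    filter_upwards [eventually_mem_tangentTriv (d := d) x] with y hy
    ext1 e
    simp only [hs, ContinuousLinearMap.comp_apply, co_sy hy]
  have hssm : ContMDiffAt (𝓡 d) ((𝓡 d).prod 𝓘(ℝ, EndModel d)) ∞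
      (fun y => TotalSpace.mk' (EndModel d) y (s y)) x :=
    contMDiffAt_end_iff.2 (hσsm.congr_of_eventuallyEq hev)
  have hsx : s x = S := by
    ext1 w
    simp [hs, hσ, h0]
  refine ⟨s, hssm, hsx, ?_⟩
  have hdiff := hssm.mdifferentiableAt (n := ∞) (by simp)
  rw [endParallel_iff D hdiff]
  obtain ⟨hb, hf⟩ := endSection_parts hdiff X
  ext w
  rw [vert_apply, hb, hf, vderiv_congr hev]
  have hσ' : vderiv (𝓡 d) σ x X = -(vderiv (𝓡 d) h x X • C) := by
    have hh := hasDerivAt_comp_curve (hsm.mdifferentiableAt (by simp)) X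
    have := (hh.smul_const C).const_sub (co x x ∘L S ∘L sy x x)
    exact (hasDerivAt_comp_curve (hσsm.mdifferentiableAt (by simp)) X).unique this
  rw [hσ']
  simp only [hsx]
  by_cases hX : X = 0
  · subst hX; simp
  · rw [h1 hX]
    simp [hC]

/-- Generators of the horizontal space are velocities of parallel sections, where `vert` vanishes.
Conversely a vector killed by `vert` has the same two components as the velocity of a parallel
section through `z` along its base part, so it is itself a generator. -/
theorem mem_horizontalSpace_end_iff (D : Connection d M)
    (z : TotalSpace (EndModel d) (EndTangent d M))
    (v : TangentSpace ((𝓡 d).prod 𝓘(ℝ, EndModel d)) z) :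
    v ∈ horizontalSpace (EndParallel D) z ↔ vert D z v = 0 := by
  obtain ⟨x, S⟩ := z
  constructor
  · intro hv
    induction hv using Submodule.span_induction with
    | mem v hv =>
      obtain ⟨s, X, hs, hpar, heq⟩ := hv
      have hS : s x = S := by
        have h := congrArg TotalSpace.proj heq
        exact eq_of_heq (TotalSpace.mk.injEq _ _ _ _ ▸ h).2
      subst hS
      have hv : mfderiv (𝓡 d) ((𝓡 d).prod 𝓘(ℝ, EndModel d))
          (fun y => TotalSpace.mk' (EndModel d) y (s y)) x X = v :=
        eq_of_heq (TotalSpace.mk.injEq _ _ _ _ ▸ heq).2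
      subst hv
      exact (endParallel_iff D (hs.mdifferentiableAt (by simp)) X).1 hpar
    | zero => exact map_zero _
    | add v w _ _ hv hw => rw [map_add, hv, hw, add_zero]
    | smul a v _ hv => rw [map_smul, hv, smul_zero]
  · intro hv
    obtain ⟨s, hs, rfl, hpar⟩ := exists_endParallel D x S (basePart _ v)
    refine Submodule.subset_span ⟨s, basePart _ v, hs, hpar, ?_⟩
    have hd := hs.mdifferentiableAt (n := ∞) (by simp)
    have h1 := (endSection_parts hd (basePart _ v)).1
    have h2 := (endParallel_iff D hd _).1 hpar
    exact congrArg (TotalSpace.mk _) (tangent_ext_vert (D := D) h1 (h2.trans hv.symm))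

end EndBundle

/-! ### Symmetry of second derivatives -/

section Torsion

variable {d : ℕ} {M : Type*} [TopologicalSpace M] [ChartedSpace (EuclideanSpace ℝ (Fin d)) M]
  [IsManifold (𝓡 d) ∞ M]

theorem mem_tangentTriv_iff {x y : M} :
    y ∈ (tangentTriv (d := d) x).baseSet ↔ y ∈ (chartAt (EuclideanSpace ℝ (Fin d)) x).source := by
  rw [TangentBundle.trivializationAt_baseSet]

theorem sy_eq_mfderiv {x y : M} (h : y ∈ (tangentTriv (d := d) x).baseSet) :
    sy x y = mfderiv 𝓘(ℝ, EuclideanSpace ℝ (Fin d)) (𝓡 d) (extChartAt (𝓡 d) x).symm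
      (extChartAt (𝓡 d) x y) := by
  rw [sy, TangentBundle.symmL_trivializationAt (mem_tangentTriv_iff.1 h),
    ModelWithCorners.range_eq_univ, mfderivWithin_univ]

theorem co_eq_mfderiv {x y : M} (h : y ∈ (tangentTriv (d := d) x).baseSet) :
    co x y = mfderiv (𝓡 d) 𝓘(ℝ, EuclideanSpace ℝ (Fin d)) (extChartAt (𝓡 d) x) y :=
  TangentBundle.continuousLinearMapAt_trivializationAt (mem_tangentTriv_iff.1 h)

/-- In the chart these fields become constant near the centre, and constant fields commute. -/
theorem mlieBracket_const (x : M) (v w : EuclideanSpace ℝ (Fin d)) :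
    VectorField.mlieBracket (𝓡 d) (fun y => sy x y v) (fun y => sy x y w) x = 0 := by
  have key : ∀ u : EuclideanSpace ℝ (Fin d),
      VectorField.mpullbackWithin 𝓘(ℝ, EuclideanSpace ℝ (Fin d)) (𝓡 d) (extChartAt (𝓡 d) x).symm
        (fun y => sy x y u) (Set.range (𝓡 d)) =ᶠ[𝓝 (extChartAt (𝓡 d) x x)] fun _ => u := by
    intro u
    filter_upwards [extChartAt_target_mem_nhds (I := 𝓡 d) x] with e he
    have hsrc : (extChartAt (𝓡 d) x).symm e ∈ (chartAt (EuclideanSpace ℝ (Fin d)) x).source := by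
      rw [← extChartAt_source (𝓡 d)]
      exact (extChartAt (𝓡 d) x).map_target he
    rw [VectorField.mpullbackWithin_apply, sy, TangentBundle.symmL_trivializationAt hsrc,
      (extChartAt (𝓡 d) x).right_inv he]
    exact (isInvertible_mfderivWithin_extChartAt_symm (I := 𝓡 d) he).inverse_apply_eq.2 rfl
  have h0 : VectorField.lieBracketWithin ℝ
      (VectorField.mpullbackWithin 𝓘(ℝ, EuclideanSpace ℝ (Fin d)) (𝓡 d) (extChartAt (𝓡 d) x).symm
        (fun y => sy x y v) (Set.range (𝓡 d)))
      (VectorField.mpullbackWithin 𝓘(ℝ, EuclideanSpace ℝ (Fin d)) (𝓡 d) (extChartAt (𝓡 d) x).symm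
        (fun y => sy x y w) (Set.range (𝓡 d)))
      ((extChartAt (𝓡 d) x).symm ⁻¹' Set.univ ∩ Set.range (𝓡 d)) (extChartAt (𝓡 d) x x) = 0 := by
    rw [((key v).filter_mono nhdsWithin_le_nhds).lieBracketWithin_vectorField_eq (key v).eq_of_nhds
      ((key w).filter_mono nhdsWithin_le_nhds) (key w).eq_of_nhds]
    simp only [VectorField.lieBracketWithin]
    simp
  rw [VectorField.mlieBracket, VectorField.mlieBracketWithin_apply]
  exact (congrArg _ h0).trans (map_zero _)

/-- Torsion-freeness applied to commuting coordinate fields. -/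
theorem christoffel_symm {g : Metric d M} {D : Connection d M} (hD : IsWeylConnection g D) (x : M)
    (X Y : TangentSpace (𝓡 d) x) : christoffel D x X Y = christoffel D x Y X := by
  have := hD.torsionFree (fun y => sy x y (co x x X)) (fun y => sy x y (co x x Y)) x
    (smoothFieldAt_const x _) (smoothFieldAt_const x _)
  rw [mlieBracket_const] at this
  simp only [sy_co_self] at this
  rw [christoffel_apply, christoffel_apply]
  exact sub_eq_zero.1 this

end Torsion

/-! ### Second derivatives of the immersion. -/

section Along

variable {m k : ℕ}
  {M : Type*} [TopologicalSpace M] [ChartedSpace (EuclideanSpace ℝ (Fin m)) M]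
  [IsManifold (𝓡 m) ∞ M]
  {N : Type*} [TopologicalSpace N] [ChartedSpace (EuclideanSpace ℝ (Fin (m + k))) N]
  [IsManifold (𝓡 (m + k)) ∞ N]
  (φ : C^∞⟮𝓡 m, M; 𝓡 (m + k), N⟯)

theorem eventually_mem_tangentTriv_comp (x : M) :
    ∀ᶠ y in 𝓝 x, φ y ∈ (tangentTriv (d := m + k) (φ x)).baseSet :=
  φ.contMDiff.continuous.continuousAt.eventually (eventually_mem_tangentTriv (φ x))

theorem mdifferentiableAt_immersion (x : M) : MDifferentiableAt (𝓡 m) (𝓡 (m + k)) φ x :=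
  φ.contMDiff.contMDiffAt.mdifferentiableAt (by simp)

/-- The differential of `φ` in the preferred charts at `x` and `φ x`. -/
def difCo (x y : M) : EuclideanSpace ℝ (Fin m) →L[ℝ] EuclideanSpace ℝ (Fin (m + k)) :=
  co (φ x) (φ y) ∘L dif φ y ∘L sy x y

theorem contMDiffAt_difCo (x : M) :
    ContMDiffAt (𝓡 m) 𝓘(ℝ, EuclideanSpace ℝ (Fin m) →L[ℝ] EuclideanSpace ℝ (Fin (m + k))) ∞
      (difCo φ x) x :=
  (φ.contMDiff.contMDiffAt (x := x)).mfderiv_const (m := ∞) (by simp)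

theorem difCo_eq_fderiv (x : M) :
    ∀ᶠ e in 𝓝 (extChartAt (𝓡 m) x x), difCo φ x ((extChartAt (𝓡 m) x).symm e) =
      fderiv ℝ (fun e => extChartAt (𝓡 (m + k)) (φ x) (φ ((extChartAt (𝓡 m) x).symm e))) e := by
  have h1 : ∀ᶠ e in 𝓝 (extChartAt (𝓡 m) x x),
      φ ((extChartAt (𝓡 m) x).symm e) ∈ (tangentTriv (d := m + k) (φ x)).baseSet := by
    have := (continuousAt_extChartAt_symm (I := 𝓡 m) x).tendsto
    rw [extChartAt_to_inv] at this
    exact this.eventually (eventually_mem_tangentTriv_comp φ x)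
  filter_upwards [h1, extChartAt_target_mem_nhds (I := 𝓡 m) x] with e he1 he
  have hsrc : (extChartAt (𝓡 m) x).symm e ∈ (extChartAt (𝓡 m) x).source :=
    (extChartAt (𝓡 m) x).map_target he
  have hbase : (extChartAt (𝓡 m) x).symm e ∈ (tangentTriv (d := m) x).baseSet := by
    rw [mem_tangentTriv_iff, ← extChartAt_source (𝓡 m)]; exact hsrc
  have hs : MDifferentiableAt 𝓘(ℝ, EuclideanSpace ℝ (Fin m)) (𝓡 m) (extChartAt (𝓡 m) x).symm e := by
    have := mdifferentiableWithinAt_extChartAt_symm (I := 𝓡 m) he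
    rwa [ModelWithCorners.range_eq_univ, mdifferentiableWithinAt_univ] at this
  have hψ : MDifferentiableAt (𝓡 (m + k)) 𝓘(ℝ, EuclideanSpace ℝ (Fin (m + k)))
      (extChartAt (𝓡 (m + k)) (φ x)) (φ ((extChartAt (𝓡 m) x).symm e)) :=
    mdifferentiableAt_extChartAt (mem_tangentTriv_iff.1 he1)
  have hφs : MDifferentiableAt 𝓘(ℝ, EuclideanSpace ℝ (Fin m)) (𝓡 (m + k))
      (φ ∘ (extChartAt (𝓡 m) x).symm) e := (mdifferentiableAt_immersion φ _).comp e hs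
  have h2 := mfderiv_comp e (mdifferentiableAt_immersion φ _) hs
  have h3 := mfderiv_comp (g := extChartAt (𝓡 (m + k)) (φ x)) e hψ hφs
  rw [mfderiv_eq_fderiv] at h3
  refine Eq.trans ?_ h3.symm
  rw [h2, difCo, co_eq_mfderiv he1, sy_eq_mfderiv hbase, (extChartAt (𝓡 m) x).right_inv he]
  rfl

/-- Near `x`, `difCo` is the Jacobian of the coordinate expression of `φ`, so its derivative is a
second derivative and the Schwarz theorem applies. -/
theorem vderiv_difCo_symm (x : M) (X Y : TangentSpace (𝓡 m) x) :
    vderiv (𝓡 m) (difCo φ x) x X (co x x Y) = vderiv (𝓡 m) (difCo φ x) x Y (co x x X) := by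
  set f : EuclideanSpace ℝ (Fin m) → EuclideanSpace ℝ (Fin (m + k)) :=
    fun e => extChartAt (𝓡 (m + k)) (φ x) (φ ((extChartAt (𝓡 m) x).symm e)) with hf
  have hsm : ContDiffAt ℝ ∞ f (extChartAt (𝓡 m) x x) := by
    have := ((contMDiffAt_iff).1 (φ.contMDiff.contMDiffAt (x := x))).2
    rw [ModelWithCorners.range_eq_univ, contDiffWithinAt_univ] at this
    exact this
  have hsymm : IsSymmSndFDerivAt ℝ f (extChartAt (𝓡 m) x x) :=
    hsm.isSymmSndFDerivAt (by
      simp only [minSmoothness_of_isRCLikeNormedField]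
      exact WithTop.coe_le_coe.2 (le_top (a := (2 : ℕ∞))))
  have hd : DifferentiableAt ℝ (fderiv ℝ f) (extChartAt (𝓡 m) x x) :=
    (hsm.fderiv_right (m := ∞) (by simp)).differentiableAt (by simp)
  have key : ∀ Z : TangentSpace (𝓡 m) x, vderiv (𝓡 m) (difCo φ x) x Z =
      fderiv ℝ (fderiv ℝ f) (extChartAt (𝓡 m) x x) (co x x Z) := by
    intro Z
    have h1 := hasDerivAt_comp_curve ((contMDiffAt_difCo φ x).mdifferentiableAt (by simp)) Z
    have hl : HasDerivAt (fun t : ℝ => extChartAt (𝓡 m) x x + t • co x x Z) (co x x Z) 0 := by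
      simpa using ((hasDerivAt_id (0 : ℝ)).smul_const (co x x Z)).const_add (extChartAt (𝓡 m) x x)
    have hd' : HasFDerivAt (fderiv ℝ f) (fderiv ℝ (fderiv ℝ f) (extChartAt (𝓡 m) x x))
      (extChartAt (𝓡 m) x x + (0 : ℝ) • co x x Z) := by simpa using hd.hasFDerivAt
    have h2 := hd'.comp_hasDerivAt (0 : ℝ) hl
    refine h1.unique (h2.congr_of_eventuallyEq ?_)
    filter_upwards [(tendsto_line x Z).eventually (difCo_eq_fderiv φ x)] with t ht
    exact ht
  rw [key, key]
  exact hsymm _ _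

end Along

/-! ### Connections along an immersion -/

section Along

variable {m k : ℕ}
  {M : Type*} [TopologicalSpace M] [ChartedSpace (EuclideanSpace ℝ (Fin m)) M]
  [IsManifold (𝓡 m) ∞ M]
  {N : Type*} [TopologicalSpace N] [ChartedSpace (EuclideanSpace ℝ (Fin (m + k))) N]
  [IsManifold (𝓡 (m + k)) ∞ N]
  (φ : C^∞⟮𝓡 m, M; 𝓡 (m + k), N⟯)

/-- Differentiability of vector fields along `φ`. -/
def DiffAlongAt (U : Π x : M, TangentSpace (𝓡 (m + k)) (φ x)) (x : M) : Prop :=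
  MDifferentiableAt (𝓡 m) 𝓘(ℝ, EuclideanSpace ℝ (Fin (m + k))) (fun y => co (φ x) (φ y) (U y)) x

variable {φ}

theorem smoothAlongAt_iff {U : Π x : M, TangentSpace (𝓡 (m + k)) (φ x)} {x : M} :
    SmoothAlongAt φ U x ↔ ContMDiffAt (𝓡 m) 𝓘(ℝ, EuclideanSpace ℝ (Fin (m + k))) ∞
      (fun y => co (φ x) (φ y) (U y)) x := by
  rw [SmoothAlongAt, contMDiffAt_totalSpace]
  refine (and_iff_right φ.contMDiff.contMDiffAt).trans (Filter.EventuallyEq.contMDiffAt_iff ?_)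
  filter_upwards [eventually_mem_tangentTriv_comp φ x] with y hy
  exact tangentTriv_apply hy _

theorem SmoothAlongAt.diff {U : Π x : M, TangentSpace (𝓡 (m + k)) (φ x)} {x : M}
    (h : SmoothAlongAt φ U x) : DiffAlongAt φ U x :=
  (smoothAlongAt_iff.1 h).mdifferentiableAt (by simp)

theorem connection_congr {d : ℕ} {M : Type*} [TopologicalSpace M]
    [ChartedSpace (EuclideanSpace ℝ (Fin d)) M] [IsManifold (𝓡 d) ∞ M] (D : Connection d M)
    {Y Y' : Π x : M, TangentSpace (𝓡 d) x} {x : M} (hY : DiffFieldAt Y x)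
    (h : ∀ᶠ y in 𝓝 x, Y y = Y' y) : D Y x = D Y' x := by
  refine D.isCovariantDerivativeOnUniv.congr_of_eventuallyEq hY ?_ univ_mem h
  refine diffFieldAt_iff.2 ((diffFieldAt_iff.1 hY).congr_of_eventuallyEq ?_)
  filter_upwards [h] with y hy
  rw [hy]

theorem covAlong_eq (D : Connection (m + k) N) {U : Π x : M, TangentSpace (𝓡 (m + k)) (φ x)} {x : M}
    (hU : DiffAlongAt φ U x) (X : TangentSpace (𝓡 m) x) :
    covAlong D φ U x X = sy (φ x) (φ x) (vderiv (𝓡 m) (fun y => co (φ x) (φ y) (U y)) x X) +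
      christoffel D (φ x) (dif φ x X) (U x) := by
  have hev : ∀ i, (fun y => (tangentTriv (φ x) ⟨φ y, U y⟩).2 i) =ᶠ[𝓝 x]
      fun y => co (φ x) (φ y) (U y) i := by
    intro i
    filter_upwards [eventually_mem_tangentTriv_comp φ x] with y hy
    rw [tangentTriv_apply hy]
  have hd : ∀ i, vderiv (𝓡 m) (fun y => (tangentTriv (φ x) ⟨φ y, U y⟩).2 i) x X =
      vderiv (𝓡 m) (fun y => co (φ x) (φ y) (U y)) x X i := by
    intro i
    rw [vderiv_congr (hev i)]
    exact vderiv_clm_comp (EuclideanSpace.proj (𝕜 := ℝ) i) hU X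
  have h2 := sum_frame D (φ x) (dif φ x X)
    (vderiv (𝓡 m) (fun y => co (φ x) (φ y) (U y)) x X) (co (φ x) (φ x) (U x))
  rw [sy_co_self] at h2
  rw [← h2]
  refine Finset.sum_congr rfl fun i _ => ?_
  rw [← hd]
  have h3 : (tangentTriv (φ x) ⟨φ x, U x⟩).2 = co (φ x) (φ x) (U x) :=
    tangentTriv_apply (mem_tangentTriv _) _
  rw [← h3]
  -- The frame in `covAlong` is written with the inverse `symm` of the trivialization and that of
  -- `christoffel` with `symmL`. They are compared only on the base set, so the locality of `D` is
  -- needed.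
  have hsy : ∀ y ∈ (tangentTriv (d := m + k) (φ x)).baseSet,
      sy (φ x) y (EuclideanSpace.single i (1 : ℝ)) =
      (tangentTriv (φ x)).symm y (EuclideanSpace.single i (1 : ℝ)) := fun y hy =>
    Bundle.Trivialization.symmL_apply _ hy _
  have hD := connection_congr D
    (smoothFieldAt_const (φ x) (EuclideanSpace.single i (1 : ℝ))).diff
    ((eventually_mem_tangentTriv (d := m + k) (φ x)).mono hsy)
  rw [hD, hsy _ (mem_tangentTriv _)]
  rfl

/-- Sections of the bundle of endomorphisms along `φ`. -/
theorem mdifferentiableAt_endAlong_iff {S : Π x : M, EndTangent (m + k) N (φ x)} {x : M} :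
    MDifferentiableAt (𝓡 m) ((𝓡 (m + k)).prod 𝓘(ℝ, EndModel (m + k)))
      (fun y => TotalSpace.mk' (EndModel (m + k)) (E := EndTangent (m + k) N) (φ y) (S y)) x ↔
    MDifferentiableAt (𝓡 m) 𝓘(ℝ, EndModel (m + k))
      (fun y => co (φ x) (φ y) ∘L S y ∘L sy (φ x) (φ y)) x := by
  rw [mdifferentiableAt_totalSpace]
  refine (and_iff_right (mdifferentiableAt_immersion φ x)).trans
    (Filter.EventuallyEq.mdifferentiableAt_iff (Eventually.of_forall fun y => ?_))
  exact trivSnd_end (S y)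

theorem endAlong_parts {S : Π x : M, EndTangent (m + k) N (φ x)} {x : M}
    (hs : MDifferentiableAt (𝓡 m) ((𝓡 (m + k)).prod 𝓘(ℝ, EndModel (m + k)))
      (fun y => TotalSpace.mk' (EndModel (m + k)) (E := EndTangent (m + k) N) (φ y) (S y)) x)
    (X : TangentSpace (𝓡 m) x) :
    basePart (⟨φ x, S x⟩ : TotalSpace (EndModel (m + k)) (EndTangent (m + k) N))
      (mfderiv (𝓡 m) ((𝓡 (m + k)).prod 𝓘(ℝ, EndModel (m + k)))
        (fun y => TotalSpace.mk' (EndModel (m + k)) (E := EndTangent (m + k) N) (φ y) (S y)) x X) =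
      dif φ x X ∧
    fibrePart (⟨φ x, S x⟩ : TotalSpace (EndModel (m + k)) (EndTangent (m + k) N))
      (mfderiv (𝓡 m) ((𝓡 (m + k)).prod 𝓘(ℝ, EndModel (m + k)))
        (fun y => TotalSpace.mk' (EndModel (m + k)) (E := EndTangent (m + k) N) (φ y) (S y)) x X) =
      vderiv (𝓡 m) (fun y => co (φ x) (φ y) ∘L S y ∘L sy (φ x) (φ y)) x X := by
  obtain ⟨h1, h2⟩ := tangentMap_snd_eq (p := ⟨x, X⟩) hs rfl
  constructor
  · have h3 : tangentMap (𝓡 m) (𝓡 (m + k)) φ ⟨x, X⟩ = ⟨φ x, dif φ x X⟩ := rfl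
    have h4 := h1.symm.trans h3
    have := (TotalSpace.mk.injEq _ _ _ _ ▸ h4).2
    exact eq_of_heq this
  · rw [← h2]
    refine DFunLike.congr_fun (vderiv_congr (Eventually.of_forall fun y => ?_)) X
    exact (trivSnd_end (S y)).symm

theorem apply_diffAlong {S : Π x : M, EndTangent (m + k) N (φ x)}
    {U : Π x : M, TangentSpace (𝓡 (m + k)) (φ x)} {x : M}
    (hs : MDifferentiableAt (𝓡 m) 𝓘(ℝ, EndModel (m + k))
      (fun y => co (φ x) (φ y) ∘L S y ∘L sy (φ x) (φ y)) x)
    (hU : DiffAlongAt φ U x) (X : TangentSpace (𝓡 m) x) :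
    DiffAlongAt φ (fun y => S y (U y)) x ∧
    vderiv (𝓡 m) (fun y => co (φ x) (φ y) (S y (U y))) x X =
      vderiv (𝓡 m) (fun y => co (φ x) (φ y) ∘L S y ∘L sy (φ x) (φ y)) x X
        (co (φ x) (φ x) (U x)) +
      co (φ x) (φ x) (S x (sy (φ x) (φ x)
        (vderiv (𝓡 m) (fun y => co (φ x) (φ y) (U y)) x X))) := by
  have hev : (fun y => co (φ x) (φ y) (S y (U y))) =ᶠ[𝓝 x]
      fun y => (co (φ x) (φ y) ∘L S y ∘L sy (φ x) (φ y)) (co (φ x) (φ y) (U y)) := by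
    filter_upwards [eventually_mem_tangentTriv_comp φ x] with y hy
    simp only [ContinuousLinearMap.comp_apply, sy_co hy]
  have hU' : MDifferentiableAt (𝓡 m) 𝓘(ℝ, EuclideanSpace ℝ (Fin (m + k)))
    (fun y => co (φ x) (φ y) (U y)) x := hU
  refine ⟨(hs.clm_apply hU').congr_of_eventuallyEq hev, ?_⟩
  rw [vderiv_congr hev, vderiv_clm_apply hs hU']
  simp only [ContinuousLinearMap.comp_apply]

/-- The analogue of `vert_endSection` for endomorphism fields along `φ`; it computes the vertical
component of the velocity of a map from `M` into the endomorphism bundle of `N`. -/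
theorem vert_endAlong (D : Connection (m + k) N) {S : Π x : M, EndTangent (m + k) N (φ x)}
    {x : M} (hs : MDifferentiableAt (𝓡 m) ((𝓡 (m + k)).prod 𝓘(ℝ, EndModel (m + k)))
      (fun y => TotalSpace.mk' (EndModel (m + k)) (E := EndTangent (m + k) N) (φ y) (S y)) x)
    (X : TangentSpace (𝓡 m) x)
    {U : Π x : M, TangentSpace (𝓡 (m + k)) (φ x)} (hU : DiffAlongAt φ U x) :
    vert D (⟨φ x, S x⟩ : TotalSpace (EndModel (m + k)) (EndTangent (m + k) N))
      (mfderiv (𝓡 m) ((𝓡 (m + k)).prod 𝓘(ℝ, EndModel (m + k)))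
        (fun y => TotalSpace.mk' (EndModel (m + k)) (E := EndTangent (m + k) N) (φ y) (S y)) x X)
        (U x) =
      covAlong D φ (fun y => S y (U y)) x X - S x (covAlong D φ U x X) := by
  obtain ⟨h1, h2⟩ := endAlong_parts hs X
  obtain ⟨h3, h4⟩ := apply_diffAlong (mdifferentiableAt_endAlong_iff.1 hs) hU X
  rw [vert_apply, h1, h2, covAlong_eq D hU, covAlong_eq D h3, h4]
  simp only [map_add, sy_co_self]
  abel

/-- The difference `(D dφ)(X, Y)` between `D_N,X (dφ Y)` and `dφ (D_M,X Y)`. -/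
def hessian (φ : C^∞⟮𝓡 m, M; 𝓡 (m + k), N⟯) (DM : Connection m M) (DN : Connection (m + k) N)
    (x : M) :
    TangentSpace (𝓡 m) x →ₗ[ℝ] TangentSpace (𝓡 m) x →ₗ[ℝ] TangentSpace (𝓡 (m + k)) (φ x) :=
  LinearMap.mk₂ ℝ (fun X v => sy (φ x) (φ x) (vderiv (𝓡 m) (difCo φ x) x X (co x x v)) +
      christoffel DN (φ x) (dif φ x X) (dif φ x v) - dif φ x (christoffel DM x X v))
    (fun v v' w => by
      simp only [ContinuousLinearMap.map_add, add_apply, LinearMap.map_add, LinearMap.add_apply]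
      abel)
    (fun a v w => by
      simp only [ContinuousLinearMap.map_smul, smul_apply, LinearMap.map_smul,
        LinearMap.smul_apply, smul_add, smul_sub])
    (fun v w w' => by
      simp only [ContinuousLinearMap.map_add, LinearMap.map_add]
      abel)
    (fun a v w => by
      simp only [ContinuousLinearMap.map_smul, LinearMap.map_smul, smul_add, smul_sub])

theorem hessian_apply (DM : Connection m M) (DN : Connection (m + k) N) (x : M)
    (X v : TangentSpace (𝓡 m) x) : hessian φ DM DN x X v =
      sy (φ x) (φ x) (vderiv (𝓡 m) (difCo φ x) x X (co x x v)) +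
      christoffel DN (φ x) (dif φ x X) (dif φ x v) - dif φ x (christoffel DM x X v) := rfl

theorem difCo_apply_eventually (x : M) (Y : Π x : M, TangentSpace (𝓡 m) x) :
    (fun y => co (φ x) (φ y) (dif φ y (Y y))) =ᶠ[𝓝 x] fun y => difCo φ x y (co x y (Y y)) := by
  filter_upwards [eventually_mem_tangentTriv (d := m) x] with y hy
  simp only [difCo, ContinuousLinearMap.comp_apply, sy_co hy]

theorem diffAlong_dif {Y : Π x : M, TangentSpace (𝓡 m) x} {x : M} (hY : DiffFieldAt Y x) :
    DiffAlongAt φ (fun y => dif φ y (Y y)) x :=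
  (((contMDiffAt_difCo φ x).mdifferentiableAt (by simp)).clm_apply
    (diffFieldAt_iff.1 hY)).congr_of_eventuallyEq (difCo_apply_eventually x Y)

/-- The derivative of the coordinates of `Y` enters `D_N,X (dφ Y)` and `dφ (D_M,X Y)` in the same
way. The difference therefore depends only on `Y x`, which justifies the coordinate definition of
`hessian`. -/
theorem covAlong_dif (DM : Connection m M) (DN : Connection (m + k) N)
    {Y : Π x : M, TangentSpace (𝓡 m) x} {x : M} (hY : DiffFieldAt Y x) (X : TangentSpace (𝓡 m) x) :
    covAlong DN φ (fun y => dif φ y (Y y)) x X =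
      hessian φ DM DN x X (Y x) + dif φ x (DM Y x X) := by
  rw [covAlong_eq DN (diffAlong_dif hY), vderiv_congr (difCo_apply_eventually x Y),
    vderiv_clm_apply ((contMDiffAt_difCo φ x).mdifferentiableAt (by simp)) (diffFieldAt_iff.1 hY),
    hessian_apply, connection_eq DM hY]
  simp only [map_add, difCo, ContinuousLinearMap.comp_apply, sy_co_self]
  abel

/-- Each of the three terms is symmetric: the first by Schwarz, the other two because both
connections are torsion-free. -/
theorem hessian_symm {gM : Metric m M} {gN : Metric (m + k) N} {DM : Connection m M}
    {DN : Connection (m + k) N} (hDM : IsWeylConnection gM DM) (hDN : IsWeylConnection gN DN)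
    (x : M) (X Y : TangentSpace (𝓡 m) x) :
    hessian φ DM DN x X Y = hessian φ DM DN x Y X := by
  rw [hessian_apply, hessian_apply, vderiv_difCo_symm, christoffel_symm hDM x X Y,
    christoffel_symm hDN (φ x) (dif φ x X)]

end Along

/-! ### Invertibility of definite bilinear forms -/

/-- Definiteness gives injectivity, and a space and its dual have the same dimension. -/
theorem isInvertible_of_definite {E : Type*} [AddCommGroup E] [Module ℝ E] [TopologicalSpace E]
    [IsTopologicalAddGroup E] [ContinuousSMul ℝ E] [T2Space E] [FiniteDimensional ℝ E]
    (L : E →L[ℝ] (E →L[ℝ] ℝ)) (h : ∀ v, L v v = 0 → v = 0) : L.IsInvertible := by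
  have hfin : FiniteDimensional ℝ (E →L[ℝ] ℝ) :=
    FiniteDimensional.of_injective (ContinuousLinearMap.coeLM ℝ)
      ContinuousLinearMap.coe_injective
  have hinj : Function.Injective L.toLinearMap := by
    rw [← LinearMap.ker_eq_bot, LinearMap.ker_eq_bot']
    intro v hv
    exact h v (by rw [show L v = 0 from hv]; rfl)
  have hdim : Module.finrank ℝ E = Module.finrank ℝ (E →L[ℝ] ℝ) := by
    have e : (E →L[ℝ] ℝ) ≃ₗ[ℝ] (E →ₗ[ℝ] ℝ) := LinearMap.toContinuousLinearMap.symm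
    rw [e.finrank_eq]
    exact (Subspace.dual_finrank_eq (K := ℝ) (V := E)).symm
  exact ⟨(LinearEquiv.ofInjectiveOfFinrankEq L.toLinearMap hinj hdim).toContinuousLinearEquiv, rfl⟩

/-! ### Metrics in coordinates and the Weyl condition. -/

section Metric

variable {d : ℕ} {M : Type*} [TopologicalSpace M] [ChartedSpace (EuclideanSpace ℝ (Fin d)) M]
  [IsManifold (𝓡 d) ∞ M]

instance finiteDimensional_tangentSpace (x : M) : FiniteDimensional ℝ (TangentSpace (𝓡 d) x) :=
  inferInstanceAs (FiniteDimensional ℝ (EuclideanSpace ℝ (Fin d)))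

instance t2Space_tangentSpace (x : M) : T2Space (TangentSpace (𝓡 d) x) :=
  inferInstanceAs (T2Space (EuclideanSpace ℝ (Fin d)))

theorem finrank_tangentSpace (x : M) : Module.finrank ℝ (TangentSpace (𝓡 d) x) = d :=
  (finrank_euclideanSpace_fin (𝕜 := ℝ) (n := d))

theorem metric_symm (g : Metric d M) (x : M) (v w : TangentSpace (𝓡 d) x) :
    g.inner x v w = g.inner x w v := g.symm x v w

theorem metric_pos (g : Metric d M) (x : M) {v : TangentSpace (𝓡 d) x} (hv : v ≠ 0) :
    0 < g.inner x v v := g.pos x v hv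

theorem metric_definite (g : Metric d M) (x : M) {v : TangentSpace (𝓡 d) x}
    (h : g.inner x v v = 0) : v = 0 := by
  by_contra hv
  exact (metric_pos g x hv).ne' h

/-- The metric in the preferred chart at `x`. -/
def metricCo (g : Metric d M) (x y : M) :
    EuclideanSpace ℝ (Fin d) →L[ℝ] EuclideanSpace ℝ (Fin d) →L[ℝ] ℝ :=
  (ContinuousLinearMap.precomp ℝ (sy x y)) ∘L g.inner y ∘L sy x y

theorem metricCo_apply (g : Metric d M) (x y : M) (v w : EuclideanSpace ℝ (Fin d)) :
    metricCo g x y v w = g.inner y (sy x y v) (sy x y w) := rfl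

theorem inner_eq_metricCo (g : Metric d M) {x y : M} (h : y ∈ (tangentTriv (d := d) x).baseSet)
    (v w : TangentSpace (𝓡 d) y) : g.inner y v w = metricCo g x y (co x y v) (co x y w) := by
  rw [metricCo_apply, sy_co h, sy_co h]

theorem contMDiffAt_metricCo (g : Metric d M) (x : M) :
    ContMDiffAt (𝓡 d) 𝓘(ℝ, EuclideanSpace ℝ (Fin d) →L[ℝ] EuclideanSpace ℝ (Fin d) →L[ℝ] ℝ) ∞
      (metricCo g x) x := by
  have h := ((contMDiffAt_hom_bundle _).1 (g.contMDiff.contMDiffAt (x := x))).2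
  refine h.congr_of_eventuallyEq ?_
  filter_upwards [eventually_mem_tangentTriv (d := d) x] with y hy
  ext v w
  rw [metricCo_apply]
  simp only [ContinuousLinearMap.inCoordinates, ContinuousLinearMap.comp_apply]
  have h2 := trivSnd_eq_continuousLinearMapAt (F := EuclideanSpace ℝ (Fin d) →L[ℝ] ℝ)
    (V := fun y : M => TangentSpace (𝓡 d) y →L[ℝ] ℝ) (x := x) (y := y) (by
      rw [hom_trivializationAt_baseSet]
      exact ⟨hy, Set.mem_univ _⟩) (g.inner y (sy x y v))
  have h3 : trivSnd x (⟨y, g.inner y (sy x y v)⟩ :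
      TotalSpace (EuclideanSpace ℝ (Fin d) →L[ℝ] ℝ) fun y : M => TangentSpace (𝓡 d) y →L[ℝ] ℝ) w =
      g.inner y (sy x y v) (sy x y w) := by
    rw [trivSnd, hom_trivializationAt_apply]
    simp [ContinuousLinearMap.inCoordinates, sy]
  rw [← h3, h2]
  rfl

theorem vderiv_metricCo_apply (g : Metric d M) (x : M) (X : TangentSpace (𝓡 d) x)
    (v w : EuclideanSpace ℝ (Fin d)) :
    vderiv (𝓡 d) (fun y => metricCo g x y v w) x X = vderiv (𝓡 d) (metricCo g x) x X v w := by
  have hg := (contMDiffAt_metricCo g x).mdifferentiableAt (by simp)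
  have hgv : MDifferentiableAt (𝓡 d) 𝓘(ℝ, EuclideanSpace ℝ (Fin d) →L[ℝ] ℝ)
      (fun y => metricCo g x y v) x := hg.clm_apply mdifferentiableAt_const
  have h1 : HasDerivAt (fun t => metricCo g x (curve x X t) v w)
      (vderiv (𝓡 d) (metricCo g x) x X v w) 0 := by
    have := ((hasDerivAt_comp_curve hg X).clm_apply (hasDerivAt_const 0 v)).clm_apply
      (hasDerivAt_const 0 w)
    simpa using this
  exact (hasDerivAt_comp_curve (hgv.clm_apply mdifferentiableAt_const) X).unique h1

/-- The Weyl condition evaluated on fields with constant coordinates, whose covariant derivatives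
are Christoffel symbols. -/
theorem exists_vderiv_metricCo {g : Metric d M} {D : Connection d M} (hD : IsWeylConnection g D) :
    ∃ α : Π x : M, TangentSpace (𝓡 d) x →L[ℝ] ℝ, ∀ (x : M) (X v w : TangentSpace (𝓡 d) x),
      vderiv (𝓡 d) (metricCo g x) x X (co x x v) (co x x w) =
        g.inner x (christoffel D x X v) w + g.inner x v (christoffel D x X w) +
          α x X * g.inner x v w := by
  obtain ⟨α, hα⟩ := hD.conformal
  refine ⟨α, fun x X v w => ?_⟩
  have := hα _ _ x (smoothFieldAt_const x (co x x v)) (smoothFieldAt_const x (co x x w)) X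
  simp only [sy_co_self, ← christoffel_apply] at this
  rw [← vderiv_metricCo_apply, ← this, sub_sub]
  exact (add_sub_cancel _ _).symm

end Metric

/-! ### The geometry of a conformal immersion -/

section Along

variable {m k : ℕ}
  {M : Type*} [TopologicalSpace M] [ChartedSpace (EuclideanSpace ℝ (Fin m)) M]
  [IsManifold (𝓡 m) ∞ M]
  {N : Type*} [TopologicalSpace N] [ChartedSpace (EuclideanSpace ℝ (Fin (m + k))) N]
  [IsManifold (𝓡 (m + k)) ∞ N]
  {φ : C^∞⟮𝓡 m, M; 𝓡 (m + k), N⟯} {gM : Metric m M} {gN : Metric (m + k) N}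

theorem contMDiffAt_metricCo_comp (x : M) :
    ContMDiffAt (𝓡 m) 𝓘(ℝ, EuclideanSpace ℝ (Fin (m + k)) →L[ℝ]
      EuclideanSpace ℝ (Fin (m + k)) →L[ℝ] ℝ) ∞ (fun y => metricCo gN (φ x) (φ y)) x :=
  (contMDiffAt_metricCo gN (φ x)).comp x φ.contMDiff.contMDiffAt

theorem inner_along_eventually (x : M) (U U' : Π x : M, TangentSpace (𝓡 (m + k)) (φ x)) :
    (fun y => gN.inner (φ y) (U y) (U' y)) =ᶠ[𝓝 x] fun y =>
      metricCo gN (φ x) (φ y) (co (φ x) (φ y) (U y)) (co (φ x) (φ y) (U' y)) := by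
  filter_upwards [eventually_mem_tangentTriv_comp φ x] with y hy
  exact inner_eq_metricCo gN hy _ _

theorem mdifferentiableAt_inner_along {x : M} {U U' : Π x : M, TangentSpace (𝓡 (m + k)) (φ x)}
    (hU : DiffAlongAt φ U x) (hU' : DiffAlongAt φ U' x) :
    MDifferentiableAt (𝓡 m) 𝓘(ℝ, ℝ) (fun y => gN.inner (φ y) (U y) (U' y)) x := by
  have hg := (contMDiffAt_metricCo_comp (φ := φ) (gN := gN) x).mdifferentiableAt (by simp)
  refine MDifferentiableAt.congr_of_eventuallyEq ?_ (inner_along_eventually x U U')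
  exact (hg.clm_apply hU).clm_apply hU'

/-- The Weyl condition is inherited by the connection on `φ^*TN`. In coordinates it follows from the
chain rule for the metric along `φ` and the product rule for the two fields. -/
theorem exists_vderiv_inner_along {D : Connection (m + k) N} (hD : IsWeylConnection gN D) :
    ∃ α : Π y : N, TangentSpace (𝓡 (m + k)) y →L[ℝ] ℝ, ∀ (x : M)
      (U U' : Π x : M, TangentSpace (𝓡 (m + k)) (φ x)), DiffAlongAt φ U x → DiffAlongAt φ U' x →
      ∀ X : TangentSpace (𝓡 m) x,
      vderiv (𝓡 m) (fun y => gN.inner (φ y) (U y) (U' y)) x X =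
        gN.inner (φ x) (covAlong D φ U x X) (U' x) + gN.inner (φ x) (U x) (covAlong D φ U' x X) +
          α (φ x) (dif φ x X) * gN.inner (φ x) (U x) (U' x) := by
  obtain ⟨α, hα⟩ := exists_vderiv_metricCo hD
  refine ⟨α, fun x U U' hU hU' X => ?_⟩
  have hg := (contMDiffAt_metricCo_comp (φ := φ) (gN := gN) x).mdifferentiableAt (by simp)
  have hg0 := (contMDiffAt_metricCo gN (φ x)).mdifferentiableAt (by simp)
  rw [vderiv_congr (inner_along_eventually x U U'), vderiv_clm_apply (hg.clm_apply hU) hU',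
    vderiv_clm_apply hg hU, add_apply, ← vderiv_comp (mdifferentiableAt_immersion φ x) hg0,
    hα, covAlong_eq D hU, covAlong_eq D hU']
  simp only [metricCo_apply, sy_co_self, map_add, add_apply]
  ring

theorem exists_vderiv_inner {D : Connection m M} (hD : IsWeylConnection gM D) :
    ∃ α : Π x : M, TangentSpace (𝓡 m) x →L[ℝ] ℝ, ∀ (x : M) (X v w : TangentSpace (𝓡 m) x),
      HasDerivAt (fun t => metricCo gM x (curve x X t) (co x x v) (co x x w))
        (gM.inner x (christoffel D x X v) w + gM.inner x v (christoffel D x X w) +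
          α x X * gM.inner x v w) 0 := by
  obtain ⟨α, hα⟩ := exists_vderiv_metricCo hD
  refine ⟨α, fun x X v w => ?_⟩
  have hg := (contMDiffAt_metricCo gM x).mdifferentiableAt (by simp)
  have := ((hasDerivAt_comp_curve hg X).clm_apply (hasDerivAt_const 0 (co x x v))).clm_apply
    (hasDerivAt_const 0 (co x x w))
  rw [← hα]
  simpa using this

/-- The Hessian of a conformal immersion between Weyl spaces is conformally skew. -/
theorem exists_inner_hessian {DM : Connection m M} {DN : Connection (m + k) N}
    (hDM : IsWeylConnection gM DM) (hDN : IsWeylConnection gN DN)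
    (hconf : IsConformalImmersion gM gN φ) (x : M) :
    ∃ c : TangentSpace (𝓡 m) x →ₗ[ℝ] ℝ, ∀ X v w : TangentSpace (𝓡 m) x,
      gN.inner (φ x) (hessian φ DM DN x X v) (dif φ x w) +
        gN.inner (φ x) (dif φ x v) (hessian φ DM DN x X w) = c X * gM.inner x v w := by
  obtain ⟨αN, hαN⟩ := exists_vderiv_inner_along (φ := φ) hDN
  obtain ⟨αM, hαM⟩ := exists_vderiv_inner hDM
  choose r hr0 hr using hconf
  -- The one-form `c` is read off from a fixed nonzero reference vector `v₀`; in its absence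
  -- everything vanishes.
  by_cases hsub : ∀ v : TangentSpace (𝓡 m) x, v = 0
  · exact ⟨0, fun X v w => by rw [hsub X, hsub v, hsub w]; simp⟩
  push Not at hsub
  obtain ⟨v₀, hv₀⟩ := hsub
  have hpos := metric_pos gM x hv₀
  set F : TangentSpace (𝓡 m) x → TangentSpace (𝓡 m) x → TangentSpace (𝓡 m) x → ℝ := fun X v w =>
      gN.inner (φ x) (hessian φ DM DN x X v) (dif φ x w) +
        gN.inner (φ x) (dif φ x v) (hessian φ DM DN x X w) with hF
  -- This differentiates `φ^* g_N = r g_M` along the coordinate line. Only the product of `r` with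
  -- the metric is differentiated, since `r` comes from a pointwise choice.
  have hder : ∀ X v w : TangentSpace (𝓡 m) x,
      HasDerivAt (fun t => r (curve x X t) * metricCo gM x (curve x X t) (co x x v) (co x x w))
        (F X v w + r x * (gM.inner x (christoffel DM x X v) w +
          gM.inner x v (christoffel DM x X w)) +
          αN (φ x) (dif φ x X) * (r x * gM.inner x v w)) 0 := by
    intro X v w
    have hdv := diffAlong_dif (φ := φ) (smoothFieldAt_const x (co x x v)).diff
    have hdw := diffAlong_dif (φ := φ) (smoothFieldAt_const x (co x x w)).diff
    have h1 := hasDerivAt_comp_curve (mdifferentiableAt_inner_along (gN := gN) hdv hdw) X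
    rw [hαN x _ _ hdv hdw, covAlong_dif DM DN (smoothFieldAt_const x (co x x v)).diff,
      covAlong_dif DM DN (smoothFieldAt_const x (co x x w)).diff, ← christoffel_apply,
      ← christoffel_apply] at h1
    simp only [sy_co_self, hr, map_add, add_apply] at h1
    refine h1.congr_deriv ?_
    simp only [hF]
    ring
  -- Differentiating the identity `(r g(v, w)) g(v₀, v₀) = (r g(v₀, v₀)) g(v, w)` eliminates the
  -- derivative of `r`; the Christoffel terms and the two Weyl forms cancel as well.
  have hFeq : ∀ X v w : TangentSpace (𝓡 m) x,
      F X v w * gM.inner x v₀ v₀ = F X v₀ v₀ * gM.inner x v w := by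
    intro X v w
    have h1 := (hder X v w).mul (hαM x X v₀ v₀)
    have h2 := (hder X v₀ v₀).mul (hαM x X v w)
    have h3 := h1.unique (h2.congr_of_eventuallyEq (Eventually.of_forall fun t => by
      simp only [Pi.mul_apply]; ring))
    simp only [curve_zero, metricCo_apply, sy_co_self] at h3
    linear_combination h3
  set c : TangentSpace (𝓡 m) x →ₗ[ℝ] ℝ :=
    { toFun := fun X => F X v₀ v₀ / gM.inner x v₀ v₀
      map_add' := fun X Y => by
        simp only [hF, map_add, LinearMap.add_apply, add_apply]; ring
      map_smul' := fun a X => by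
        simp only [hF, map_smul, LinearMap.smul_apply, smul_apply, RingHom.id_apply, smul_eq_mul]
        ring } with hc
  refine ⟨c, fun X v w => ?_⟩
  have h := hFeq X v w
  change F X v w = F X v₀ v₀ / gM.inner x v₀ v₀ * gM.inner x v w
  field_simp
  linarith

end Along

/-! ### The tangential and normal projections -/

section Along

variable {m k : ℕ}
  {M : Type*} [TopologicalSpace M] [ChartedSpace (EuclideanSpace ℝ (Fin m)) M]
  [IsManifold (𝓡 m) ∞ M]
  {N : Type*} [TopologicalSpace N] [ChartedSpace (EuclideanSpace ℝ (Fin (m + k))) N]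
  [IsManifold (𝓡 (m + k)) ∞ N]
  {φ : C^∞⟮𝓡 m, M; 𝓡 (m + k), N⟯} {gM : Metric m M} {gN : Metric (m + k) N}

theorem mem_normalSpace {x : M} {w : TangentSpace (𝓡 (m + k)) (φ x)} :
    w ∈ normalSpace gN φ x ↔ ∀ v, gN.inner (φ x) w (dif φ x v) = 0 := Iff.rfl

variable (hconf : IsConformalImmersion gM gN φ)
include hconf

theorem dif_injective (x : M) : Function.Injective (dif φ x) := by
  obtain ⟨r, hr0, hr⟩ := hconf x
  rw [injective_iff_map_eq_zero]
  intro v hv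
  have := hr v v
  rw [hv] at this
  simp only [map_zero] at this
  exact metric_definite gM x (by
    rcases mul_eq_zero.1 this.symm with h | h
    · exact absurd h hr0.ne'
    · exact h)

/-- `tangentialPart` is defined through `inverse`, which takes a default value on operators that are
not invertible. Here it is a true inverse, because the form induced by `dφ` is definite. -/
theorem inner_tangentialPart (x : M) (w : TangentSpace (𝓡 (m + k)) (φ x))
    (u : TangentSpace (𝓡 m) x) :
    gN.inner (φ x) (dif φ x (tangentialPart gN φ x w)) (dif φ x u) =
      gN.inner (φ x) w (dif φ x u) := by
  set R : TangentSpace (𝓡 (m + k)) (φ x) →L[ℝ] (TangentSpace (𝓡 m) x →L[ℝ] ℝ) :=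
    (ContinuousLinearMap.precomp ℝ (dif φ x)) ∘L gN.inner (φ x) with hR
  have hinv : (R ∘L dif φ x).IsInvertible := by
    refine isInvertible_of_definite _ fun v hv => ?_
    have : gN.inner (φ x) (dif φ x v) (dif φ x v) = 0 := hv
    exact dif_injective hconf x ((metric_definite gN _ this).trans (map_zero _).symm)
  have h : (R ∘L dif φ x) ((R ∘L dif φ x).inverse (R w)) = R w := hinv.self_apply_inverse _
  exact DFunLike.congr_fun h u

theorem eq_tangentialPart {x : M} {w : TangentSpace (𝓡 (m + k)) (φ x)} {v : TangentSpace (𝓡 m) x}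
    (h : ∀ u, gN.inner (φ x) (dif φ x v) (dif φ x u) = gN.inner (φ x) w (dif φ x u)) :
    tangentialPart gN φ x w = v := by
  have h0 : ∀ u, gN.inner (φ x) (dif φ x (tangentialPart gN φ x w - v)) (dif φ x u) = 0 := by
    intro u
    rw [map_sub, map_sub, sub_apply, inner_tangentialPart hconf, h, sub_self]
  have h1 := metric_definite gN _ (h0 (tangentialPart gN φ x w - v))
  exact sub_eq_zero.1 (dif_injective hconf x (h1.trans (map_zero _).symm))

theorem tangentialPart_dif (x : M) (v : TangentSpace (𝓡 m) x) :
    tangentialPart gN φ x (dif φ x v) = v :=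
  eq_tangentialPart hconf fun _ => rfl

theorem tangentialPart_eq_zero_iff {x : M} {w : TangentSpace (𝓡 (m + k)) (φ x)} :
    tangentialPart gN φ x w = 0 ↔ w ∈ normalSpace gN φ x := by
  rw [mem_normalSpace]
  constructor
  · intro h v
    rw [← inner_tangentialPart hconf, h]; simp
  · intro h
    exact eq_tangentialPart hconf fun u => by rw [h]; simp

omit hconf in
theorem normalProj_apply (x : M) (w : TangentSpace (𝓡 (m + k)) (φ x)) :
    normalProj gN φ x w = w - dif φ x (tangentialPart gN φ x w) := rfl

theorem normalProj_mem (x : M) (w : TangentSpace (𝓡 (m + k)) (φ x)) :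
    normalProj gN φ x w ∈ normalSpace gN φ x := by
  intro v
  rw [normalProj_apply, map_sub, sub_apply, inner_tangentialPart hconf, sub_self]

theorem normalProj_of_mem {x : M} {w : TangentSpace (𝓡 (m + k)) (φ x)}
    (h : w ∈ normalSpace gN φ x) : normalProj gN φ x w = w := by
  rw [normalProj_apply, (tangentialPart_eq_zero_iff hconf).2 h, map_zero, sub_zero]

theorem normalProj_dif (x : M) (v : TangentSpace (𝓡 m) x) :
    normalProj gN φ x (dif φ x v) = 0 := by
  rw [normalProj_apply, tangentialPart_dif hconf, sub_self]

omit hconf in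
theorem tangential_add_normal (x : M) (w : TangentSpace (𝓡 (m + k)) (φ x)) :
    dif φ x (tangentialPart gN φ x w) + normalProj gN φ x w = w := by
  rw [normalProj_apply]; abel

theorem inner_normalProj_left (x : M) (w w' : TangentSpace (𝓡 (m + k)) (φ x))
    (h : w' ∈ normalSpace gN φ x) :
    gN.inner (φ x) (normalProj gN φ x w) w' = gN.inner (φ x) w w' := by
  rw [normalProj_apply, map_sub, sub_apply, metric_symm gN _ (dif φ x _), h, sub_zero]

/-- The tangential projection in the preferred charts. -/
theorem contMDiffAt_tangentialPart (x : M) :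
    ContMDiffAt (𝓡 m) 𝓘(ℝ, EuclideanSpace ℝ (Fin (m + k)) →L[ℝ] EuclideanSpace ℝ (Fin m)) ∞
      (fun y => co x y ∘L tangentialPart gN φ y ∘L sy (φ x) (φ y)) x := by
  set R : M → (EuclideanSpace ℝ (Fin (m + k)) →L[ℝ] (EuclideanSpace ℝ (Fin m) →L[ℝ] ℝ)) :=
    fun y => (ContinuousLinearMap.precomp ℝ (difCo φ x y)) ∘L metricCo gN (φ x) (φ y) with hR
  have hpre : ContMDiffAt (𝓡 m) 𝓘(ℝ, (EuclideanSpace ℝ (Fin (m + k)) →L[ℝ] ℝ) →L[ℝ]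
      (EuclideanSpace ℝ (Fin m) →L[ℝ] ℝ)) ∞
      (fun y => ContinuousLinearMap.precomp ℝ (difCo φ x y)) x :=
    ContMDiffAt.clm_precomp (F₃ := ℝ) (contMDiffAt_difCo φ x)
  have hRsm : ContMDiffAt (𝓡 m) 𝓘(ℝ, EuclideanSpace ℝ (Fin (m + k)) →L[ℝ]
      (EuclideanSpace ℝ (Fin m) →L[ℝ] ℝ)) ∞ R x :=
    hpre.clm_comp (contMDiffAt_metricCo_comp x)
  have hBsm : ContMDiffAt (𝓡 m) 𝓘(ℝ, EuclideanSpace ℝ (Fin m) →L[ℝ]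
      (EuclideanSpace ℝ (Fin m) →L[ℝ] ℝ)) ∞ (fun y => R y ∘L difCo φ x y) x :=
    hRsm.clm_comp (contMDiffAt_difCo φ x)
  have hval : ∀ y : M, y ∈ (tangentTriv (d := m) x).baseSet →
      φ y ∈ (tangentTriv (d := m + k) (φ x)).baseSet →
      ∀ (w : EuclideanSpace ℝ (Fin (m + k))) (u : EuclideanSpace ℝ (Fin m)),
        R y w u = gN.inner (φ y) (sy (φ x) (φ y) w) (dif φ y (sy x y u)) := by
    intro y hy hy' w u
    change metricCo gN (φ x) (φ y) w (difCo φ x y u) = _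
    rw [metricCo_apply]
    simp only [difCo, ContinuousLinearMap.comp_apply, sy_co hy']
  have hinv : ∀ y : M, y ∈ (tangentTriv (d := m) x).baseSet →
      φ y ∈ (tangentTriv (d := m + k) (φ x)).baseSet → (R y ∘L difCo φ x y).IsInvertible := by
    intro y hy hy'
    refine isInvertible_of_definite _ fun v hv => ?_
    have h1 := hval y hy hy' (difCo φ x y v) v
    have h2 : R y (difCo φ x y v) v = 0 := hv
    rw [h2] at h1
    simp only [difCo, ContinuousLinearMap.comp_apply, sy_co hy'] at h1
    have h3 := dif_injective hconf y ((metric_definite gN _ h1.symm).trans (map_zero _).symm)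
    rw [← co_sy hy v, h3, map_zero]
  have hev : (fun y => co x y ∘L tangentialPart gN φ y ∘L sy (φ x) (φ y)) =ᶠ[𝓝 x]
      fun y => (R y ∘L difCo φ x y).inverse ∘L R y := by
    filter_upwards [eventually_mem_tangentTriv (d := m) x, eventually_mem_tangentTriv_comp φ x]
      with y hy hy'
    ext1 w
    symm
    rw [ContinuousLinearMap.comp_apply]
    refine (hinv y hy hy').inverse_apply_eq.2 ?_
    ext1 u
    rw [hval y hy hy', ← inner_tangentialPart hconf, ContinuousLinearMap.comp_apply,
      hval y hy hy']
    simp only [difCo, ContinuousLinearMap.comp_apply, sy_co hy', sy_co hy]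
  refine ContMDiffAt.congr_of_eventuallyEq ?_ hev
  refine ContMDiffAt.clm_comp ?_ hRsm
  obtain ⟨e, he⟩ := hinv x (mem_tangentTriv x) (mem_tangentTriv (φ x))
  -- The projection is `(R ∘ dφ)⁻¹ ∘ R` in coordinates, and inversion is smooth at an invertible
  -- operator.
  have hci : ContDiffAt ℝ ∞ (ContinuousLinearMap.inverse : (EuclideanSpace ℝ (Fin m) →L[ℝ]
      (EuclideanSpace ℝ (Fin m) →L[ℝ] ℝ)) → _) (R x ∘L difCo φ x x) := by
    rw [← he]
    exact contDiffAt_map_inverse e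
  exact hci.contMDiffAt.comp x hBsm

theorem contMDiffAt_normalProj (x : M) :
    ContMDiffAt (𝓡 m) 𝓘(ℝ, EndModel (m + k)) ∞
      (fun y => co (φ x) (φ y) ∘L normalProj gN φ y ∘L sy (φ x) (φ y)) x := by
  have h : ContMDiffAt (𝓡 m) 𝓘(ℝ, EndModel (m + k)) ∞
      (fun y => ContinuousLinearMap.id ℝ (EuclideanSpace ℝ (Fin (m + k))) -
        difCo φ x y ∘L (co x y ∘L tangentialPart gN φ y ∘L sy (φ x) (φ y))) x :=
    contMDiffAt_const.sub ((contMDiffAt_difCo φ x).clm_comp (contMDiffAt_tangentialPart hconf x))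
  refine h.congr_of_eventuallyEq ?_
  filter_upwards [eventually_mem_tangentTriv (d := m) x, eventually_mem_tangentTriv_comp φ x]
    with y hy hy'
  ext1 w
  simp only [ContinuousLinearMap.comp_apply, normalProj_apply, map_sub, co_sy hy', difCo, sy_co hy,
    sub_apply, ContinuousLinearMap.id_apply]

/-- Every normal vector extends to a smooth normal field. -/
theorem exists_smoothNormal {x : M} {w : TangentSpace (𝓡 (m + k)) (φ x)}
    (hw : w ∈ normalSpace gN φ x) :
    ∃ U : Π x : M, TangentSpace (𝓡 (m + k)) (φ x), SmoothAlongAt φ U x ∧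
      (∀ y, U y ∈ normalSpace gN φ y) ∧ U x = w := by
  refine ⟨fun y => normalProj gN φ y (sy (φ x) (φ y) (co (φ x) (φ x) w)), ?_,
    fun y => normalProj_mem hconf y _, ?_⟩
  · rw [smoothAlongAt_iff]
    exact (contMDiffAt_normalProj hconf x).clm_apply contMDiffAt_const
  · simp only [sy_co_self]
    exact normalProj_of_mem hconf hw

end Along

/-! ### The direct sum map -/

section Along

variable {m k : ℕ}
  {M : Type*} [TopologicalSpace M] [ChartedSpace (EuclideanSpace ℝ (Fin m)) M]
  [IsManifold (𝓡 m) ∞ M]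
  {N : Type*} [TopologicalSpace N] [ChartedSpace (EuclideanSpace ℝ (Fin (m + k))) N]
  [IsManifold (𝓡 (m + k)) ∞ N]
  {φ : C^∞⟮𝓡 m, M; 𝓡 (m + k), N⟯} {gM : Metric m M} {gN : Metric (m + k) N}

theorem mdifferentiableAt_of_affine {F : Type*} [NormedAddCommGroup F] [NormedSpace ℝ F]
    {f : ℝ → F} {a b : F} (h : ∀ t, f t = a + t • b) : MDifferentiableAt 𝓘(ℝ, ℝ) 𝓘(ℝ, F) f 0 := by
  rw [funext h]
  exact ((differentiableAt_id.smul_const b).const_add a).mdifferentiableAt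

theorem trivSnd_sum {x y : M} (A : SumBundle φ y) :
    trivSnd x (⟨y, A⟩ : TotalSpace (SumModel m k) (SumBundle φ)) =
      (co x y ∘L A.1 ∘L sy x y, co (φ x) (φ y) ∘L normalComponent φ y A ∘L sy (φ x) (φ y)) :=
  Prod.ext (trivSnd_end (x := x) A.1) (trivSnd_end (x := φ x) (normalComponent φ y A))

theorem contMDiffAt_sum_iff {s : Π x : M, SumBundle φ x} {x : M} :
    ContMDiffAt (𝓡 m) ((𝓡 m).prod 𝓘(ℝ, SumModel m k)) ∞
      (fun y => TotalSpace.mk' (SumModel m k) y (s y)) x ↔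
    ContMDiffAt (𝓡 m) 𝓘(ℝ, EndModel m) ∞ (fun y => co x y ∘L (s y).1 ∘L sy x y) x ∧
    ContMDiffAt (𝓡 m) 𝓘(ℝ, EndModel (m + k)) ∞
      (fun y => co (φ x) (φ y) ∘L normalComponent φ y (s y) ∘L sy (φ x) (φ y)) x := by
  refine (contMDiffAt_section x).trans ?_
  refine (Filter.EventuallyEq.contMDiffAt_iff
    (Eventually.of_forall fun y => trivSnd_sum (s y))).trans ?_
  exact contMDiffAt_prod_module_iff _

variable (hconf : IsConformalImmersion gM gN φ)
include hconf

/-- In the trivializations the fibre component is `dφ ∘ J ∘ tangentialPart + K`, linear in the fibre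
coordinates `(J, K)` with smooth coefficients. This holds on the whole ambient vector bundle. -/
theorem mdifferentiableAt_directSumMap (z : TotalSpace (SumModel m k) (SumBundle φ)) :
    MDifferentiableAt ((𝓡 m).prod 𝓘(ℝ, SumModel m k)) ((𝓡 (m + k)).prod 𝓘(ℝ, EndModel (m + k)))
      (directSumMap gN φ) z := by
  rw [mdifferentiableAt_totalSpace]
  have hproj := mdifferentiableAt_proj (d := m) z
  refine ⟨(mdifferentiableAt_immersion φ z.proj).comp z hproj, ?_⟩
  have htriv := mdifferentiableAt_trivSnd (d := m) z
  have h1 : MDifferentiableAt ((𝓡 m).prod 𝓘(ℝ, SumModel m k)) 𝓘(ℝ, EndModel m)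
      (fun z' : TotalSpace (SumModel m k) (SumBundle φ) => (trivSnd z.proj z').1) z :=
    ((ContinuousLinearMap.fst ℝ (EndModel m) (EndModel (m + k))).mdifferentiableAt
      (x := trivSnd z.proj z)).comp z htriv
  have h2 : MDifferentiableAt ((𝓡 m).prod 𝓘(ℝ, SumModel m k)) 𝓘(ℝ, EndModel (m + k))
      (fun z' : TotalSpace (SumModel m k) (SumBundle φ) => (trivSnd z.proj z').2) z :=
    ((ContinuousLinearMap.snd ℝ (EndModel m) (EndModel (m + k))).mdifferentiableAt
      (x := trivSnd z.proj z)).comp z htriv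
  have h3 := ((contMDiffAt_difCo φ z.proj).mdifferentiableAt (by simp)).comp z hproj
  have h4 := ((contMDiffAt_tangentialPart hconf z.proj).mdifferentiableAt (by simp)).comp z hproj
  have h5 := (h3.clm_comp (h1.clm_comp h4)).add h2
  refine h5.congr_of_eventuallyEq ?_
  have hev : ∀ᶠ z' in 𝓝 z, z'.proj ∈ (tangentTriv (d := m) z.proj).baseSet :=
    hproj.continuousAt.eventually (eventually_mem_tangentTriv (d := m) z.proj)
  filter_upwards [hev] with z' hz'
  refine (trivSnd_end (x := φ z.proj) (directSumMap gN φ z').2).trans ?_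
  have h6 := trivSnd_sum (x := z.proj) z'.2
  have h61 : (trivSnd z.proj z').1 = co z.proj z'.proj ∘L z'.2.1 ∘L sy z.proj z'.proj :=
    congrArg Prod.fst h6
  have h62 : (trivSnd z.proj z').2 = co (φ z.proj) (φ z'.proj) ∘L
      normalComponent φ z'.proj z'.2 ∘L sy (φ z.proj) (φ z'.proj) := congrArg Prod.snd h6
  ext1 e
  change co (φ z.proj) (φ z'.proj) (dif φ z'.proj (z'.2.1 (tangentialPart gN φ z'.proj
      (sy (φ z.proj) (φ z'.proj) e))) + normalComponent φ z'.proj z'.2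
      (sy (φ z.proj) (φ z'.proj) e)) = difCo φ z.proj z'.proj ((trivSnd z.proj z').1
      (co z.proj z'.proj (tangentialPart gN φ z'.proj (sy (φ z.proj) (φ z'.proj) e)))) +
      (trivSnd z.proj z').2 e
  rw [h61, h62, map_add]
  simp only [difCo, ContinuousLinearMap.comp_apply, sy_co hz']

omit hconf in
theorem mdifferentiableAt_sum_line (x : M) (B A : SumBundle φ x) :
    MDifferentiableAt 𝓘(ℝ, ℝ) ((𝓡 m).prod 𝓘(ℝ, SumModel m k))
      (fun t : ℝ => TotalSpace.mk' (SumModel m k) x (B + t • A)) 0 := by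
  rw [mdifferentiableAt_totalSpace]
  refine ⟨mdifferentiableAt_const, ?_⟩
  have hlin : ∀ t : ℝ, trivSnd x (TotalSpace.mk' (SumModel m k) x (B + t • A)) =
      trivSnd x (⟨x, B⟩ : TotalSpace (SumModel m k) (SumBundle φ)) +
        t • trivSnd x (⟨x, A⟩ : TotalSpace (SumModel m k) (SumBundle φ)) := by
    intro t
    simp only [TotalSpace.mk']
    rw [trivSnd_sum, trivSnd_sum, trivSnd_sum]
    refine Prod.ext ?_ ?_
    · ext1 e
      change co x x ((B.1 + t • A.1) (sy x x e)) = _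
      simp
    · ext1 e
      change co (φ x) (φ x) ((normalComponent φ x B +
        t • normalComponent φ x A) (sy (φ x) (φ x) e)) = _
      simp
  exact mdifferentiableAt_of_affine hlin

omit hconf in
/-- The fibre component of the direct sum map. -/
theorem directSumMap_line (x : M) (B A : SumBundle φ x) (t : ℝ) :
    (directSumMap gN φ ⟨x, B + t • A⟩).2 = dif φ x ∘L B.1 ∘L tangentialPart gN φ x +
      normalComponent φ x B + t • (dif φ x ∘L A.1 ∘L tangentialPart gN φ x +
        normalComponent φ x A) := by
  ext1 w
  change dif φ x (B.1 (tangentialPart gN φ x w) + t • A.1 (tangentialPart gN φ x w)) +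
      (normalComponent φ x B w + t • normalComponent φ x A w) =
    dif φ x (B.1 (tangentialPart gN φ x w)) +
      normalComponent φ x B w + t • (dif φ x (A.1 (tangentialPart gN φ x w)) +
      normalComponent φ x A w)
  rw [map_add, map_smul, smul_add]
  abel

/-- The differential of the direct sum map, on vertical vectors. -/
theorem isVerticalLift_directSumMap {z : TotalSpace (SumModel m k) (SumBundle φ)}
    {A : SumBundle φ z.proj} {v : TangentSpace ((𝓡 m).prod 𝓘(ℝ, SumModel m k)) z}
    (hv : IsVerticalLift z A v) :
    IsVerticalLift (directSumMap gN φ z)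
      (dif φ z.proj ∘L A.1 ∘L tangentialPart gN φ z.proj + normalComponent φ z.proj A)
      (mfderiv ((𝓡 m).prod 𝓘(ℝ, SumModel m k)) ((𝓡 (m + k)).prod 𝓘(ℝ, EndModel (m + k)))
        (directSumMap gN φ) z v) := by
  obtain ⟨x, B⟩ := z
  set c : ℝ → TotalSpace (SumModel m k) (SumBundle φ) :=
    fun t => TotalSpace.mk' (SumModel m k) x (B + t • A) with hcdef
  have hc : MDifferentiableAt 𝓘(ℝ, ℝ) ((𝓡 m).prod 𝓘(ℝ, SumModel m k)) c 0 :=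
    mdifferentiableAt_sum_line x B A
  have hΦ : MDifferentiableAt ((𝓡 m).prod 𝓘(ℝ, SumModel m k))
      ((𝓡 (m + k)).prod 𝓘(ℝ, EndModel (m + k))) (directSumMap gN φ) (c 0) :=
    mdifferentiableAt_directSumMap hconf _
  -- The map is linear on each fibre, so it carries the line through `B` in the direction `A` to a
  -- line.
  have hcomp : (fun t : ℝ => TotalSpace.mk' (EndModel (m + k)) (E := EndTangent (m + k) N)
      (φ x) ((dif φ x ∘L B.1 ∘L tangentialPart gN φ x + normalComponent φ x B) + t •
        (dif φ x ∘L A.1 ∘L tangentialPart gN φ x + normalComponent φ x A))) =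
      directSumMap gN φ ∘ c :=
    funext fun t => congrArg (TotalSpace.mk (φ x)) (directSumMap_line x B A t).symm
  have h := tangentMap_comp_at (⟨0, 1⟩ : TangentBundle 𝓘(ℝ, ℝ) ℝ) hΦ hc
  have hv' : tangentMap 𝓘(ℝ, ℝ) ((𝓡 m).prod 𝓘(ℝ, SumModel m k)) c ⟨0, 1⟩ = ⟨⟨x, B⟩, v⟩ := hv
  rw [hv', ← hcomp] at h
  exact h

end Along

/-! ### Parallel sections and the direct sum map -/

section Along

variable {m k : ℕ}
  {M : Type*} [TopologicalSpace M] [ChartedSpace (EuclideanSpace ℝ (Fin m)) M]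
  [IsManifold (𝓡 m) ∞ M]
  {N : Type*} [TopologicalSpace N] [ChartedSpace (EuclideanSpace ℝ (Fin (m + k))) N]
  [IsManifold (𝓡 (m + k)) ∞ N]
  {φ : C^∞⟮𝓡 m, M; 𝓡 (m + k), N⟯} {gM : Metric m M} {gN : Metric (m + k) N}

theorem covAlong_congr (D : Connection (m + k) N)
    {U U' : Π x : M, TangentSpace (𝓡 (m + k)) (φ x)} {x : M} (hU : DiffAlongAt φ U x)
    (h : ∀ᶠ y in 𝓝 x, U y = U' y) (X : TangentSpace (𝓡 m) x) :
    covAlong D φ U x X = covAlong D φ U' x X := by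
  have hev : (fun y => co (φ x) (φ y) (U y)) =ᶠ[𝓝 x] fun y => co (φ x) (φ y) (U' y) := by
    filter_upwards [h] with y hy
    rw [hy]
  have hU' : DiffAlongAt φ U' x := hev.mdifferentiableAt_iff.1 hU
  rw [covAlong_eq D hU, covAlong_eq D hU', vderiv_congr hev, h.self_of_nhds]

/-- The direct sum of `B.1` and of the endomorphism `B.2` of the normal space. -/
def directEnd (gN : Metric (m + k) N) (φ : C^∞⟮𝓡 m, M; 𝓡 (m + k), N⟯) (x : M) (B : SumBundle φ x) :
    EndTangent (m + k) N (φ x) :=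
  dif φ x ∘L B.1 ∘L tangentialPart gN φ x + normalComponent φ x B

theorem directEnd_apply (x : M) (B : SumBundle φ x) (w : TangentSpace (𝓡 (m + k)) (φ x)) :
    directEnd gN φ x B w =
      dif φ x (B.1 (tangentialPart gN φ x w)) + normalComponent φ x B w := rfl

/-- The vertical component of the image of a vector through the differential of the direct sum
map. -/
def sumVert (gN : Metric (m + k) N) (φ : C^∞⟮𝓡 m, M; 𝓡 (m + k), N⟯) (DN : Connection (m + k) N)
    (x : M) (B : SumBundle φ x) :
    TangentSpace ((𝓡 m).prod 𝓘(ℝ, SumModel m k))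
      (⟨x, B⟩ : TotalSpace (SumModel m k) (SumBundle φ)) →ₗ[ℝ]
    TangentSpace (𝓡 (m + k)) (φ x) →ₗ[ℝ] TangentSpace (𝓡 (m + k)) (φ x) :=
  vert DN (⟨φ x, directEnd gN φ x B⟩ : TotalSpace (EndModel (m + k)) (EndTangent (m + k) N)) ∘ₗ
    (mfderiv ((𝓡 m).prod 𝓘(ℝ, SumModel m k)) ((𝓡 (m + k)).prod 𝓘(ℝ, EndModel (m + k)))
        (directSumMap gN φ) ⟨x, B⟩).toLinearMap

variable (hconf : IsConformalImmersion gM gN φ)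
include hconf

theorem directEnd_dif {x : M} {B : SumBundle φ x} (hB : normalComponent φ x B ∈ normalEnd gN φ x)
    (v : TangentSpace (𝓡 m) x) : directEnd gN φ x B (dif φ x v) = dif φ x (B.1 v) := by
  rw [directEnd_apply, tangentialPart_dif hconf, hB.1, add_zero]

theorem directEnd_normal {x : M} {B : SumBundle φ x}
    {w : TangentSpace (𝓡 (m + k)) (φ x)} (hw : w ∈ normalSpace gN φ x) :
    directEnd gN φ x B w = normalComponent φ x B w := by
  rw [directEnd_apply, (tangentialPart_eq_zero_iff hconf).2 hw, map_zero, map_zero, zero_add]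

theorem mdifferentiableAt_sum_components {s : Π x : M, SumBundle φ x} {x : M}
    (hs : MDifferentiableAt (𝓡 m) ((𝓡 m).prod 𝓘(ℝ, SumModel m k))
      (fun y => TotalSpace.mk' (SumModel m k) y (s y)) x) :
    MDifferentiableAt (𝓡 m) 𝓘(ℝ, EndModel m) (fun y => co x y ∘L (s y).1 ∘L sy x y) x := by
  have h := ((mdifferentiableAt_section (𝓡 m) s (b₀ := x)).1 hs)
  have h2 : MDifferentiableAt (𝓡 m) 𝓘(ℝ, EndModel m)
      (fun y => (trivSnd x (TotalSpace.mk' (SumModel m k) y (s y))).1) x :=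
    ((ContinuousLinearMap.fst ℝ (EndModel m) (EndModel (m + k))).mdifferentiableAt
      (x := trivSnd x (TotalSpace.mk' (SumModel m k) x (s x)))).comp x h
  refine h2.congr_of_eventuallyEq (Eventually.of_forall fun y => ?_)
  exact congrArg Prod.fst (trivSnd_sum (s y)).symm

variable {DM : Connection m M} {DN : Connection (m + k) N} {s : Π x : M, SumBundle φ x} {x : M}

/-- The vertical component of the image of a vector tangent to a section of `SumBundle`. -/
theorem sumVert_section (hs : MDifferentiableAt (𝓡 m) ((𝓡 m).prod 𝓘(ℝ, SumModel m k))
      (fun y => TotalSpace.mk' (SumModel m k) y (s y)) x) (X : TangentSpace (𝓡 m) x)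
    {U : Π x : M, TangentSpace (𝓡 (m + k)) (φ x)} (hU : DiffAlongAt φ U x) :
    DiffAlongAt φ (fun y => directEnd gN φ y (s y) (U y)) x ∧
    sumVert gN φ DN x (s x) (mfderiv (𝓡 m) ((𝓡 m).prod 𝓘(ℝ, SumModel m k))
      (fun y => TotalSpace.mk' (SumModel m k) y (s y)) x X) (U x) =
    covAlong DN φ (fun y => directEnd gN φ y (s y) (U y)) x X -
      directEnd gN φ x (s x) (covAlong DN φ U x X) := by
  have hΦ := mdifferentiableAt_directSumMap hconf (TotalSpace.mk' (SumModel m k) x (s x))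
  have hS : MDifferentiableAt (𝓡 m) ((𝓡 (m + k)).prod 𝓘(ℝ, EndModel (m + k)))
      (fun y => TotalSpace.mk' (EndModel (m + k)) (E := EndTangent (m + k) N) (φ y)
        (directEnd gN φ y (s y))) x := hΦ.comp x hs
  refine ⟨(apply_diffAlong (mdifferentiableAt_endAlong_iff.1 hS) hU X).1, ?_⟩
  rw [← vert_endAlong DN hS X hU]
  have h := DFunLike.congr_fun (mfderiv_comp x hΦ hs) X
  exact congrArg (fun v => vert DN (⟨φ x, directEnd gN φ x (s x)⟩ :
    TotalSpace (EndModel (m + k)) (EndTangent (m + k) N)) v (U x)) h.symm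

section Parallel

variable {X : TangentSpace (𝓡 m) x} (hs : MDifferentiableAt (𝓡 m) ((𝓡 m).prod 𝓘(ℝ, SumModel m k))
      (fun y => TotalSpace.mk' (SumModel m k) y (s y)) x)
  (hpar : SumParallel gN DM DN φ s x X)
include hs hpar

/-- In `D_X (dφ (J Y)) - S D_X (dφ Y)` each term is a Hessian plus `dφ` of a covariant derivative on
`M`; since `J` is parallel along `X`, the latter cancel. -/
theorem sumVert_dif (v : TangentSpace (𝓡 m) x) :
    sumVert gN φ DN x (s x) (mfderiv (𝓡 m) ((𝓡 m).prod 𝓘(ℝ, SumModel m k))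
          (fun y => TotalSpace.mk' (SumModel m k) y (s y)) x X) (dif φ x v) =
      hessian φ DM DN x X ((s x).1 v) - directEnd gN φ x (s x) (hessian φ DM DN x X v) := by
  obtain ⟨hn, hp, -⟩ := hpar
  obtain ⟨Y, hY, rfl⟩ := exists_smoothField x v
  obtain ⟨hSY, h⟩ := sumVert_section (DN := DN) hconf hs X (diffAlong_dif (φ := φ) hY.diff)
  rw [h, covAlong_congr DN hSY (U' := fun y => dif φ y ((s y).1 (Y y)))
    (hn.mono fun y hy => directEnd_dif hconf hy (Y y))]
  have h1 : DiffFieldAt (fun y => (s y).1 (Y y)) x :=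
    (apply_diffField (mdifferentiableAt_sum_components hconf hs) hY.diff X).1
  rw [covAlong_dif DM DN h1, covAlong_dif DM DN hY.diff, hp Y hY, map_add,
    directEnd_dif hconf hn.self_of_nhds]
  abel

/-- The component `K` is parallel for `Π ∘ D_N`, which is exactly the vanishing of the normal-normal
block. -/
theorem inner_sumVert_normal {w : TangentSpace (𝓡 (m + k)) (φ x)} (hw : w ∈ normalSpace gN φ x)
    {w' : TangentSpace (𝓡 (m + k)) (φ x)} (hw' : w' ∈ normalSpace gN φ x) :
    gN.inner (φ x) (sumVert gN φ DN x (s x) (mfderiv (𝓡 m) ((𝓡 m).prod 𝓘(ℝ, SumModel m k))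
          (fun y => TotalSpace.mk' (SumModel m k) y (s y)) x X) w) w' = 0 := by
  obtain ⟨hn, -, hp⟩ := hpar
  obtain ⟨U, hU, hUn, rfl⟩ := exists_smoothNormal hconf hw
  obtain ⟨hSU, h⟩ := sumVert_section (DN := DN) hconf hs X hU.diff
  rw [h, covAlong_congr DN hSU (U' := fun y => normalComponent φ y (s y) (U y))
    (Eventually.of_forall fun y => directEnd_normal hconf (hUn y))]
  have h1 := hp U hU (Eventually.of_forall hUn)
  have h2 : normalComponent φ x (s x) (covAlong DN φ U x X) =
      normalComponent φ x (s x) (normalProj gN φ x (covAlong DN φ U x X)) := by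
    conv_lhs => rw [← tangential_add_normal (gN := gN) x (covAlong DN φ U x X), map_add,
      hn.self_of_nhds.1, zero_add]
  rw [map_sub, sub_apply, directEnd_apply, map_add, add_apply, metric_symm gN _ (dif φ x _), hw',
    zero_add, h2, ← h1, inner_normalProj_left hconf _ _ _ hw', sub_self]

set_option maxHeartbeats 1000000 in
/-- The vertical component is skew on pairs formed of a normal and a tangent vector. -/
theorem inner_sumVert_mixed (hDN : IsWeylConnection gN DN)
    (hskew : ∀ w w', gN.inner (φ x) (directEnd gN φ x (s x) w) w' =
      -gN.inner (φ x) w (directEnd gN φ x (s x) w'))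
    {w : TangentSpace (𝓡 (m + k)) (φ x)} (hw : w ∈ normalSpace gN φ x) (v : TangentSpace (𝓡 m) x) :
    gN.inner (φ x) (sumVert gN φ DN x (s x) (mfderiv (𝓡 m) ((𝓡 m).prod 𝓘(ℝ, SumModel m k))
          (fun y => TotalSpace.mk' (SumModel m k) y (s y)) x X) w) (dif φ x v) =
    -gN.inner (φ x) w (sumVert gN φ DN x (s x) (mfderiv (𝓡 m) ((𝓡 m).prod 𝓘(ℝ, SumModel m k))
          (fun y => TotalSpace.mk' (SumModel m k) y (s y)) x X) (dif φ x v)) := by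
  obtain ⟨α, hα⟩ := exists_vderiv_inner_along (φ := φ) hDN
  obtain ⟨hn, -, -⟩ := hpar
  obtain ⟨U, hU, hUn, rfl⟩ := exists_smoothNormal hconf hw
  obtain ⟨Y, hY, rfl⟩ := exists_smoothField x v
  have hY' := diffAlong_dif (φ := φ) hY.diff
  obtain ⟨hSU, h⟩ := sumVert_section (DN := DN) hconf hs X hU.diff
  obtain ⟨hSY, h'⟩ := sumVert_section (DN := DN) hconf hs X hY'
  have hzero : ∀ f : M → ℝ, (∀ᶠ y in 𝓝 x, f y = 0) → vderiv (𝓡 m) f x X = 0 := by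
    intro f hf
    rw [vderiv_congr (G' := fun _ => (0 : ℝ)) hf]
    have := (hasDerivAt_comp_curve (mdifferentiableAt_const (c := (0 : ℝ))) X)
    exact this.unique (hasDerivAt_const _ _)
  -- The section need not consist of skew endomorphisms away from `x`, but it does preserve the
  -- splitting near `x`. So `g(S U, dφ Y)` and `g(U, S dφ Y)` vanish there identically. Their
  -- derivatives are added, and skewness is used only at `x`.
  have e1 := hα x _ _ hSU hY' X
  rw [hzero] at e1
  · have e2 := hα x _ _ hU.diff hSY X
    rw [hzero] at e2
    · rw [h, h']
      simp only [map_sub, sub_apply]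
      have e3 := hskew (U x) (dif φ x (Y x))
      have e4 := hskew (covAlong DN φ U x X) (dif φ x (Y x))
      have e5 := hskew (U x) (covAlong DN φ (fun y => dif φ y (Y y)) x X)
      rw [e3] at e1
      rw [e4]
      rw [e5] at e1
      linear_combination -e1 - e2
    · filter_upwards [hn] with y hy
      rw [directEnd_dif hconf hy]
      exact hUn y _
  · filter_upwards [hn] with y hy
    rw [directEnd_normal hconf (hUn y)]
    exact hy.2 _ _

end Parallel

end Along

/-! ### Parallel sections and the direct sum map -/

section Along

variable {m k : ℕ}
  {M : Type*} [TopologicalSpace M] [ChartedSpace (EuclideanSpace ℝ (Fin m)) M]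
  [IsManifold (𝓡 m) ∞ M]
  {N : Type*} [TopologicalSpace N] [ChartedSpace (EuclideanSpace ℝ (Fin (m + k))) N]
  [IsManifold (𝓡 (m + k)) ∞ N]
  {φ : C^∞⟮𝓡 m, M; 𝓡 (m + k), N⟯} {gM : Metric m M} {gN : Metric (m + k) N}

variable (hconf : IsConformalImmersion gM gN φ)

/-- Extension of an endomorphism of `T_{φ(x)}N` to a section of the bundle of endomorphisms of the
normal bundle. -/
def normalExt (gN : Metric (m + k) N) (φ : C^∞⟮𝓡 m, M; 𝓡 (m + k), N⟯) (x : M)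
    (K : EndTangent (m + k) N (φ x)) (y : M) : EndTangent (m + k) N (φ y) :=
  normalProj gN φ y ∘L sy (φ x) (φ y) ∘L (co (φ x) (φ x) ∘L K ∘L sy (φ x) (φ x)) ∘L
    co (φ x) (φ y) ∘L normalProj gN φ y

theorem normalExt_self (x : M) (K : EndTangent (m + k) N (φ x))
    (w : TangentSpace (𝓡 (m + k)) (φ x)) :
    normalExt gN φ x K x w = normalProj gN φ x (K (normalProj gN φ x w)) := by
  simp only [normalExt, ContinuousLinearMap.comp_apply, sy_co_self]

theorem covAlong_sub_smul (D : Connection (m + k) N) {h : M → ℝ}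
    {U U' : Π x : M, TangentSpace (𝓡 (m + k)) (φ x)} {x : M} (hh : MDifferentiableAt (𝓡 m) 𝓘(ℝ, ℝ) h x)
    (h0 : h x = 0) (hU : DiffAlongAt φ U x) (hU' : DiffAlongAt φ U' x) (X : TangentSpace (𝓡 m) x) :
    covAlong D φ (fun y => U y - h y • U' y) x X =
      covAlong D φ U x X - vderiv (𝓡 m) h x X • U' x := by
  have hlin : (fun y => co (φ x) (φ y) (U y - h y • U' y)) =
      fun y => co (φ x) (φ y) (U y) - h y • co (φ x) (φ y) (U' y) := by
    funext y
    rw [map_sub, map_smul]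
  have hd : MDifferentiableAt (𝓡 m) 𝓘(ℝ, EuclideanSpace ℝ (Fin (m + k)))
      (fun y => co (φ x) (φ y) (U y) - h y • co (φ x) (φ y) (U' y)) x :=
    MDifferentiableAt.sub hU (hh.smul hU')
  have hd' : DiffAlongAt φ (fun y => U y - h y • U' y) x := by
    unfold DiffAlongAt; rw [hlin]; exact hd
  have hder : ∀ u u' : M → EuclideanSpace ℝ (Fin (m + k)),
      MDifferentiableAt (𝓡 m) 𝓘(ℝ, EuclideanSpace ℝ (Fin (m + k))) u x →
      MDifferentiableAt (𝓡 m) 𝓘(ℝ, EuclideanSpace ℝ (Fin (m + k))) u' x →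
      vderiv (𝓡 m) (fun y => u y - h y • u' y) x X =
        vderiv (𝓡 m) u x X - vderiv (𝓡 m) h x X • u' x := by
    intro u u' hu hu'
    have h1 := (hasDerivAt_comp_curve hu X).sub
      ((hasDerivAt_comp_curve hh X).smul (hasDerivAt_comp_curve hu' X))
    have h2 : MDifferentiableAt (𝓡 m) 𝓘(ℝ, EuclideanSpace ℝ (Fin (m + k)))
      (fun y => u y - h y • u' y) x := hu.sub (hh.smul hu')
    rw [(hasDerivAt_comp_curve h2 X).unique h1]
    simp only [curve_zero, h0, zero_smul, zero_add]
  rw [covAlong_eq D hd', covAlong_eq D hU, hlin, hder _ _ hU hU']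
  simp only [h0, zero_smul, sub_zero, map_sub, map_smul, sy_co_self]
  abel

theorem mfderiv_proj_section {d : ℕ} {M : Type*} [TopologicalSpace M]
    [ChartedSpace (EuclideanSpace ℝ (Fin d)) M] [IsManifold (𝓡 d) ∞ M]
    {F : Type*} [NormedAddCommGroup F] [NormedSpace ℝ F]
    {V : M → Type*} [TopologicalSpace (Bundle.TotalSpace F V)]
    [∀ x, AddCommMonoid (V x)] [∀ x, Module ℝ (V x)] [∀ x, TopologicalSpace (V x)]
    [FiberBundle F V] {s : Π x : M, V x} {x : M}
    (hs : MDifferentiableAt (𝓡 d) ((𝓡 d).prod 𝓘(ℝ, F)) (fun y => TotalSpace.mk' F y (s y)) x)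
    (X : TangentSpace (𝓡 d) x) :
    basePart (⟨x, s x⟩ : TotalSpace F V) (mfderiv (𝓡 d) ((𝓡 d).prod 𝓘(ℝ, F))
      (fun y => TotalSpace.mk' F y (s y)) x X) = X := by
  have h := mfderiv_comp x (mdifferentiableAt_proj (TotalSpace.mk' F x (s x))) hs
  have h2 : mfderiv (𝓡 d) (𝓡 d)
    ((TotalSpace.proj : TotalSpace F V → M) ∘ fun y => TotalSpace.mk' F y (s y)) x =
      ContinuousLinearMap.id ℝ _ := mfderiv_id
  exact (DFunLike.congr_fun (h.symm.trans h2) X)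

include hconf

theorem normalExt_mem (x : M) (K : EndTangent (m + k) N (φ x)) (y : M) :
    normalExt gN φ x K y ∈ normalEnd gN φ y := by
  refine ⟨fun v => ?_, fun w => normalProj_mem hconf y _⟩
  simp only [normalExt, ContinuousLinearMap.comp_apply, normalProj_dif hconf, map_zero]

theorem contMDiffAt_normalExt (x : M) (K : EndTangent (m + k) N (φ x)) :
    ContMDiffAt (𝓡 m) 𝓘(ℝ, EndModel (m + k)) ∞
      (fun y => co (φ x) (φ y) ∘L normalExt gN φ x K y ∘L sy (φ x) (φ y)) x := by
  have hP := contMDiffAt_normalProj hconf x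
  have hc : ContMDiffAt (𝓡 m) 𝓘(ℝ, EndModel (m + k)) ∞
    (fun _ : M => co (φ x) (φ x) ∘L K ∘L sy (φ x) (φ x)) x := contMDiffAt_const
  refine (hP.clm_comp (hc.clm_comp hP)).congr_of_eventuallyEq (Eventually.of_forall fun y => ?_)
  ext1 e
  simp only [normalExt, ContinuousLinearMap.comp_apply]

/-- Every endomorphism of the normal space is the value of a smooth section which is parallel along
a given vector. -/
theorem exists_normalParallel (DN : Connection (m + k) N) (x : M)
    (K : EndTangent (m + k) N (φ x)) (hB : K ∈ normalEnd gN φ x) (X : TangentSpace (𝓡 m) x) :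
    ∃ t : Π y : M, EndTangent (m + k) N (φ y), ContMDiffAt (𝓡 m) 𝓘(ℝ, EndModel (m + k)) ∞
      (fun y => co (φ x) (φ y) ∘L t y ∘L sy (φ x) (φ y)) x ∧ (∀ y, t y ∈ normalEnd gN φ y) ∧
      t x = K ∧ ∀ U : Π x : M, TangentSpace (𝓡 (m + k)) (φ x), SmoothAlongAt φ U x →
        U x ∈ normalSpace gN φ x → normalProj gN φ x (covAlong DN φ (fun y => t y (U y)) x X) =
          K (normalProj gN φ x (covAlong DN φ U x X)) := by
  obtain ⟨h, hsm, h0, h1⟩ := exists_affine_function x X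
  set t₀ := normalExt gN φ x K with ht₀
  have hKP : ∀ w, K (normalProj gN φ x w) = K w := by
    intro w
    conv_rhs => rw [← tangential_add_normal (gN := gN) x w, map_add, hB.1, zero_add]
  have ht₀x : t₀ x = K := by
    ext1 w
    rw [ht₀, normalExt_self, hKP, normalProj_of_mem hconf (hB.2 w)]
  have hsm₀ := contMDiffAt_normalExt hconf x K
  have hd₀ := hsm₀.mdifferentiableAt (n := ∞) (by simp)
  have hD₀ := mdifferentiableAt_endAlong_iff.2 hd₀
  -- `C` is the covariant derivative along `X` of the first extension `t₀`. Subtracting `h` times an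
  -- extension of `C` removes its normal part without changing the value at `x`.
  set C : EndTangent (m + k) N (φ x) := LinearMap.toContinuousLinearMap
    (vert DN (⟨φ x, t₀ x⟩ : TotalSpace (EndModel (m + k)) (EndTangent (m + k) N))
      (mfderiv (𝓡 m) ((𝓡 (m + k)).prod 𝓘(ℝ, EndModel (m + k)))
        (fun y => TotalSpace.mk' (EndModel (m + k)) (E := EndTangent (m + k) N) (φ y) (t₀ y)) x X))
    with hC
  -- The function `h` is normalised only for `X ≠ 0`; for `X = 0` the correction `C` is itself zero.
  have hCX : vderiv (𝓡 m) h x X • C = C := by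
    by_cases hX : X = 0
    · have : C = 0 := by
        ext1 w
        rw [hC, LinearMap.coe_toContinuousLinearMap', hX]
        rw [ContinuousLinearMap.map_zero, LinearMap.map_zero]
        rfl
      rw [this, smul_zero]
    · rw [h1 hX, one_smul]
  set t : Π y : M, EndTangent (m + k) N (φ y) := fun y => t₀ y - h y • normalExt gN φ x C y with ht
  have htmem : ∀ y, t y ∈ normalEnd gN φ y := by
    intro y
    have m1 := normalExt_mem hconf x K y
    have m2 := normalExt_mem hconf x C y
    refine ⟨fun v => ?_, fun w => ?_⟩
    · simp only [ht, sub_apply, smul_apply]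
      rw [m1.1, m2.1, smul_zero, sub_zero]
    · exact Submodule.sub_mem _ (m1.2 w) (Submodule.smul_mem _ _ (m2.2 w))
  have htsm : ContMDiffAt (𝓡 m) 𝓘(ℝ, EndModel (m + k)) ∞
      (fun y => co (φ x) (φ y) ∘L t y ∘L sy (φ x) (φ y)) x := by
    have := hsm₀.sub (hsm.smul (contMDiffAt_normalExt hconf x C))
    refine this.congr_of_eventuallyEq (Eventually.of_forall fun y => ?_)
    ext1 e
    change co (φ x) (φ y) (t₀ y (sy (φ x) (φ y) e) -
      h y • normalExt gN φ x C y (sy (φ x) (φ y) e)) = _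
    rw [map_sub, map_smul]
    rfl
  refine ⟨t, htsm, htmem, ?_, ?_⟩
  · change t₀ x - h x • normalExt gN φ x C x = K
    rw [h0, zero_smul, sub_zero, ht₀x]
  · intro U hU hUx
    have a1 := (apply_diffAlong hd₀ hU.diff X).1
    have a2 := (apply_diffAlong ((contMDiffAt_normalExt hconf x C).mdifferentiableAt (by simp))
      hU.diff X).1
    have e1 : covAlong DN φ (fun y => t y (U y)) x X =
        covAlong DN φ (fun y => t₀ y (U y)) x X -
          vderiv (𝓡 m) h x X • normalExt gN φ x C x (U x) :=
      covAlong_sub_smul DN (hsm.mdifferentiableAt (by simp)) h0 a1 a2 X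
    have e3 : C (U x) = covAlong DN φ (fun y => t₀ y (U y)) x X - t₀ x (covAlong DN φ U x X) :=
      vert_endAlong DN hD₀ X hU.diff
    rw [e1, hKP, normalExt_self, normalProj_of_mem hconf hUx, map_sub, map_smul,
      normalProj_of_mem hconf (normalProj_mem hconf x _), ← map_smul, ← smul_apply, hCX, e3, ht₀x,
      map_sub, normalProj_of_mem hconf (hB.2 _)]
    abel

/-- Every element of the bundle is the value of a smooth section which is parallel along a given
vector. -/
theorem exists_sumParallel (DM : Connection m M) (DN : Connection (m + k) N) (x : M)
    (B : SumBundle φ x) (hB : normalComponent φ x B ∈ normalEnd gN φ x) (X : TangentSpace (𝓡 m) x) :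
    ∃ s : Π x : M, SumBundle φ x, ContMDiffAt (𝓡 m) ((𝓡 m).prod 𝓘(ℝ, SumModel m k)) ∞
      (fun y => TotalSpace.mk' (SumModel m k) y (s y)) x ∧ s x = B ∧
      SumParallel gN DM DN φ s x X := by
  obtain ⟨s₁, hs₁, hs₁x, hpar⟩ := exists_endParallel DM x B.1 X
  obtain ⟨t, ht, htmem, htx, hpar'⟩ := exists_normalParallel hconf DN x _ hB X
  refine ⟨fun y => (s₁ y, t y), contMDiffAt_sum_iff.2 ⟨contMDiffAt_end_iff.1 hs₁, ht⟩,
    Prod.ext hs₁x htx, Eventually.of_forall htmem, hpar, fun U hU hUn => ?_⟩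
  have e4 : normalComponent φ x (s₁ x, t x) = normalComponent φ x B := htx
  rw [e4, ← hpar' U hU hUn.self_of_nhds]
  rfl

end Along

/-! ### Skew endomorphisms of an orthogonal direct sum -/

section Skew

variable {V V' : Type*} [AddCommGroup V] [Module ℝ V] [AddCommGroup V'] [Module ℝ V']
  {g : V' →ₗ[ℝ] V' →ₗ[ℝ] ℝ} {P : V →ₗ[ℝ] V'} {S : V' →ₗ[ℝ] V'} {J : V →ₗ[ℝ] V}
  (hsymm : ∀ v w, g v w = g w v) (hnd : ∀ w, (∀ w', g w w' = 0) → w = 0)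
  (hdec : ∀ w, ∃ v n, (∀ u, g n (P u) = 0) ∧ w = P v + n)
  (hS2 : ∀ w, S (S w) = -w) (hskew : ∀ w w', g (S w) w' = -g w (S w'))
  (hSP : ∀ v, S (P v) = P (J v)) (hJ2 : ∀ v, J (J v) = -v)

include hskew hSP in
theorem normal_apply {n : V'} (hn : ∀ u, g n (P u) = 0) (u : V) : g (S n) (P u) = 0 := by
  rw [hskew, hSP, hn, neg_zero]

include hsymm hskew hSP hdec in
-- The normal-normal block vanishes and the mixed ones are skew by assumption. In the tangent block
-- the symmetric part of `g(β ·, P ·)` is a multiple of `q`; since `J` is skew for `q`, its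
-- contributions cancel.
theorem skew_of_hessian {L : V' →ₗ[ℝ] V'} {β : V →ₗ[ℝ] V'} {q : V → V → ℝ} {c : ℝ}
    (hL : ∀ v, L (P v) = β (J v) - S (β v))
    (hq : ∀ v w, q (J v) w = -q v (J w))
    (hc : ∀ v w, g (β v) (P w) + g (P v) (β w) = c * q v w)
    (hnn : ∀ n n', (∀ u, g n (P u) = 0) → (∀ u, g n' (P u) = 0) → g (L n) n' = 0)
    (hmix : ∀ n v, (∀ u, g n (P u) = 0) → g (L n) (P v) = -g n (L (P v))) (w w' : V') :
    g (L w) w' = -g w (L w') := by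
  obtain ⟨v, n, hn, rfl⟩ := hdec w
  obtain ⟨v', n', hn', rfl⟩ := hdec w'
  have h1 : g (L (P v)) (P v') = -g (P v) (L (P v')) := by
    have e1 := hc (J v) v'
    have e2 := hc v (J v')
    have e3 := hskew (β v) (P v')
    have e4 := hskew (P v) (β v')
    rw [hSP] at e3 e4
    rw [hL, hL]
    simp only [map_sub, LinearMap.sub_apply]
    linear_combination e1 + e2 + c * hq v v' - e3 - e4
  have h2 := hmix n v' hn
  have h3 := hmix n' v hn'
  have h4 := hnn n n' hn hn'
  have h5 := hnn n' n hn' hn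
  rw [hsymm] at h5
  rw [hsymm, hsymm n'] at h3
  simp only [map_add, LinearMap.add_apply]
  linear_combination h1 + h2 + h3 + h4 + h5

include hsymm hnd hskew hSP hdec hS2 hJ2 in
-- On tangent vectors this is the identity `S (β(Jv) - S β(v)) = S β(Jv) + β(v)`, up to sign. On
-- normal vectors it follows by pairing with both summands and moving `L` and `S` across `g`.
theorem anticomm_of_hessian {L : V' →ₗ[ℝ] V'} {β : V →ₗ[ℝ] V'}
    (hL : ∀ v, L (P v) = β (J v) - S (β v))
    (hnn : ∀ n n', (∀ u, g n (P u) = 0) → (∀ u, g n' (P u) = 0) → g (L n) n' = 0)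
    (hmix : ∀ n v, (∀ u, g n (P u) = 0) → g (L n) (P v) = -g n (L (P v))) (w : V') :
    L (S w) = -S (L w) := by
  have hP : ∀ v, L (S (P v)) = -S (L (P v)) := by
    intro v
    rw [hSP, hL, hL, map_sub, hS2, hJ2, map_neg]
    abel
  obtain ⟨v, n, hn, rfl⟩ := hdec w
  suffices h : L (S n) = -S (L n) by rw [map_add, map_add, hP, h, map_add, map_add]; abel
  rw [← sub_eq_zero]
  refine hnd _ fun w' => ?_
  obtain ⟨v', n', hn', rfl⟩ := hdec w'
  have hSn := normal_apply hskew hSP hn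
  have hSn' := normal_apply hskew hSP hn'
  have e1 := hmix (S n) v' hSn
  have e2 := hnn (S n) n' hSn hn'
  have e3 := hnn n (S n') hn hSn'
  have e4 := hmix n (J v') hn
  have e5 := hP v'
  rw [hSP] at e5
  rw [e5, map_neg] at e4
  have e6 := hskew (L n) (P v')
  rw [hSP] at e6
  have e7 := hskew (L n) n'
  have e8 := hskew n (L (P v'))
  simp only [map_add, map_sub, map_neg, LinearMap.sub_apply, LinearMap.neg_apply]
  linear_combination e1 + e2 + e6 - e4 + e7 - e3 - e8

include hsymm hnd hdec hskew hSP in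
-- The map `S L` is skew because `S` and `L` are skew and anticommute, and it has zero normal-normal
-- block because `S` preserves the normal space. A skew map with zero normal-normal block is
-- determined by its values on the image of `P`.
theorem eq_comp_of_skew {L L' : V' →ₗ[ℝ] V'} {σ : ℝ}
    (hL : ∀ w w', g (L w) w' = -g w (L w')) (hanti : ∀ w, L (S w) = -S (L w))
    (hL' : ∀ w w', g (L' w) w' = -g w (L' w'))
    (hnn : ∀ n n', (∀ u, g n (P u) = 0) → (∀ u, g n' (P u) = 0) → g (L n) n' = 0)
    (hnn' : ∀ n n', (∀ u, g n (P u) = 0) → (∀ u, g n' (P u) = 0) → g (L' n) n' = 0)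
    (h : ∀ v, L' (P v) = σ • S (L (P v))) (w : V') : L' w = σ • S (L w) := by
  obtain ⟨v, n, hn, rfl⟩ := hdec w
  suffices h2 : L' n = σ • S (L n) by rw [map_add, h, h2, map_add, map_add, smul_add]
  rw [← sub_eq_zero]
  refine hnd _ fun w' => ?_
  obtain ⟨v', n', hn', rfl⟩ := hdec w'
  have hSn' := normal_apply hskew hSP hn'
  have e1 := hL' n (P v')
  rw [h, map_smul, smul_eq_mul] at e1
  have e2 := hnn' n n' hn hn'
  have e3 := hnn n (S n') hn hSn'
  have e4 := hskew (L n) n'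
  have e5 := hskew (L n) (P v')
  have e6 := hL n (S (P v'))
  rw [hanti, map_neg] at e6
  simp only [map_add, map_sub, map_smul, LinearMap.sub_apply, LinearMap.smul_apply, smul_eq_mul]
  linear_combination e1 + e2 - σ * e4 - σ * e5 + σ * e3 + σ * e6

end Skew

/-! ### Complex vectors as pairs of real vectors. -/

section Complexification

variable {T B : Type*} [AddCommGroup T] [Module ℝ T] [AddCommGroup B] [Module ℝ B]

theorem ofReIm_eq_tmul (σ : ℝ) (a b : T) :
    ofReIm a (σ • b) = (1 : ℂ) ⊗ₜ[ℝ] a + (σ * Complex.I) ⊗ₜ[ℝ] b := by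
  rw [ofReIm, ← TensorProduct.smul_tmul, Complex.real_smul]

theorem ofReIm_eq_of_mul_self {σ : ℝ} (hσ : σ * σ = 1) (a b : T) :
    ofReIm a b = (1 : ℂ) ⊗ₜ[ℝ] a + (σ * Complex.I) ⊗ₜ[ℝ] (σ • b) := by
  rw [← ofReIm_eq_tmul, smul_smul, hσ, one_smul]

theorem ofReIm_mem_comap (f : T →ₗ[ℝ] B) {p : Submodule ℂ (ℂ ⊗[ℝ] B)} {a b : T} :
    ofReIm a b ∈ p.comap (f.baseChange ℂ) ↔ ofReIm (f a) (f b) ∈ p := by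
  rw [Submodule.mem_comap, baseChange_ofReIm]

theorem ofReIm_mem_sup {p q : Submodule ℂ (ℂ ⊗[ℝ] T)} {w₁ w₂ u₁ u₂ : T}
    (hp : ofReIm u₁ u₂ ∈ p) (hq : ofReIm (w₁ - u₁) (w₂ - u₂) ∈ q) : ofReIm w₁ w₂ ∈ p ⊔ q := by
  have h : ofReIm w₁ w₂ = ofReIm u₁ u₂ + ofReIm (w₁ - u₁) (w₂ - u₂) := by
    rw [ofReIm_add, add_sub_cancel, add_sub_cancel]
  rw [h]
  exact Submodule.add_mem_sup hp hq

/-- The space of vectors `a + i b` such that `f b = σ S ∘ f a`. -/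
def intertwiner (f : T →ₗ[ℝ] B →ₗ[ℝ] B) (S : B →ₗ[ℝ] B) (hS : ∀ v, S (S v) = -v) {σ : ℝ}
    (hσ : σ * σ = 1) : Submodule ℂ (ℂ ⊗[ℝ] T) where
  carrier := {W | ∃ a b, W = ofReIm a b ∧ ∀ v, f b v = σ • S (f a v)}
  zero_mem' := ⟨0, 0, by simp [ofReIm], by simp⟩
  add_mem' := by
    rintro _ _ ⟨a, b, rfl, h⟩ ⟨a', b', rfl, h'⟩
    refine ⟨a + a', b + b', by rw [ofReIm_add], fun v => ?_⟩
    rw [map_add, map_add, LinearMap.add_apply, LinearMap.add_apply, h, h', map_add, smul_add]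
  -- The condition says that the complexification of `f` maps `a + i b` into the eigenspace for `-σ
  -- i` of the composition with `S`. Stability under complex scalars uses `S² = -1` and `σ² = 1`.
  smul_mem' := by
    rintro c _ ⟨a, b, rfl, h⟩
    refine ⟨_, _, smul_ofReIm c a b, fun v => ?_⟩
    have h1 : f (c.im • a + c.re • b) v = c.im • f a v + (c.re * σ) • S (f a v) := by
      rw [map_add, map_smul, map_smul, LinearMap.add_apply, LinearMap.smul_apply,
        LinearMap.smul_apply, h, smul_smul]
    have h2 : f (c.re • a - c.im • b) v = c.re • f a v - (c.im * σ) • S (f a v) := by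
      rw [map_sub, map_smul, map_smul, LinearMap.sub_apply, LinearMap.smul_apply,
        LinearMap.smul_apply, h, smul_smul]
    have h3 : σ * (c.im * σ) = c.im := by linear_combination c.im * hσ
    rw [h1, h2, map_sub, map_smul, map_smul, hS, smul_neg, sub_neg_eq_add, smul_add, smul_smul,
      smul_smul, h3, mul_comm σ, add_comm]

theorem ofReIm_mem_intertwiner {f : T →ₗ[ℝ] B →ₗ[ℝ] B} {S : B →ₗ[ℝ] B} {hS : ∀ v, S (S v) = -v}
    {σ : ℝ} {hσ : σ * σ = 1} {a b : T} :
    ofReIm a b ∈ intertwiner f S hS hσ ↔ ∀ v, f b v = σ • S (f a v) := by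
  constructor
  · rintro ⟨a', b', hab, h⟩
    obtain ⟨rfl, rfl⟩ := ofReIm_inj.1 hab
    exact h
  · exact fun h => ⟨a, b, rfl, h⟩

end Complexification

/-! ### The distribution on the twistor space -/

section Distribution

variable {d : ℕ} {M : Type*} [TopologicalSpace M] [ChartedSpace (EuclideanSpace ℝ (Fin d)) M]
  [IsManifold (𝓡 d) ∞ M] {g : Metric d M} {D : Connection d M}

theorem exists_horizontal (D : Connection d M) (z : TotalSpace (EndModel d) (EndTangent d M))
    (X : TangentSpace (𝓡 d) z.proj) :
    ∃ h : TangentSpace ((𝓡 d).prod 𝓘(ℝ, EndModel d)) z, basePart z h = X ∧ vert D z h = 0 := by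
  obtain ⟨x, S⟩ := z
  obtain ⟨s, hs, rfl, hpar⟩ := exists_endParallel D x S X
  have hd := hs.mdifferentiableAt (n := ∞) (by simp)
  exact ⟨_, (endSection_parts hd X).1, (endParallel_iff D hd _).1 hpar⟩

theorem isVerticalLift_sub {z : TotalSpace (EndModel d) (EndTangent d M)}
    {w u : TangentSpace ((𝓡 d).prod 𝓘(ℝ, EndModel d)) z} {A : EndTangent d M z.proj}
    (hb : basePart z u = basePart z w) (hu : vert D z u = 0) (hw : vert D z w = A.toLinearMap) :
    IsVerticalLift z A (w - u) := by
  rw [isVerticalLift_end_iff D, ContinuousLinearMap.map_sub, LinearMap.map_sub, hb, hu, hw,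
    sub_self, sub_zero]
  exact ⟨rfl, rfl⟩

theorem isVerticalLift_smul (D : Connection d M) {z : TotalSpace (EndModel d) (EndTangent d M)}
    {v : TangentSpace ((𝓡 d).prod 𝓘(ℝ, EndModel d)) z} {A : EndTangent d M z.proj}
    (h : IsVerticalLift z A v) (σ : ℝ) : IsVerticalLift z (σ • A) (σ • v) := by
  rw [isVerticalLift_end_iff D] at h ⊢
  rw [ContinuousLinearMap.map_smul, LinearMap.map_smul, h.1, h.2, smul_zero]
  exact ⟨rfl, rfl⟩

theorem ofReIm_mem_horizontalLift {z : TotalSpace (EndModel d) (EndTangent d M)}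
    {w₁ w₂ : TangentSpace ((𝓡 d).prod 𝓘(ℝ, EndModel d)) z} :
    ofReIm w₁ w₂ ∈ horizontalLift z (horizontalSpace (EndParallel D) z)
      (minusISpace z.2.toLinearMap) ↔
    (vert D z w₁ = 0 ∧ vert D z w₂ = 0) ∧
      z.2 (basePart z w₁) = basePart z w₂ ∧ z.2 (basePart z w₂) = -basePart z w₁ := by
  rw [horizontalLift, Submodule.mem_inf, ofReIm_mem_baseChange, mem_horizontalSpace_end_iff,
    mem_horizontalSpace_end_iff]
  refine and_congr_right fun _ => ?_
  exact (ofReIm_mem_comap (basePart z).toLinearMap).trans (ofReIm_mem_minusISpace _ _ _)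

/-- Subtract the horizontal lifts of the base parts: these lie in the horizontal summand, and the
remainders are the vertical lifts of `A` and `σ S A`. -/
theorem ofReIm_mem_twistorDistribution {z : TotalSpace (EndModel d) (EndTangent d M)} {σ : ℝ}
    {w₁ w₂ : TangentSpace ((𝓡 d).prod 𝓘(ℝ, EndModel d)) z} (hS : ∀ v, z.2 (z.2 v) = -v)
    (hbase : z.2 (basePart z w₁) = basePart z w₂) (hσ : σ * σ = 1)
    {A : EndTangent d M z.proj} (hA : A ∈ fibreTangent g z.proj z.2)
    (h₁ : vert D z w₁ = A.toLinearMap) (h₂ : vert D z w₂ = (σ • z.2 ∘L A).toLinearMap) :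
    ofReIm w₁ w₂ ∈ twistorDistribution g D (σ * Complex.I) z := by
  obtain ⟨u₁, hb₁, hu₁⟩ := exists_horizontal D z (basePart z w₁)
  obtain ⟨u₂, hb₂, hu₂⟩ := exists_horizontal D z (basePart z w₂)
  refine ofReIm_mem_sup (ofReIm_mem_horizontalLift.2
    ⟨⟨hu₁, hu₂⟩, by rw [hb₁, hb₂, hbase], by rw [hb₁, hb₂, ← hbase, hS]⟩) ?_
  -- The remainder `w₂ - u₂` lifts `σ S A`, so its multiple by `σ` lifts `S A`, as the generators of
  -- the vertical part require.
  refine Submodule.subset_span ⟨A, hA, w₁ - u₁, σ • (w₂ - u₂), isVerticalLift_sub hb₁ hu₁ h₁, ?_, ?_⟩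
  · have h := isVerticalLift_smul D (isVerticalLift_sub hb₂ hu₂ h₂) σ
    rwa [smul_smul, hσ, one_smul] at h
  · exact ofReIm_eq_of_mul_self hσ _ _

/-- The relation defines a complex subspace, so it is enough to check it on the two summands: on the
horizontal one `vert` vanishes, and on the vertical one it is the form of the generators. -/
theorem vert_of_mem_twistorDistribution {z : TotalSpace (EndModel d) (EndTangent d M)} {σ : ℝ}
    (hS : ∀ v, z.2 (z.2 v) = -v) (hσ : σ * σ = 1)
    {w₁ w₂ : TangentSpace ((𝓡 d).prod 𝓘(ℝ, EndModel d)) z}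
    (hW : ofReIm w₁ w₂ ∈ twistorDistribution g D (σ * Complex.I) z) (v : TangentSpace (𝓡 d) z.proj) :
    vert D z w₂ v = σ • z.2 (vert D z w₁ v) := by
  suffices h : twistorDistribution g D (σ * Complex.I) z ≤
      intertwiner (vert D z) z.2.toLinearMap hS hσ from ofReIm_mem_intertwiner.1 (h hW) v
  refine sup_le ?_ (Submodule.span_le.2 ?_)
  · intro W hW
    obtain ⟨w₁, w₂, rfl⟩ := exists_ofReIm W
    obtain ⟨⟨h₁, h₂⟩, -⟩ := ofReIm_mem_horizontalLift.1 hW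
    refine ofReIm_mem_intertwiner.2 fun v => ?_
    rw [h₁, h₂]
    simp
  · rintro W ⟨A, -, v, w, hv, hw, rfl⟩
    rw [SetLike.mem_coe, ← ofReIm_eq_tmul]
    refine ofReIm_mem_intertwiner.2 fun u => ?_
    rw [isVerticalLift_end_iff D] at hv hw
    rw [LinearMap.map_smul, hv.2, hw.2]
    rfl

end Distribution

/-! ### The direct sum map and the distributions -/

/-- The space of the elements for which the values of `f` are skew endomorphisms, determined by the
bilinear map `b`. -/
def hessianSubmodule {T V V' : Type*} [AddCommGroup T] [Module ℝ T] [AddCommGroup V] [Module ℝ V]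
    [AddCommGroup V'] [Module ℝ V'] (f : T →ₗ[ℝ] V' →ₗ[ℝ] V') (p : T →ₗ[ℝ] V)
    (b : V →ₗ[ℝ] V →ₗ[ℝ] V') (J : V →ₗ[ℝ] V) (S : V' →ₗ[ℝ] V') (P : V →ₗ[ℝ] V')
    (n : Submodule ℝ V') (g : V' →ₗ[ℝ] V' →ₗ[ℝ] ℝ) : Submodule ℝ T where
  carrier := {v | (∀ u, f v (P u) = b (p v) (J u) - S (b (p v) u)) ∧
    (∀ w w', w ∈ n → w' ∈ n → g (f v w) w' = 0) ∧
    ∀ w u, w ∈ n → g (f v w) (P u) = -g w (f v (P u))}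
  zero_mem' := by simp
  add_mem' := by
    rintro v w ⟨a1, a2, a3⟩ ⟨b1, b2, b3⟩
    refine ⟨fun u => ?_, fun n n' hn hn' => ?_, fun n u hn => ?_⟩
    · simp only [map_add, LinearMap.add_apply, a1, b1]
      abel
    · simp only [map_add, LinearMap.add_apply, a2 n n' hn hn', b2 n n' hn hn', add_zero]
    · simp only [map_add, LinearMap.add_apply, a3 n u hn, b3 n u hn, neg_add]
  smul_mem' := by
    rintro a v ⟨a1, a2, a3⟩
    refine ⟨fun u => ?_, fun n n' hn hn' => ?_, fun n u hn => ?_⟩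
    · simp only [map_smul, LinearMap.smul_apply, a1, smul_sub]
    · simp only [map_smul, LinearMap.smul_apply, a2 n n' hn hn', smul_zero]
    · simp only [map_smul, LinearMap.smul_apply, a3 n u hn, smul_neg]

section Along

variable {m k : ℕ}
  {M : Type*} [TopologicalSpace M] [ChartedSpace (EuclideanSpace ℝ (Fin m)) M]
  [IsManifold (𝓡 m) ∞ M]
  {N : Type*} [TopologicalSpace N] [ChartedSpace (EuclideanSpace ℝ (Fin (m + k))) N]
  [IsManifold (𝓡 (m + k)) ∞ N]
  {φ : C^∞⟮𝓡 m, M; 𝓡 (m + k), N⟯} {gM : Metric m M} {gN : Metric (m + k) N}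

/-- A metric, as a bilinear form. -/
def metricForm {d : ℕ} {M : Type*} [TopologicalSpace M] [ChartedSpace (EuclideanSpace ℝ (Fin d)) M]
    [IsManifold (𝓡 d) ∞ M] (g : Metric d M) (x : M) :
    TangentSpace (𝓡 d) x →ₗ[ℝ] TangentSpace (𝓡 d) x →ₗ[ℝ] ℝ :=
  ContinuousLinearMap.coeLM ℝ ∘ₗ (g.inner x).toLinearMap

theorem inner_complexStructure {d : ℕ} {M : Type*} [TopologicalSpace M]
    [ChartedSpace (EuclideanSpace ℝ (Fin d)) M] [IsManifold (𝓡 d) ∞ M] {g : Metric d M}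
    {o : Π x : M, Orientation ℝ (TangentSpace (𝓡 d) x) (Fin d)} {x : M} {J : EndTangent d M x}
    (hJ : J ∈ posComplexStructures g o x) (v w : TangentSpace (𝓡 d) x) :
    g.inner x (J v) w = -g.inner x v (J w) := by
  rw [← hJ.2.1 v, hJ.1, map_neg, neg_neg]

theorem basePart_mfderiv_directSumMap (hconf : IsConformalImmersion gM gN φ)
    (z : TotalSpace (SumModel m k) (SumBundle φ))
    (v : TangentSpace ((𝓡 m).prod 𝓘(ℝ, SumModel m k)) z) :
    basePart (directSumMap gN φ z) (mfderiv ((𝓡 m).prod 𝓘(ℝ, SumModel m k))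
      ((𝓡 (m + k)).prod 𝓘(ℝ, EndModel (m + k))) (directSumMap gN φ) z v) =
      dif φ z.proj (basePart z v) := by
  have h1 := mfderiv_comp z (mdifferentiableAt_proj (directSumMap gN φ z))
    (mdifferentiableAt_directSumMap hconf z)
  have h2 := mfderiv_comp z (mdifferentiableAt_immersion φ z.proj) (mdifferentiableAt_proj z)
  exact DFunLike.congr_fun (h1.symm.trans h2) v

/-! ### Algebra of the direct sum of two complex structures. -/

section Structure

variable {oM : Π x : M, Orientation ℝ (TangentSpace (𝓡 m) x) (Fin m)}
  {oN : Π y : N, Orientation ℝ (TangentSpace (𝓡 (m + k)) y) (Fin (m + k))}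
  {x : M} {B : SumBundle φ x}
  (hB₁ : B.1 ∈ posComplexStructures gM oM x)
  (hB₂ : normalComponent φ x B ∈ posNormalComplexStructures gN oM oN φ x)

include hB₂ in
theorem inner_normalStructure {w w' : TangentSpace (𝓡 (m + k)) (φ x)} (hw : w ∈ normalSpace gN φ x)
    (hw' : w' ∈ normalSpace gN φ x) :
    gN.inner (φ x) (normalComponent φ x B w) w' = -gN.inner (φ x) w (normalComponent φ x B w') := by
  rw [← hB₂.2.2.1 w hw _ (hB₂.1.2 _), hB₂.2.1 _ hw', map_neg, neg_neg]

variable (hconf : IsConformalImmersion gM gN φ)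

include hconf

theorem exists_decomposition (x : M) (w : TangentSpace (𝓡 (m + k)) (φ x)) :
    ∃ v n, (∀ u, gN.inner (φ x) n (dif φ x u) = 0) ∧ w = dif φ x v + n :=
  ⟨_, _, normalProj_mem hconf x w, (tangential_add_normal x w).symm⟩

theorem directEnd_add {x : M} {B : SumBundle φ x} (hB : normalComponent φ x B ∈ normalEnd gN φ x)
    (v : TangentSpace (𝓡 m) x) {n : TangentSpace (𝓡 (m + k)) (φ x)}
    (hn : ∀ u, gN.inner (φ x) n (dif φ x u) = 0) :
    directEnd gN φ x B (dif φ x v + n) = dif φ x (B.1 v) + normalComponent φ x B n := by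
  rw [map_add, directEnd_dif hconf hB, directEnd_normal hconf hn]

include hB₁ hB₂

theorem directEnd_sq (w : TangentSpace (𝓡 (m + k)) (φ x)) :
    directEnd gN φ x B (directEnd gN φ x B w) = -w := by
  obtain ⟨v, n, hn, rfl⟩ := exists_decomposition hconf x w
  have hn' : n ∈ normalSpace gN φ x := hn
  rw [map_add, directEnd_dif hconf hB₂.1, directEnd_normal hconf hn', map_add,
    directEnd_dif hconf hB₂.1, directEnd_normal hconf (hB₂.1.2 _), hB₁.1, hB₂.2.1 _ hn', map_neg,
    neg_add]

theorem directEnd_skew (w w' : TangentSpace (𝓡 (m + k)) (φ x)) :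
    gN.inner (φ x) (directEnd gN φ x B w) w' = -gN.inner (φ x) w (directEnd gN φ x B w') := by
  obtain ⟨v, n, hn, rfl⟩ := exists_decomposition hconf x w
  obtain ⟨v', n', hn', rfl⟩ := exists_decomposition hconf x w'
  obtain ⟨r, -, hr⟩ := hconf x
  have e1 := inner_normalStructure hB₂ hn hn'
  have e2 := inner_complexStructure hB₁ v v'
  have e3 := hB₂.1.2 n v'
  have e4 := hB₂.1.2 n' v
  have e5 := hn (B.1 v')
  have e6 := hn' (B.1 v)
  rw [metric_symm gN] at e4 e6
  rw [directEnd_add hconf hB₂.1 v hn, directEnd_add hconf hB₂.1 v' hn']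
  simp only [map_add, add_apply, hr]
  linear_combination e1 + r * e2 + e3 + e4 + e5 + e6

/-- Block-diagonal sums are compatible with skewness, with anticommutation and with composition by
`J ⊕ K`. Thus the direct sum map is complex linear on vertical vectors, and these put no condition
on the immersion. -/
theorem sum_mem_fibreTangent {A : SumBundle φ x} (hA : A ∈ sumFibreTangent gM gN φ x B) :
    dif φ x ∘L A.1 ∘L tangentialPart gN φ x + normalComponent φ x A ∈
      fibreTangent gN (φ x) (directEnd gN φ x B) ∧
    directEnd gN φ x B ∘L (dif φ x ∘L A.1 ∘L tangentialPart gN φ x + normalComponent φ x A) =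
      dif φ x ∘L (B.1 ∘L A.1) ∘L tangentialPart gN φ x +
        normalComponent φ x B ∘L normalComponent φ x A := by
  obtain ⟨h1, h2, h3⟩ := hA
  obtain ⟨r, -, hr⟩ := hconf x
  have hP : ∀ v, directEnd gN φ x A (dif φ x v) = dif φ x (A.1 v) := directEnd_dif hconf h2
  have hn : ∀ n ∈ normalSpace gN φ x, directEnd gN φ x A n = normalComponent φ x A n :=
    fun n hn => directEnd_normal hconf hn
  refine ⟨⟨fun w w' => ?_, fun w => ?_⟩, ?_⟩
  · change gN.inner (φ x) (directEnd gN φ x A w) w' = -gN.inner (φ x) w (directEnd gN φ x A w')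
    obtain ⟨v, n, hn, rfl⟩ := exists_decomposition hconf x w
    obtain ⟨v', n', hn', rfl⟩ := exists_decomposition hconf x w'
    have e1 := h3.1 n n'
    have e2 := h1.1 v v'
    have e3 := h2.2 n v'
    have e4 := h2.2 n' v
    have e5 := hn (A.1 v')
    have e6 := hn' (A.1 v)
    rw [metric_symm gN] at e4 e6
    rw [directEnd_add hconf h2 v hn, directEnd_add hconf h2 v' hn']
    simp only [map_add, add_apply, hr]
    linear_combination e1 + r * e2 + e3 + e4 + e5 + e6
  · change directEnd gN φ x A (directEnd gN φ x B w) = -directEnd gN φ x B (directEnd gN φ x A w)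
    obtain ⟨v, n, hn, rfl⟩ := exists_decomposition hconf x w
    rw [map_add, directEnd_dif hconf hB₂.1, directEnd_normal hconf hn, map_add, map_add, hP, hP,
      map_add, directEnd_dif hconf hB₂.1, directEnd_normal hconf hn, h1.2, map_neg,
      directEnd_normal hconf (hB₂.1.2 _), h3.2, directEnd_normal hconf (h2.2 _), neg_add]
  · ext1 w
    change directEnd gN φ x B (directEnd gN φ x A w) = dif φ x (B.1 (A.1 (tangentialPart gN φ x w))) +
      normalComponent φ x B (normalComponent φ x A w)
    rw [directEnd_apply x A w, map_add, directEnd_dif hconf hB₂.1, directEnd_normal hconf (h2.2 _)]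

end Structure

/-! ### Images of horizontal vectors. -/

section Horizontal

variable {DM : Connection m M} {DN : Connection (m + k) N} {x : M} {B : SumBundle φ x}
  (hconf : IsConformalImmersion gM gN φ) (hB : normalComponent φ x B ∈ normalEnd gN φ x)
include hconf hB

theorem exists_sumHorizontal (DM : Connection m M) (DN : Connection (m + k) N)
    (X : TangentSpace (𝓡 m) x) :
    ∃ v ∈ horizontalSpace (SumParallel gN DM DN φ)
      (⟨x, B⟩ : TotalSpace (SumModel m k) (SumBundle φ)), basePart _ v = X := by
  obtain ⟨s, hs, rfl, hpar⟩ := exists_sumParallel hconf DM DN x B hB X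
  have hd := hs.mdifferentiableAt (n := ∞) (by simp)
  exact ⟨_, Submodule.subset_span ⟨s, X, hs, hpar, rfl⟩, mfderiv_proj_section hd X⟩

/-- The vertical components of the images of the horizontal vectors. -/
theorem sumVert_horizontal (hDN : IsWeylConnection gN DN)
    (hskew : ∀ w w', gN.inner (φ x) (directEnd gN φ x B w) w' =
      -gN.inner (φ x) w (directEnd gN φ x B w'))
    {v : TangentSpace ((𝓡 m).prod 𝓘(ℝ, SumModel m k))
      (⟨x, B⟩ : TotalSpace (SumModel m k) (SumBundle φ))}
    (hv : v ∈ horizontalSpace (SumParallel gN DM DN φ) ⟨x, B⟩) :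
    (∀ u, sumVert gN φ DN x B v (dif φ x u) = hessian φ DM DN x (basePart _ v) (B.1 u) -
      directEnd gN φ x B (hessian φ DM DN x (basePart _ v) u)) ∧
    (∀ n n', n ∈ normalSpace gN φ x → n' ∈ normalSpace gN φ x →
      gN.inner (φ x) (sumVert gN φ DN x B v n) n' = 0) ∧
    (∀ n u, n ∈ normalSpace gN φ x → gN.inner (φ x) (sumVert gN φ DN x B v n) (dif φ x u) =
      -gN.inner (φ x) n (sumVert gN φ DN x B v (dif φ x u))) := by
  -- The three properties are linear in `v`, so they need only be checked on the velocities of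
  -- parallel sections that span the horizontal space.
  suffices h : horizontalSpace (SumParallel gN DM DN φ)
      (⟨x, B⟩ : TotalSpace (SumModel m k) (SumBundle φ)) ≤
      hessianSubmodule (sumVert gN φ DN x B) (basePart (⟨x, B⟩ : TotalSpace (SumModel m k)
        (SumBundle φ))).toLinearMap (hessian φ DM DN x) B.1.toLinearMap
        (directEnd gN φ x B).toLinearMap (dif φ x).toLinearMap (normalSpace gN φ x)
        (metricForm gN (φ x)) from h hv
  refine Submodule.span_le.2 ?_
  rintro v ⟨s, X, hs, hpar, heq⟩
  have hS : s x = B := eq_of_heq (TotalSpace.mk.injEq _ _ _ _ ▸ congrArg TotalSpace.proj heq).2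
  subst hS
  have hv : mfderiv (𝓡 m) ((𝓡 m).prod 𝓘(ℝ, SumModel m k))
      (fun y => TotalSpace.mk' (SumModel m k) y (s y)) x X = v :=
    eq_of_heq (TotalSpace.mk.injEq _ _ _ _ ▸ heq).2
  subst hv
  have hd := hs.mdifferentiableAt (n := ∞) (by simp)
  refine ⟨fun u => ?_, fun n n' hn hn' => inner_sumVert_normal hconf hd hpar hn hn',
    fun n u hn => inner_sumVert_mixed hconf hd hpar hDN hskew hn u⟩
  refine (sumVert_dif hconf hd hpar u).trans ?_
  have := mfderiv_proj_section hd X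
  exact congrArg (fun Y => hessian φ DM DN x Y ((s x).1 u) -
    directEnd gN φ x (s x) (hessian φ DM DN x Y u)) this.symm

end Horizontal

end Along

/-! ### The criterion for the direct sum map to be holomorphic -/

theorem ofReIm_mem_horizontalLift_iff {d : ℕ} {M : Type*} [TopologicalSpace M]
    [ChartedSpace (EuclideanSpace ℝ (Fin d)) M]
    {F : Type*} [NormedAddCommGroup F] [NormedSpace ℝ F]
    {V : M → Type*} [TopologicalSpace (Bundle.TotalSpace F V)]
    [∀ x, AddCommMonoid (V x)] [∀ x, Module ℝ (V x)] [∀ x, TopologicalSpace (V x)]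
    [FiberBundle F V] {z : TotalSpace F V}
    {H : Submodule ℝ (TangentSpace ((𝓡 d).prod 𝓘(ℝ, F)) z)}
    {J : TangentSpace (𝓡 d) z.proj →ₗ[ℝ] TangentSpace (𝓡 d) z.proj}
    {w₁ w₂ : TangentSpace ((𝓡 d).prod 𝓘(ℝ, F)) z} :
    ofReIm w₁ w₂ ∈ horizontalLift z H (minusISpace J) ↔ (w₁ ∈ H ∧ w₂ ∈ H) ∧
      J (basePart z w₁) = basePart z w₂ ∧ J (basePart z w₂) = -basePart z w₁ := by
  rw [horizontalLift, Submodule.mem_inf, ofReIm_mem_baseChange]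
  refine and_congr_right fun _ => ?_
  exact (ofReIm_mem_comap (basePart z).toLinearMap).trans (ofReIm_mem_minusISpace _ _ _)

section Along

variable {m k : ℕ}
  {M : Type*} [TopologicalSpace M] [ChartedSpace (EuclideanSpace ℝ (Fin m)) M]
  [IsManifold (𝓡 m) ∞ M]
  {N : Type*} [TopologicalSpace N] [ChartedSpace (EuclideanSpace ℝ (Fin (m + k))) N]
  [IsManifold (𝓡 (m + k)) ∞ N]
  {φ : C^∞⟮𝓡 m, M; 𝓡 (m + k), N⟯} {gM : Metric m M} {gN : Metric (m + k) N}

section Criterion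

variable {oM : Π x : M, Orientation ℝ (TangentSpace (𝓡 m) x) (Fin m)}
  {oN : Π y : N, Orientation ℝ (TangentSpace (𝓡 (m + k)) y) (Fin (m + k))}
  {DM : Connection m M} {DN : Connection (m + k) N} (hDM : IsWeylConnection gM DM)
  (hDN : IsWeylConnection gN DN) (hconf : IsConformalImmersion gM gN φ)
  {x : M} {B : SumBundle φ x} (hB₁ : B.1 ∈ posComplexStructures gM oM x)
  (hB₂ : normalComponent φ x B ∈ posNormalComplexStructures gN oM oN φ x)
include hDM hDN hconf hB₁ hB₂

/-- This says that the vertical component is tangent to the fibre of the twistor space of `N` at the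
image point, as required for membership in the distribution. -/
theorem sumVert_skew {v : TangentSpace ((𝓡 m).prod 𝓘(ℝ, SumModel m k))
      (⟨x, B⟩ : TotalSpace (SumModel m k) (SumBundle φ))}
    (hv : v ∈ horizontalSpace (SumParallel gN DM DN φ) ⟨x, B⟩) :
    (∀ w w', gN.inner (φ x) (sumVert gN φ DN x B v w) w' =
      -gN.inner (φ x) w (sumVert gN φ DN x B v w')) ∧
    ∀ w, sumVert gN φ DN x B v (directEnd gN φ x B w) =
      -directEnd gN φ x B (sumVert gN φ DN x B v w) := by
  have hskew := directEnd_skew hB₁ hB₂ hconf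
  obtain ⟨h1, h2, h3⟩ := sumVert_horizontal (DM := DM) hconf hB₂.1 hDN hskew hv
  obtain ⟨c, hc⟩ := exists_inner_hessian hDM hDN hconf x
  exact ⟨skew_of_hessian (g := metricForm gN (φ x)) (P := (dif φ x).toLinearMap)
    (S := (directEnd gN φ x B).toLinearMap) (J := B.1.toLinearMap)
    (β := hessian φ DM DN x (basePart _ v)) (q := fun v w => gM.inner x v w)
    (metric_symm gN (φ x)) (exists_decomposition hconf x) hskew (directEnd_dif hconf hB₂.1) h1
    (inner_complexStructure hB₁) (fun v' w => hc _ v' w) (fun n n' hn hn' => h2 n n' hn hn')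
    fun n u hn => h3 n u hn,
    anticomm_of_hessian (g := metricForm gN (φ x)) (P := (dif φ x).toLinearMap)
    (S := (directEnd gN φ x B).toLinearMap) (J := B.1.toLinearMap)
    (β := hessian φ DM DN x (basePart _ v))
    (metric_symm gN (φ x)) (fun w hw => metric_definite gN (φ x) (hw w))
    (exists_decomposition hconf x) (directEnd_sq hB₁ hB₂ hconf) hskew
    (directEnd_dif hconf hB₂.1) hB₁.1 h1 (fun n n' hn hn' => h2 n n' hn hn')
    fun n u hn => h3 n u hn⟩

set_option maxHeartbeats 800000 in
/-- The direct sum map is holomorphic at a point if and only if the Hessian satisfies an algebraic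
condition, with respect to the corresponding complex structures. -/
theorem directSumMap_holomorphicAt_iff {σ : ℝ} (hσ : σ * σ = 1) :
    (∀ W ∈ sumTwistorDistribution gM gN DM DN φ (σ * Complex.I)
        (⟨x, B⟩ : TotalSpace (SumModel m k) (SumBundle φ)),
      (mfderiv ((𝓡 m).prod 𝓘(ℝ, SumModel m k)) ((𝓡 (m + k)).prod 𝓘(ℝ, EndModel (m + k)))
        (directSumMap gN φ) ⟨x, B⟩).toLinearMap.baseChange ℂ W ∈
        twistorDistribution gN DN (σ * Complex.I) (directSumMap gN φ ⟨x, B⟩)) ↔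
    ∀ u v, hessian φ DM DN x (B.1 u) (B.1 v) - directEnd gN φ x B (hessian φ DM DN x (B.1 u) v) =
      σ • (directEnd gN φ x B (hessian φ DM DN x u (B.1 v)) + hessian φ DM DN x u v) := by
  have hskew := directEnd_skew hB₁ hB₂ hconf
  have hsq := directEnd_sq hB₁ hB₂ hconf
  have hdif := directEnd_dif hconf hB₂.1
  have hbase : ∀ v, basePart (⟨φ x, directEnd gN φ x B⟩ : TotalSpace (EndModel (m + k))
      (EndTangent (m + k) N)) (mfderiv ((𝓡 m).prod 𝓘(ℝ, SumModel m k))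
      ((𝓡 (m + k)).prod 𝓘(ℝ, EndModel (m + k))) (directSumMap gN φ) ⟨x, B⟩ v) =
      dif φ x (basePart _ v) := basePart_mfderiv_directSumMap hconf ⟨x, B⟩
  have hlift : ∀ w₁ w₂ : TangentSpace ((𝓡 m).prod 𝓘(ℝ, SumModel m k))
      (⟨x, B⟩ : TotalSpace (SumModel m k) (SumBundle φ)),
      ofReIm w₁ w₂ ∈ horizontalLift ⟨x, B⟩ (horizontalSpace (SumParallel gN DM DN φ) ⟨x, B⟩)
        (minusISpace B.1.toLinearMap) ↔
      (w₁ ∈ horizontalSpace (SumParallel gN DM DN φ) ⟨x, B⟩ ∧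
        w₂ ∈ horizontalSpace (SumParallel gN DM DN φ) ⟨x, B⟩) ∧
      B.1 (basePart _ w₁) = basePart _ w₂ ∧ B.1 (basePart _ w₂) = -basePart _ w₁ :=
    fun w₁ w₂ => ofReIm_mem_horizontalLift_iff
  constructor
  · intro h u v
    -- Horizontal lifts of `u` and `J u` combine to a vector `w₁ + i w₂` of the distribution;
    -- evaluating the resulting relation on `dφ v` gives the condition.
    obtain ⟨w₁, hw₁, hb₁⟩ := exists_sumHorizontal hconf hB₂.1 DM DN u
    obtain ⟨w₂, hw₂, hb₂⟩ := exists_sumHorizontal hconf hB₂.1 DM DN (B.1 u)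
    have h1 := h (ofReIm w₁ w₂) (Submodule.mem_sup_left ((hlift w₁ w₂).2
      ⟨⟨hw₁, hw₂⟩, by rw [hb₁, hb₂], by rw [hb₁, hb₂, hB₁.1]⟩))
    rw [baseChange_ofReIm] at h1
    have h2 : sumVert gN φ DN x B w₂ (dif φ x v) =
        σ • directEnd gN φ x B (sumVert gN φ DN x B w₁ (dif φ x v)) :=
      vert_of_mem_twistorDistribution (z := (⟨φ x, directEnd gN φ x B⟩ :
        TotalSpace (EndModel (m + k)) (EndTangent (m + k) N))) hsq hσ h1 (dif φ x v)
    rw [(sumVert_horizontal (DM := DM) hconf hB₂.1 hDN hskew hw₁).1,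
      (sumVert_horizontal (DM := DM) hconf hB₂.1 hDN hskew hw₂).1, hb₁, hb₂, map_sub, hsq,
      sub_neg_eq_add] at h2
    exact h2
  · intro h
    suffices hle : sumTwistorDistribution gM gN DM DN φ (σ * Complex.I)
        (⟨x, B⟩ : TotalSpace (SumModel m k) (SumBundle φ)) ≤
        (twistorDistribution gN DN (σ * Complex.I) (⟨φ x, directEnd gN φ x B⟩ :
          TotalSpace (EndModel (m + k)) (EndTangent (m + k) N))).comap
        ((mfderiv ((𝓡 m).prod 𝓘(ℝ, SumModel m k)) ((𝓡 (m + k)).prod 𝓘(ℝ, EndModel (m + k)))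
        (directSumMap gN φ) ⟨x, B⟩).toLinearMap.baseChange ℂ) from fun W hW => hle hW
    refine sup_le ?_ (Submodule.span_le.2 ?_)
    · intro W hW
      obtain ⟨w₁, w₂, rfl⟩ := exists_ofReIm W
      obtain ⟨⟨hw₁, hw₂⟩, hb, -⟩ := (hlift w₁ w₂).1 hW
      refine (ofReIm_mem_comap _).2 ?_
      have s₁ := sumVert_skew hDM hDN hconf hB₁ hB₂ hw₁
      have s₂ := sumVert_skew hDM hDN hconf hB₁ hB₂ hw₂
      obtain ⟨a1, a2, -⟩ := sumVert_horizontal (DM := DM) hconf hB₂.1 hDN hskew hw₁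
      obtain ⟨b1, b2, -⟩ := sumVert_horizontal (DM := DM) hconf hB₂.1 hDN hskew hw₂
      -- The condition gives `L' = σ S L` only on `dφ(TM)`; skewness extends it to the normal
      -- vectors.
      have key := eq_comp_of_skew (g := metricForm gN (φ x)) (P := (dif φ x).toLinearMap)
        (S := (directEnd gN φ x B).toLinearMap) (J := B.1.toLinearMap)
        (metric_symm gN (φ x)) (fun w hw => metric_definite gN (φ x) (hw w))
        (exists_decomposition hconf x) hskew hdif (σ := σ) s₁.1 s₁.2 s₂.1
        (fun n n' hn hn' => a2 n n' hn hn') (fun n n' hn hn' => b2 n n' hn hn') (fun v => by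
          have := h (basePart _ w₁) v
          rw [hb] at this
          refine (b1 v).trans (this.trans ?_)
          change _ = σ • directEnd gN φ x B (sumVert gN φ DN x B w₁ (dif φ x v))
          rw [a1, map_sub, hsq, sub_neg_eq_add])
      refine ofReIm_mem_twistorDistribution hsq (by
        change directEnd gN φ x B _ = _
        refine (congrArg (directEnd gN φ x B) (hbase w₁)).trans ?_
        exact (hdif _).trans ((congrArg (dif φ x) hb).trans (hbase w₂).symm)) hσ
        (A := LinearMap.toContinuousLinearMap (sumVert gN φ DN x B w₁)) s₁ rfl
        (LinearMap.ext key)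
    · rintro W ⟨A, hA, v, w, hv, hw, rfl⟩
      have hw' := isVerticalLift_directSumMap hconf hw
      refine Submodule.mem_sup_right (Submodule.subset_span ⟨_,
        (sum_mem_fibreTangent hB₁ hB₂ hconf hA).1, _, mfderiv ((𝓡 m).prod 𝓘(ℝ, SumModel m k))
        ((𝓡 (m + k)).prod 𝓘(ℝ, EndModel (m + k))) (directSumMap gN φ) ⟨x, B⟩ w,
        isVerticalLift_directSumMap hconf hv, ?_, ?_⟩)
      · exact (congrArg (fun C : EndTangent (m + k) N (φ x) => IsVerticalLift
          (directSumMap gN φ ⟨x, B⟩) C (mfderiv ((𝓡 m).prod 𝓘(ℝ, SumModel m k))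
          ((𝓡 (m + k)).prod 𝓘(ℝ, EndModel (m + k))) (directSumMap gN φ) ⟨x, B⟩ w))
          (sum_mem_fibreTangent hB₁ hB₂ hconf hA).2).mpr hw'
      · simp only [map_add, LinearMap.baseChange_tmul]
        rfl

end Criterion

end Along

/-! ### Orientations and the existence of complex structures -/

section ProdBasis

variable {V V' : Type*} [AddCommGroup V] [Module ℝ V] [AddCommGroup V'] [Module ℝ V']
  {d d' : ℕ}

/-- The matrix of the change of basis is block diagonal with one block the identity, so its
determinant is that of the change from `b` to `b'`. -/
theorem prod_orientation_eq {b b' : Module.Basis (Fin d) ℝ V} (c : Module.Basis (Fin d') ℝ V')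
    (h : b.orientation = b'.orientation) : (b.prod c).orientation = (b'.prod c).orientation := by
  rw [Module.Basis.orientation_eq_iff_det_pos] at h ⊢
  have hm : (b.prod c).toMatrix (b'.prod c) = Matrix.fromBlocks (b.toMatrix b') 0 0 1 := by
    ext i j
    rcases i with i | i <;> rcases j with j | j <;>
      simp [Module.Basis.toMatrix_apply, Matrix.one_apply, Finsupp.single_apply, eq_comm]
  rwa [Module.Basis.det_apply, hm, Matrix.det_fromBlocks_zero₂₁, Matrix.det_one, mul_one,
    ← Module.Basis.det_apply]

theorem flipBasis_orientation (b : Module.Basis (Fin d) ℝ V) (n : Fin d) :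
    (flipBasis b n).orientation = -b.orientation :=
  Module.Basis.orientation_neg_single b n

theorem prod_flipBasis_orientation (b : Module.Basis (Fin d) ℝ V) (c : Module.Basis (Fin d') ℝ V')
    (n : Fin d') : (b.prod (flipBasis c n)).orientation = -(b.prod c).orientation := by
  rw [← Module.Basis.orientation_neg_single (b.prod c) (Sum.inr n)]
  congr 1
  refine Module.Basis.eq_of_apply_eq fun i => ?_
  rcases i with i | i
  · simp [Module.Basis.unitsSMul_apply, Module.Basis.prod_apply]
  · by_cases h : i = n
    · subst h
      simp [Module.Basis.unitsSMul_apply, Module.Basis.prod_apply, flipBasis_self]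
    · simp [Module.Basis.unitsSMul_apply, Module.Basis.prod_apply, flipBasis_of_ne _ h,
        Function.update_of_ne (show (Sum.inr i : Fin d ⊕ Fin d') ≠ Sum.inr n by simpa using h)]

theorem isSignClosed_orientation (o : Orientation ℝ V (Fin d)) :
    IsSignClosed fun b : Module.Basis (Fin d) ℝ V => b.orientation = o := by
  intro b n
  rcases b.orientation_eq_or_eq_neg o with h | h
  · exact Or.inl h.symm
  · exact Or.inr ((flipBasis_orientation b n).trans h.symm)

end ProdBasis

/-! ### Orientations and complex structures on the normal spaces. -/

section Along

variable {m k : ℕ}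
  {M : Type*} [TopologicalSpace M] [ChartedSpace (EuclideanSpace ℝ (Fin m)) M]
  [IsManifold (𝓡 m) ∞ M]
  {N : Type*} [TopologicalSpace N] [ChartedSpace (EuclideanSpace ℝ (Fin (m + k))) N]
  [IsManifold (𝓡 (m + k)) ∞ N]
  {φ : C^∞⟮𝓡 m, M; 𝓡 (m + k), N⟯} {gM : Metric m M} {gN : Metric (m + k) N}

section Structures

variable {oM : Π x : M, Orientation ℝ (TangentSpace (𝓡 m) x) (Fin m)}
  {oN : Π y : N, Orientation ℝ (TangentSpace (𝓡 (m + k)) y) (Fin (m + k))}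

theorem mem_posComplexStructures {d : ℕ} {M : Type*} [TopologicalSpace M]
    [ChartedSpace (EuclideanSpace ℝ (Fin d)) M] [IsManifold (𝓡 d) ∞ M] {g : Metric d M}
    {o : Π x : M, Orientation ℝ (TangentSpace (𝓡 d) x) (Fin d)} {x : M}
    {J : TangentSpace (𝓡 d) x →ₗ[ℝ] TangentSpace (𝓡 d) x}
    (hJ : IsPosStructure (metricForm g x) (fun b => b.orientation = o x) J) :
    LinearMap.toContinuousLinearMap J ∈ posComplexStructures g o x := hJ

variable (hconf : IsConformalImmersion gM gN φ)
include hconf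

/-- The orthogonal decomposition of the tangent spaces of `N` along `M`. -/
def sumEquiv (x : M) :
    (TangentSpace (𝓡 m) x × normalSpace gN φ x) ≃ₗ[ℝ] TangentSpace (𝓡 (m + k)) (φ x) :=
  LinearEquiv.ofBijective ((dif φ x).toLinearMap.coprod (normalSpace gN φ x).subtype) (by
    constructor
    · rw [← LinearMap.ker_eq_bot, LinearMap.ker_eq_bot']
      rintro ⟨v, n⟩ h
      have h' : dif φ x v + n = 0 := h
      have h1 := congrArg (tangentialPart gN φ x) h'
      rw [map_add, tangentialPart_dif hconf, (tangentialPart_eq_zero_iff hconf).2 n.2, add_zero,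
        map_zero] at h1
      rw [h1, map_zero, zero_add] at h'
      exact Prod.ext h1 (Subtype.ext h')
    · intro w
      exact ⟨(tangentialPart gN φ x w, ⟨_, normalProj_mem hconf x w⟩), tangential_add_normal x w⟩)

theorem finrank_normalSpace (x : M) : Module.finrank ℝ (normalSpace gN φ x) = k := by
  have h := (sumEquiv hconf x).finrank_eq
  rw [Module.finrank_prod, finrank_tangentSpace, finrank_tangentSpace] at h
  omega

/-- The basis formed of the bases `b` and `c` of the tangent space of `M` and of the normal space. -/
def sumBasis {x : M} (b : Module.Basis (Fin m) ℝ (TangentSpace (𝓡 m) x))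
    (c : Module.Basis (Fin k) ℝ (normalSpace gN φ x)) :
    Module.Basis (Fin (m + k)) ℝ (TangentSpace (𝓡 (m + k)) (φ x)) :=
  ((b.prod c).map (sumEquiv hconf x)).reindex finSumFinEquiv

theorem sumBasis_coe {x : M} (b : Module.Basis (Fin m) ℝ (TangentSpace (𝓡 m) x))
    (c : Module.Basis (Fin k) ℝ (normalSpace gN φ x)) :
    ⇑(sumBasis hconf b c) = Fin.append (fun i => dif φ x (b i))
        (fun j => (c j : TangentSpace (𝓡 (m + k)) (φ x))) := by
  funext i
  refine Fin.addCases (fun i => ?_) (fun j => ?_) i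
  · rw [Fin.append_left, sumBasis, Module.Basis.reindex_apply, finSumFinEquiv_symm_apply_castAdd,
      Module.Basis.map_apply, Module.Basis.prod_apply]
    change dif φ x (b i) + 0 = _
    rw [add_zero]
  · rw [Fin.append_right, sumBasis, Module.Basis.reindex_apply, finSumFinEquiv_symm_apply_natAdd,
      Module.Basis.map_apply, Module.Basis.prod_apply]
    change dif φ x 0 + (c j : TangentSpace (𝓡 (m + k)) (φ x)) = _
    rw [map_zero, zero_add]

theorem sumBasis_orientation_eq {x : M} {b b' : Module.Basis (Fin m) ℝ (TangentSpace (𝓡 m) x)}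
    (c : Module.Basis (Fin k) ℝ (normalSpace gN φ x)) (h : b.orientation = b'.orientation) :
    (sumBasis hconf b c).orientation = (sumBasis hconf b' c).orientation := by
  rw [sumBasis, sumBasis, Module.Basis.orientation_reindex, Module.Basis.orientation_reindex,
    Module.Basis.orientation_map, Module.Basis.orientation_map, prod_orientation_eq c h]

theorem sumBasis_flip_orientation {x : M} (b : Module.Basis (Fin m) ℝ (TangentSpace (𝓡 m) x))
    (c : Module.Basis (Fin k) ℝ (normalSpace gN φ x)) (n : Fin k) :
    (sumBasis hconf b (flipBasis c n)).orientation = -(sumBasis hconf b c).orientation := by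
  rw [sumBasis, sumBasis, Module.Basis.orientation_reindex, Module.Basis.orientation_reindex,
    Module.Basis.orientation_map, Module.Basis.orientation_map, prod_flipBasis_orientation,
    Orientation.map_neg, Orientation.reindex_neg]

/-- Whether the joint basis is positive does not depend on the chosen positive basis of the tangent
space of `M`, and changing one sign in `c` reverses it. -/
theorem isSignClosed_normal (x : M) :
    IsSignClosed (IsPositiveNormalBasis gN oM oN φ x) := by
  intro c n
  by_cases hb : ∃ b : Module.Basis (Fin m) ℝ (TangentSpace (𝓡 m) x), b.orientation = oM x
  · obtain ⟨b, hb⟩ := hb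
    rcases (sumBasis hconf b c).orientation_eq_or_eq_neg (oN (φ x)) with h | h
    · refine Or.inl fun b' hb' => ⟨sumBasis hconf b' c, ?_, sumBasis_coe hconf b' c⟩
      rw [h, sumBasis_orientation_eq hconf c (hb'.trans hb.symm)]
    · refine Or.inr fun b' hb' => ⟨sumBasis hconf b' _, ?_, sumBasis_coe hconf b' _⟩
      rw [h, sumBasis_orientation_eq hconf _ (hb'.trans hb.symm), sumBasis_flip_orientation]
  -- Without a positive basis of the tangent space, which can occur only for `m = 0`, the condition
  -- on `c` is vacuous.
  · exact Or.inl fun b hb' => absurd ⟨b, hb'⟩ hb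

/-- The metric of the normal space. -/
def normalForm (gN : Metric (m + k) N) (φ : C^∞⟮𝓡 m, M; 𝓡 (m + k), N⟯) (x : M) :
    normalSpace gN φ x →ₗ[ℝ] normalSpace gN φ x →ₗ[ℝ] ℝ :=
  (metricForm gN (φ x)).compl₁₂ (normalSpace gN φ x).subtype (normalSpace gN φ x).subtype

/-- The endomorphism of `T_{φ(x)}N` induced by an endomorphism of the normal space. -/
def extendNormal {x : M} (K : normalSpace gN φ x →ₗ[ℝ] normalSpace gN φ x) :
    EndTangent (m + k) N (φ x) :=
  LinearMap.toContinuousLinearMap ((normalSpace gN φ x).subtype ∘ₗ K ∘ₗ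
    (normalProj gN φ x).toLinearMap.codRestrict (normalSpace gN φ x) (normalProj_mem hconf x))

theorem extendNormal_apply {x : M} (K : normalSpace gN φ x →ₗ[ℝ] normalSpace gN φ x)
    (w : normalSpace gN φ x) :
    extendNormal hconf K (w : TangentSpace (𝓡 (m + k)) (φ x)) = K w := by
  have h : (normalProj gN φ x).toLinearMap.codRestrict (normalSpace gN φ x)
      (normalProj_mem hconf x) w = w := Subtype.ext (normalProj_of_mem hconf w.2)
  exact congrArg (fun u => ((K u : normalSpace gN φ x) : TangentSpace (𝓡 (m + k)) (φ x))) h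

theorem extendNormal_mem {x : M} {K : normalSpace gN φ x →ₗ[ℝ] normalSpace gN φ x}
    (hK : IsPosStructure (normalForm gN φ x) (IsPositiveNormalBasis gN oM oN φ x) K) :
    extendNormal hconf K ∈ posNormalComplexStructures gN oM oN φ x := by
  obtain ⟨h1, h2, c, hc, hcK⟩ := hK
  refine ⟨⟨fun v => ?_, fun w => ?_⟩, fun w hw => ?_, fun w hw w' hw' => ?_, c, hc,
    fun i j hi hj => ?_⟩
  · have h : (normalProj gN φ x).toLinearMap.codRestrict (normalSpace gN φ x)
      (normalProj_mem hconf x) (dif φ x v) = 0 := Subtype.ext (normalProj_dif hconf x v)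
    have h' : K ((normalProj gN φ x).toLinearMap.codRestrict (normalSpace gN φ x)
      (normalProj_mem hconf x) (dif φ x v)) = 0 := by rw [h, map_zero]
    exact congrArg Subtype.val h'
  · exact (K _).2
  · have e := extendNormal_apply hconf K ⟨w, hw⟩
    have e' := extendNormal_apply hconf K (K ⟨w, hw⟩)
    rw [e, e', h1]
    rfl
  · have e := extendNormal_apply hconf K ⟨w, hw⟩
    have e' := extendNormal_apply hconf K ⟨w', hw'⟩
    rw [e, e']
    exact h2 ⟨w, hw⟩ ⟨w', hw'⟩
  · exact (extendNormal_apply hconf K (c i)).trans (congrArg Subtype.val (hcK i j hi hj))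

theorem exists_normalStructure (hk : Even k) (hor : k = 0 → PreservesOrientation oM oN φ) (x : M) :
    ∃ K, K ∈ posNormalComplexStructures gN oM oN φ x := by
  suffices h : ∃ K, IsPosStructure (normalForm gN φ x) (IsPositiveNormalBasis gN oM oN φ x) K by
    obtain ⟨K, hK⟩ := h
    exact ⟨_, extendNormal_mem hconf hK⟩
  have hdim := finrank_normalSpace hconf x
  by_cases h2 : 2 ≤ k
  · exact exists_posStructure_of_two_le hk hdim (fun v w => metric_symm gN (φ x) _ _)
      (fun v hv => metric_pos gN (φ x) (by simpa using hv)) h2 (isSignClosed_normal hconf x)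
  -- In codimension zero the only candidate is the zero structure with the empty basis; its
  -- positivity is the assumption that `φ` preserves the orientations.
  · have h0 : k = 0 := by
      obtain ⟨j, hj⟩ := hk
      omega
    subst h0
    have hsub : Subsingleton (normalSpace gN φ x) := Module.finrank_zero_iff.1 hdim
    let c : Module.Basis (Fin 0) ℝ (normalSpace gN φ x) := Module.Basis.empty _
    refine ⟨0, fun v => Subsingleton.elim _ _, fun v w => ?_, c, fun b hb => ?_, fun i => i.elim0⟩
    · rw [Subsingleton.elim v 0, Subsingleton.elim w 0]; simp
    · obtain ⟨a, ha, hab⟩ := hor rfl x rfl b hb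
      refine ⟨a, ha, ?_⟩
      funext i
      refine Fin.addCases (fun i => ?_) (fun j => j.elim0) i
      rw [Fin.append_left]
      exact hab i

/-- The direct sum of positive complex structures is positive. -/
theorem directEnd_mem (hm : Even m) {x : M} {B : SumBundle φ x}
    (hB₁ : B.1 ∈ posComplexStructures gM oM x)
    (hB₂ : normalComponent φ x B ∈ posNormalComplexStructures gN oM oN φ x) :
    directEnd gN φ x B ∈ posComplexStructures gN oN (φ x) := by
  refine ⟨directEnd_sq hB₁ hB₂ hconf, fun v w => ?_, ?_⟩
  · rw [directEnd_skew hB₁ hB₂ hconf, directEnd_sq hB₁ hB₂ hconf, map_neg, neg_neg]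
  obtain ⟨b, hb, hbJ⟩ := hB₁.2.2
  obtain ⟨c, hc, hcK⟩ := hB₂.2.2.2
  obtain ⟨a, ha, hac⟩ := hc b hb
  refine ⟨a, ha, ?_⟩
  rw [hac]
  intro i j hi hj
  revert hi hj
  refine Fin.addCases (fun i => ?_) (fun i => ?_) i
  · intro hi hj
    rw [Fin.val_castAdd] at hi hj
    -- Since `m` is even, a pair `(i, i + 1)` with `i` even never straddles the two blocks of the
    -- basis.
    have hjm : i.val + 1 < m := by
      have := i.2
      obtain ⟨p, hp⟩ := hi
      obtain ⟨q, hq⟩ := hm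
      omega
    have hj' : j = Fin.castAdd k ⟨i.val + 1, hjm⟩ := Fin.ext (by simpa using hj)
    rw [hj', Fin.append_left, Fin.append_left]
    refine (directEnd_dif hconf hB₂.1 (b i)).trans (congrArg (dif φ x) ?_)
    exact hbJ i ⟨i.val + 1, hjm⟩ hi rfl
  · intro hi hj
    rw [Fin.val_natAdd] at hi hj
    have hi' : Even i.val := (Nat.even_add.1 hi).1 hm
    have hjk : i.val + 1 < k := by
      have := j.2
      omega
    have hj' : j = Fin.natAdd m ⟨i.val + 1, hjk⟩ := Fin.ext (by simp [hj]; omega)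
    rw [hj', Fin.append_right, Fin.append_right]
    refine (directEnd_normal hconf (c i).2).trans ?_
    exact hcK i ⟨i.val + 1, hjk⟩ hi' rfl

end Structures

end Along

/-! ### Umbilical submanifolds and geodesic maps -/

section Algebra

variable {V V' : Type*} [AddCommGroup V] [Module ℝ V] [AddCommGroup V'] [Module ℝ V']
  {q : V →ₗ[ℝ] V →ₗ[ℝ] ℝ} {g : V' →ₗ[ℝ] V' →ₗ[ℝ] ℝ} {P : V →ₗ[ℝ] V'} {b : V →ₗ[ℝ] V →ₗ[ℝ] V'}
  {c : V → ℝ}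

theorem eq_zero_of_eq_neg {v : V} (h : v = -v) : v = 0 := by
  have h2 : (2 : ℝ) • v = 0 := by rw [two_smul, ← eq_neg_iff_add_eq_zero]; exact h
  exact (smul_eq_zero.1 h2).resolve_left two_ne_zero

theorem apply_eq_zero_of_apply_self {β : V →ₗ[ℝ] V →ₗ[ℝ] V'} (hb : ∀ u v, β u v = β v u)
    (h : ∀ u, β u u = 0) (u v : V) : β u v = 0 := by
  have h1 := h (u + v)
  rw [map_add, map_add, LinearMap.add_apply, LinearMap.add_apply, hb v u, h, h, zero_add,
    add_zero] at h1
  exact eq_zero_of_eq_neg (eq_neg_of_add_eq_zero_left h1)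

/-- The Koszul formula. -/
theorem koszul_formula (hq : ∀ v w, q v w = q w v) (hg : ∀ v w, g v w = g w v)
    (hb : ∀ u v, b u v = b v u) (hc : ∀ u v w, g (b u v) (P w) + g (P v) (b u w) = c u * q v w)
    (u v w : V) : 2 * g (b u v) (P w) = c u * q v w + c v * q u w - c w * q u v := by
  have h1 := hc u v w
  have h2 := hc v u w
  have h3 := hc w u v
  rw [hg (P _)] at h1 h2 h3
  rw [hb v u] at h2
  rw [hb w u, hb w v] at h3
  rw [hq v w] at *
  linear_combination h1 + h2 - h3

/-- A symmetric bilinear map whose values on the orthogonal vectors of the same norm are equal is a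
multiple of the scalar product. -/
theorem exists_eq_smul_of_orthogonal {d : ℕ} [FiniteDimensional ℝ V]
    (hdim : Module.finrank ℝ V = d) (hq : ∀ v w, q v w = q w v) (hpos : ∀ v, v ≠ 0 → 0 < q v v)
    (hb : ∀ u v, b u v = b v u)
    (h : ∀ u v, u ≠ 0 → q u v = 0 → q v v = q u u → b v v = b u u) :
    ∃ (u : V) (r : ℝ), ∀ v w, b v w = q v w • (r • b u u) := by
  rcases d with _ | d
  · have : Subsingleton V := Module.finrank_zero_iff.1 hdim
    exact ⟨0, 0, fun v w => by rw [Subsingleton.elim v 0]; simp⟩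
  obtain ⟨e, -, he⟩ := exists_orthogonal_basis hdim q hq hpos ∅ (fun _ => 0) 1 one_pos (by simp)
  refine ⟨e 0, 1, fun v w => ?_⟩
  rw [one_smul]
  have h2 : ∀ i j, i ≠ j → b (e i) (e j) = 0 := by
    intro i j hij
    -- The vectors `e i ± e j` are orthogonal and of equal length; equality of `b` on them says `4 b
    -- (e i) (e j) = 0`.
    have h3 := h (e i + e j) (e i - e j) (fun h0 => by
      have : q (e i + e j) (e i) = 0 := by rw [h0]; simp
      simp [he, hij.symm] at this) (by simp [he, hij, hij.symm]) (by simp [he, hij, hij.symm])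
    simp only [map_add, map_sub, LinearMap.add_apply, LinearMap.sub_apply, hb (e j) (e i)] at h3
    have h4 : (4 : ℝ) • b (e i) (e j) = 0 := by
      have h5 : b (e i) (e i) - b (e i) (e j) - (b (e i) (e j) - b (e j) (e j)) -
        (b (e i) (e i) + b (e i) (e j) + (b (e i) (e j) + b (e j) (e j))) = 0 := sub_eq_zero.2 h3
      rw [← neg_eq_zero, ← h5]
      module
    exact (smul_eq_zero.1 h4).resolve_left (by norm_num)
  have h1 : b = q.compr₂ (LinearMap.toSpanSingleton ℝ V' (b (e 0) (e 0))) := by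
    refine e.ext fun i => e.ext fun j => ?_
    rw [LinearMap.compr₂_apply, LinearMap.toSpanSingleton_apply, he]
    by_cases hij : i = j
    · subst hij
      rw [if_pos rfl, one_smul]
      by_cases hi : i = 0
      · rw [hi]
      · exact h _ _ (e.ne_zero _) (by rw [he, if_neg (Ne.symm hi)]) (by simp [he])
    · rw [if_neg hij, zero_smul, h2 i j hij]
  exact LinearMap.congr_fun₂ h1 v w

section SumCondition

variable {β : V →ₗ[ℝ] V →ₗ[ℝ] V'} {J J' : V →ₗ[ℝ] V} {K K' : V' →ₗ[ℝ] V'} {u v : V}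

/-- With one `K` and two structures taking opposite values at `u`, the terms `2 K β(u, ·)` are
opposite while the other terms agree, so they vanish. -/
theorem eq_of_pos_neg (hJ : J u = v) (hJ' : J' u = -v)
    (h : β (J u) (J u) = β u u + (2 : ℝ) • K (β u (J u)))
    (h' : β (J' u) (J' u) = β u u + (2 : ℝ) • K (β u (J' u))) : β v v = β u u := by
  rw [hJ] at h
  simp only [hJ', map_neg, LinearMap.neg_apply, neg_neg, smul_neg] at h'
  have h2 : (2 : ℝ) • K (β u v) = 0 := eq_zero_of_eq_neg (add_left_cancel (h.symm.trans h'))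
  rw [h, h2, add_zero]

theorem eq_of_apply_eq_zero (hJ : J u = v ∨ J u = -v) (h0 : β u v = 0)
    (h : β (J u) (J u) = β u u + (2 : ℝ) • K (β u (J u))) : β v v = β u u := by
  rcases hJ with hJ | hJ <;> simpa [hJ, h0] using h

/-- Here `J` is fixed and the normal structure varies: opposite values of `K` and `K'` at `β u v`
force the last term to vanish. -/
theorem eq_of_apply_neg (hJ : J u = v ∨ J u = -v) (hK : K' (β u v) = -K (β u v))
    (h : β (J u) (J u) = β u u + (2 : ℝ) • K (β u (J u)))
    (h' : β (J u) (J u) = β u u + (2 : ℝ) • K' (β u (J u))) : β v v = β u u := by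
  have h2 : (2 : ℝ) • K (β u v) = -((2 : ℝ) • K (β u v)) := by
    rcases hJ with hJ | hJ <;> rw [h, hJ] at h' <;>
      simpa [hK, eq_comm (a := (2 : ℝ) • K (β u v))] using h'
  have h3 : K (β u v) = 0 := (smul_eq_zero.1 (eq_zero_of_eq_neg h2)).resolve_left two_ne_zero
  rcases hJ with hJ | hJ <;> simpa [hJ, h3] using h

end SumCondition

end Algebra

/-! ### Consequences of the algebraic condition. -/

section Along

variable {m k : ℕ}
  {M : Type*} [TopologicalSpace M] [ChartedSpace (EuclideanSpace ℝ (Fin m)) M]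
  [IsManifold (𝓡 m) ∞ M]
  {N : Type*} [TopologicalSpace N] [ChartedSpace (EuclideanSpace ℝ (Fin (m + k))) N]
  [IsManifold (𝓡 (m + k)) ∞ N]
  {φ : C^∞⟮𝓡 m, M; 𝓡 (m + k), N⟯} {gM : Metric m M} {gN : Metric (m + k) N}

section Final

variable {oM : Π x : M, Orientation ℝ (TangentSpace (𝓡 m) x) (Fin m)}
  {oN : Π y : N, Orientation ℝ (TangentSpace (𝓡 (m + k)) y) (Fin (m + k))}
  {DM : Connection m M} {DN : Connection (m + k) N}
  (hconf : IsConformalImmersion gM gN φ)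

theorem isGeodesicMap_iff : IsGeodesicMap DM DN φ ↔ ∀ x X v, hessian φ DM DN x X v = 0 := by
  constructor
  · intro h x X v
    obtain ⟨Y, hY, rfl⟩ := exists_smoothField x v
    have h1 := h x Y hY X
    rwa [covAlong_dif DM DN hY.diff, add_eq_right] at h1
  · intro h x Y hY X
    rw [covAlong_dif DM DN hY.diff, h, zero_add]

include hconf

/-- The second fundamental form is the normal part of the Hessian, since `dφ (D_M,X Y)` has no
normal component. -/
theorem isUmbilical_iff (DM : Connection m M) : IsUmbilical gM gN DN φ ↔
    ∀ x, ∃ ξ ∈ normalSpace gN φ x, ∀ X v,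
      normalProj gN φ x (hessian φ DM DN x X v) = gM.inner x X v • ξ := by
  refine forall_congr' fun x => exists_congr fun ξ => and_congr_right fun _ => ?_
  constructor
  · intro h X v
    obtain ⟨Y, hY, rfl⟩ := exists_smoothField x v
    have h1 := h Y hY X
    rwa [covAlong_dif DM DN hY.diff, map_add, normalProj_dif hconf, add_zero] at h1
  · intro h Y hY X
    rw [covAlong_dif DM DN hY.diff, map_add, normalProj_dif hconf, add_zero, h]

theorem normalProj_directEnd {x : M} {B : SumBundle φ x}
    (hB : normalComponent φ x B ∈ normalEnd gN φ x) (w : TangentSpace (𝓡 (m + k)) (φ x)) :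
    normalProj gN φ x (directEnd gN φ x B w) =
      normalComponent φ x B (normalProj gN φ x w) := by
  obtain ⟨v, n, hn, rfl⟩ := exists_decomposition hconf x w
  rw [directEnd_add hconf hB v hn, map_add, map_add, normalProj_dif hconf, normalProj_dif hconf,
    normalProj_of_mem hconf (hB.2 n), normalProj_of_mem hconf hn, zero_add, zero_add]

/-- Two vectors are equal if their normal parts, and their scalar products with the tangent vectors,
are equal. -/
theorem eq_of_normalProj_eq {x : M} {w w' : TangentSpace (𝓡 (m + k)) (φ x)}
    (h₁ : ∀ v, gN.inner (φ x) w (dif φ x v) = gN.inner (φ x) w' (dif φ x v))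
    (h₂ : normalProj gN φ x w = normalProj gN φ x w') : w = w' := by
  have h3 : tangentialPart gN φ x w = tangentialPart gN φ x w' :=
    eq_tangentialPart hconf fun u => by rw [inner_tangentialPart hconf, h₁]
  rw [← tangential_add_normal (gN := gN) x w, ← tangential_add_normal (gN := gN) x w', h3, h₂]

/-- The direct sum map is holomorphic if and only if the Hessian satisfies an algebraic
condition. -/
theorem isHolomorphic_directSumMap_iff (hm : Even m) (hDM : IsWeylConnection gM DM)
    (hDN : IsWeylConnection gN DN) {σ : ℝ} (hσ : σ * σ = 1) {ε : ℂ} (hε : ε = σ * Complex.I) :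
    IsHolomorphic ((𝓡 m).prod 𝓘(ℝ, SumModel m k)) ((𝓡 (m + k)).prod 𝓘(ℝ, EndModel (m + k)))
          (sumTwistorSet gM gN oM oN φ) (sumTwistorDistribution gM gN DM DN φ ε)
          (twistorSet gN oN) (twistorDistribution gN DN ε) (directSumMap gN φ) ↔
    ∀ (x : M) (B : SumBundle φ x), B.1 ∈ posComplexStructures gM oM x →
      normalComponent φ x B ∈ posNormalComplexStructures gN oM oN φ x → ∀ u v,
      hessian φ DM DN x (B.1 u) (B.1 v) - directEnd gN φ x B (hessian φ DM DN x (B.1 u) v) =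
      σ • (directEnd gN φ x B (hessian φ DM DN x u (B.1 v)) + hessian φ DM DN x u v) := by
  subst hε
  constructor
  · intro h x B hB₁ hB₂
    exact (directSumMap_holomorphicAt_iff hDM hDN hconf hB₁ hB₂ hσ).1 (h.2 ⟨x, B⟩ ⟨hB₁, hB₂⟩).2
  · intro h
    refine ⟨fun z hz => directEnd_mem hconf hm hz.1 hz.2,
      fun z hz => ⟨mdifferentiableAt_directSumMap hconf z, ?_⟩⟩
    obtain ⟨x, B⟩ := z
    exact (directSumMap_holomorphicAt_iff hDM hDN hconf hz.1 hz.2 hσ).2 (h x B hz.1 hz.2)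

theorem exists_koszul (hDM : IsWeylConnection gM DM) (hDN : IsWeylConnection gN DN) (x : M) :
    ∃ c : TangentSpace (𝓡 m) x →ₗ[ℝ] ℝ, ∀ u v w,
      2 * gN.inner (φ x) (hessian φ DM DN x u v) (dif φ x w) =
        c u * gM.inner x v w + c v * gM.inner x u w - c w * gM.inner x u v := by
  obtain ⟨c, hc⟩ := exists_inner_hessian hDM hDN hconf x
  exact ⟨c, koszul_formula (q := metricForm gM x) (g := metricForm gN (φ x))
    (P := (dif φ x).toLinearMap) (b := hessian φ DM DN x) (c := c) (metric_symm gM x)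
    (metric_symm gN (φ x)) (hessian_symm hDM hDN x) hc⟩

section Pointwise

variable {x : M} {B : SumBundle φ x} (hB₁ : B.1 ∈ posComplexStructures gM oM x)
  (hB₂ : normalComponent φ x B ∈ posNormalComplexStructures gN oM oN φ x)
include hB₁ hB₂

/-- The tangential parts of the two sides of the holomorphicity condition. -/
theorem hessian_tangential {c : TangentSpace (𝓡 m) x →ₗ[ℝ] ℝ}
    (hk : ∀ u v w, 2 * gN.inner (φ x) (hessian φ DM DN x u v) (dif φ x w) =
      c u * gM.inner x v w + c v * gM.inner x u w - c w * gM.inner x u v)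
    (u v w : TangentSpace (𝓡 m) x) :
    2 * gN.inner (φ x) (hessian φ DM DN x (B.1 u) (B.1 v) -
        directEnd gN φ x B (hessian φ DM DN x (B.1 u) v)) (dif φ x w) =
      c (B.1 v) * gM.inner x (B.1 u) w - c w * gM.inner x u v + c v * gM.inner x u w -
        c (B.1 w) * gM.inner x (B.1 u) v ∧
    2 * gN.inner (φ x) (directEnd gN φ x B (hessian φ DM DN x u (B.1 v)) +
        hessian φ DM DN x u v) (dif φ x w) =
      c (B.1 v) * gM.inner x (B.1 u) w - c w * gM.inner x u v + c v * gM.inner x u w -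
        c (B.1 w) * gM.inner x (B.1 u) v := by
  have hS : ∀ y, gN.inner (φ x) (directEnd gN φ x B y) (dif φ x w) =
      -gN.inner (φ x) y (dif φ x (B.1 w)) := fun y => by
    rw [directEnd_skew hB₁ hB₂ hconf, directEnd_dif hconf hB₂.1]
  have hJ := inner_complexStructure hB₁
  simp only [map_sub, map_add, sub_apply, add_apply, hS]
  constructor
  · linear_combination hk (B.1 u) (B.1 v) w + hk (B.1 u) v (B.1 w) + c (B.1 u) * hJ v w -
      c w * hB₁.2.1 u v + c v * hB₁.2.1 u w
  · linear_combination -hk u (B.1 v) (B.1 w) + hk u v w - c u * hB₁.2.1 v w - c (B.1 v) * hJ u w +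
      c (B.1 w) * hJ u v

variable (hDM : IsWeylConnection gM DM) (hDN : IsWeylConnection gN DN)
include hDM hDN

/-- The tangential parts always agree. For the normal parts, insert `II = q ⊗ ξ` and use `q(Ju, Jv)
= q(u, v)` and `q(Ju, v) = -q(u, Jv)`. -/
theorem condition_of_umbilical {ξ : TangentSpace (𝓡 (m + k)) (φ x)}
    (h : ∀ X v, normalProj gN φ x (hessian φ DM DN x X v) = gM.inner x X v • ξ)
    (u v : TangentSpace (𝓡 m) x) :
    hessian φ DM DN x (B.1 u) (B.1 v) - directEnd gN φ x B (hessian φ DM DN x (B.1 u) v) =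
      directEnd gN φ x B (hessian φ DM DN x u (B.1 v)) + hessian φ DM DN x u v := by
  obtain ⟨c, hc⟩ := exists_koszul hconf hDM hDN x
  refine eq_of_normalProj_eq hconf (fun w => ?_) ?_
  · obtain ⟨h1, h2⟩ := hessian_tangential hconf hB₁ hB₂ hc u v w
    linarith
  · have hK := normalProj_directEnd hconf hB₂.1
    rw [map_sub, map_add, hK, hK, h, h, h, h, hB₁.2.1, inner_complexStructure hB₁, map_smul,
      map_smul]
    module

/-- The normal part of the holomorphicity condition. -/
theorem normal_condition {σ : ℝ} (h : ∀ u v,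
      hessian φ DM DN x (B.1 u) (B.1 v) - directEnd gN φ x B (hessian φ DM DN x (B.1 u) v) =
      σ • (directEnd gN φ x B (hessian φ DM DN x u (B.1 v)) + hessian φ DM DN x u v))
    (u : TangentSpace (𝓡 m) x) :
    normalProj gN φ x (hessian φ DM DN x (B.1 u) (B.1 u)) =
      σ • normalProj gN φ x (hessian φ DM DN x u u) +
        (1 + σ) • normalComponent φ x B (normalProj gN φ x (hessian φ DM DN x u (B.1 u))) := by
  -- On the diagonal the symmetry of the Hessian merges the two mixed terms into one with
  -- coefficient `1 + σ`, which is zero for `σ = -1`.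
  have h1 := congrArg (normalProj gN φ x) (h u u)
  have hK := normalProj_directEnd hconf hB₂.1
  rw [map_sub, map_smul, map_add, hK, hK, hessian_symm hDM hDN x (B.1 u) u, sub_eq_iff_eq_add] at h1
  rw [h1]
  module

end Pointwise

variable (hm : Even m) (hk : Even k) (hDM : IsWeylConnection gM DM) (hDN : IsWeylConnection gN DN)
include hm hDM hDN

theorem hessian_eq_zero_of_condition (h4 : 4 ≤ m) (x : M)
    (hN : ∃ K, K ∈ posNormalComplexStructures gN oM oN φ x)
    (h : ∀ (B : SumBundle φ x), B.1 ∈ posComplexStructures gM oM x →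
      normalComponent φ x B ∈ posNormalComplexStructures gN oM oN φ x → ∀ u v,
      hessian φ DM DN x (B.1 u) (B.1 v) - directEnd gN φ x B (hessian φ DM DN x (B.1 u) v) =
      (-1 : ℝ) • (directEnd gN φ x B (hessian φ DM DN x u (B.1 v)) + hessian φ DM DN x u v))
    (X v : TangentSpace (𝓡 m) x) : hessian φ DM DN x X v = 0 := by
  obtain ⟨K, hK⟩ := hN
  have hpos : ∀ v, v ≠ 0 → 0 < metricForm gM x v v := fun v hv => metric_pos gM x hv
  have hsymm : ∀ v w, metricForm gM x v w = metricForm gM x w v := metric_symm gM x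
  have hdim := finrank_tangentSpace (d := m) x
  have hex : ∀ u v : TangentSpace (𝓡 m) x, u ≠ 0 → gM.inner x u v = 0 →
      gM.inner x v v = gM.inner x u u → ∃ J ∈ posComplexStructures gM oM x, J u = v := by
    intro u v hu huv hn
    obtain ⟨J, hJ, hJu⟩ := exists_posStructure hm hdim hsymm hpos h4
      (isSignClosed_orientation (oM x)) hu huv hn
    exact ⟨_, mem_posComplexStructures hJ, hJu⟩
  have hquad : ∀ u v : TangentSpace (𝓡 m) x, u ≠ 0 → gM.inner x u v = 0 →
      gM.inner x v v = gM.inner x u u → normalProj gN φ x (hessian φ DM DN x v v) =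
        -normalProj gN φ x (hessian φ DM DN x u u) := by
    intro u v hu huv hn
    obtain ⟨J, hJ, rfl⟩ := hex u v hu huv hn
    have := normal_condition (B := ((J, K) : SumBundle φ x)) hconf hJ hK hDM hDN (h (J, K) hJ hK) u
    rw [add_neg_cancel, zero_smul, add_zero, neg_one_smul] at this
    exact this
  have hzero : ∀ u, normalProj gN φ x (hessian φ DM DN x u u) = 0 := by
    intro u
    by_cases hu : u = 0
    · rw [hu, map_zero, map_zero]
    -- Passing from one to another of three pairwise orthogonal vectors of equal length changes the
    -- sign of the quadratic form; going around the triangle gives `II(u, u) = -II(u, u)`.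
    obtain ⟨v, w, hv, huv, huw, hvw, hvv, hww⟩ :=
      exists_orthogonal_triple hdim hsymm hpos (by omega) hu
    have e1 := hquad u v hu huv hvv
    have e2 := hquad u w hu huw hww
    have e3 := hquad v w hv hvw (hww.trans hvv.symm)
    rw [e1, e2, neg_neg] at e3
    exact eq_zero_of_eq_neg e3.symm
  have hnormal : ∀ u v, normalProj gN φ x (hessian φ DM DN x u v) = 0 :=
    apply_eq_zero_of_apply_self
      (β := (hessian φ DM DN x).compr₂ (normalProj gN φ x).toLinearMap)
      (fun u v => congrArg (normalProj gN φ x) (hessian_symm hDM hDN x u v)) hzero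
  obtain ⟨c, hc⟩ := exists_koszul hconf hDM hDN x
  have hc0 : ∀ z, c z = 0 := by
    intro z
    by_cases hz : z = 0
    · rw [hz, map_zero]
    -- With `J u = w` and `z` orthogonal to `u` and `w`, the common value of the two tangential
    -- parts reduces to `-c(z) q(u, u)`. For `σ = -1` the two parts are also opposite, hence `c(z) =
    -- 0`.
    obtain ⟨u, w, hu, hzu, hzw, huw, huu, hww⟩ :=
      exists_orthogonal_triple hdim hsymm hpos (by omega) hz
    obtain ⟨J, hJ, hJu⟩ := hex u w hu huw (hww.trans huu.symm)
    obtain ⟨e₁, e₂⟩ := hessian_tangential (B := ((J, K) : SumBundle φ x)) hconf hJ hK hc u u z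
    have e₃ : ∀ a b : TangentSpace (𝓡 (m + k)) (φ x), a = (-1 : ℝ) • b →
        gN.inner (φ x) a (dif φ x z) = -gN.inner (φ x) b (dif φ x z) := fun a b hab => by
      rw [hab, neg_one_smul, map_neg, neg_apply]
    rw [e₃ _ _ (h (J, K) hJ hK u u)] at e₁
    have hq1 : gM.inner x (J u) z = 0 := by rw [hJu]; exact (hsymm _ _).trans hzw
    have hq2 : gM.inner x (J u) u = 0 := by rw [hJu]; exact (hsymm _ _).trans huw
    have hq3 : gM.inner x u z = 0 := (hsymm _ _).trans hzu
    have hq4 : c z * gM.inner x u u = 0 := by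
      simp only [hq1, hq2, hq3] at e₁ e₂
      linarith
    exact (mul_eq_zero.1 hq4).resolve_right (hpos u hu).ne'
  have hc' : ∀ w, gN.inner (φ x) (hessian φ DM DN x X v) (dif φ x w) = 0 := fun w => by
    have h2 := hc X v w
    rw [hc0, hc0, hc0] at h2
    linarith
  exact eq_of_normalProj_eq hconf (fun w => by rw [hc', map_zero, zero_apply])
    (by rw [hnormal, map_zero])

include hk

/-- Everything reduces to `β v v = β u u` for orthogonal `u`, `v` of equal length, that is, to
disposing of the term `2 K β(u, Ju)`. -/
theorem exists_umbilical_of_condition (hor : k = 0 → PreservesOrientation oM oN φ)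
    (hmk : ¬(m = 2 ∧ k = 2)) (x : M)
    (h : ∀ (B : SumBundle φ x), B.1 ∈ posComplexStructures gM oM x →
      normalComponent φ x B ∈ posNormalComplexStructures gN oM oN φ x → ∀ u v,
      hessian φ DM DN x (B.1 u) (B.1 v) - directEnd gN φ x B (hessian φ DM DN x (B.1 u) v) =
      (1 : ℝ) • (directEnd gN φ x B (hessian φ DM DN x u (B.1 v)) + hessian φ DM DN x u v)) :
    ∃ ξ ∈ normalSpace gN φ x, ∀ X v,
      normalProj gN φ x (hessian φ DM DN x X v) = gM.inner x X v • ξ := by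
  have hpos : ∀ v, v ≠ 0 → 0 < metricForm gM x v v := fun v hv => metric_pos gM x hv
  have hsymm : ∀ v w, metricForm gM x v w = metricForm gM x w v := metric_symm gM x
  have hdim := finrank_tangentSpace (d := m) x
  set β : TangentSpace (𝓡 m) x →ₗ[ℝ] TangentSpace (𝓡 m) x →ₗ[ℝ] TangentSpace (𝓡 (m + k)) (φ x) :=
    (hessian φ DM DN x).compr₂ (normalProj gN φ x).toLinearMap with hβ
  have hβapp : ∀ u v, β u v = normalProj gN φ x (hessian φ DM DN x u v) := fun _ _ => rfl
  have hcond : ∀ (J : EndTangent m M x) (K : EndTangent (m + k) N (φ x)),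
      J ∈ posComplexStructures gM oM x → K ∈ posNormalComplexStructures gN oM oN φ x →
      ∀ u, β (J u) (J u) = β u u + (2 : ℝ) • K (β u (J u)) := by
    intro J K hJ hK u
    have := normal_condition (B := ((J, K) : SumBundle φ x)) hconf hJ hK hDM hDN (h (J, K) hJ hK) u
    rw [one_smul, one_add_one_eq_two] at this
    exact this
  have horth : ∀ u v, u ≠ 0 → metricForm gM x u v = 0 → metricForm gM x v v = metricForm gM x u u →
      β v v = β u u := by
    intro u v hu huv hn
    have hm2 : 2 ≤ m := by
      have : Nontrivial (TangentSpace (𝓡 m) x) := ⟨u, 0, hu⟩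
      have h0 : 0 < m := hdim ▸ Module.finrank_pos (R := ℝ) (M := TangentSpace (𝓡 m) x)
      obtain ⟨j, hj⟩ := hm
      omega
    obtain ⟨K₀, hK₀⟩ := exists_normalStructure hconf hk hor x
    have hmem : β u v ∈ normalSpace gN φ x := normalProj_mem hconf x _
    -- In dimension at least 4 both `J u = v` and `J' u = -v` are possible, with the same normal
    -- structure `K₀`.
    by_cases h4 : 4 ≤ m
    · obtain ⟨J, hJ, hJu⟩ := exists_posStructure hm hdim hsymm hpos h4
        (isSignClosed_orientation (oM x)) hu huv hn
      obtain ⟨J', hJ', hJu'⟩ := exists_posStructure hm hdim hsymm hpos h4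
        (isSignClosed_orientation (oM x)) hu (v := -v) (by rw [map_neg, huv, neg_zero])
        (by rw [map_neg, map_neg, LinearMap.neg_apply, neg_neg, hn])
      exact eq_of_pos_neg (K := K₀.toLinearMap) hJu hJu'
        (hcond _ _ (mem_posComplexStructures hJ) hK₀ u)
        (hcond _ _ (mem_posComplexStructures hJ') hK₀ u)
    obtain ⟨J, hJ, hJu⟩ := exists_posStructure_or hm hdim hsymm hpos hm2
      (isSignClosed_orientation (oM x)) hu huv hn
    have hJ' := mem_posComplexStructures hJ
    by_cases hw : β u v = 0
    · refine eq_of_apply_eq_zero (K := K₀.toLinearMap) hJu hw (hcond _ _ hJ' hK₀ u)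
    have hdimN := finrank_normalSpace hconf x
    -- Now `m = 2` and the normal vector `β u v` is nonzero, so `k ≥ 2`; the excluded case `(2, 2)`
    -- and the parity of `k` leave `k ≥ 4`.
    have hk4 : 4 ≤ k := by
      have : Nontrivial (normalSpace gN φ x) := ⟨⟨_, hmem⟩, 0, fun h => hw (congrArg Subtype.val h)⟩
      have h0 : 0 < k := hdimN ▸ Module.finrank_pos (R := ℝ) (M := normalSpace gN φ x)
      obtain ⟨j, hj⟩ := hk
      obtain ⟨j', hj'⟩ := hm
      omega
    have hsymmN : ∀ v w, normalForm gN φ x v w = normalForm gN φ x w v :=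
      fun v w => metric_symm gN (φ x) _ _
    have hposN : ∀ v, v ≠ 0 → 0 < normalForm gN φ x v v :=
      fun v hv => metric_pos gN (φ x) (by simpa using hv)
    have hw' : (⟨β u v, hmem⟩ : normalSpace gN φ x) ≠ 0 := fun h => hw (congrArg Subtype.val h)
    -- The roles are exchanged: normal structures sending `β u v` to `n` and to `-n` are compared,
    -- for one `J`.
    obtain ⟨n, hwn, hnn⟩ := exists_orthogonal_vector hdimN hsymmN hposN (by omega) hw'
    obtain ⟨K, hK, hKw⟩ := exists_posStructure hk hdimN hsymmN hposN hk4
      (isSignClosed_normal hconf x) hw' hwn hnn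
    obtain ⟨K', hK', hKw'⟩ := exists_posStructure hk hdimN hsymmN hposN hk4
      (isSignClosed_normal hconf x) hw' (v := -n) (by rw [map_neg, hwn, neg_zero])
      (by rw [map_neg, map_neg, LinearMap.neg_apply, neg_neg, hnn])
    refine eq_of_apply_neg (K := (extendNormal hconf K).toLinearMap)
      (K' := (extendNormal hconf K').toLinearMap) hJu ?_
      (hcond _ _ hJ' (extendNormal_mem hconf hK) u) (hcond _ _ hJ' (extendNormal_mem hconf hK') u)
    have e := extendNormal_apply hconf K ⟨β u v, hmem⟩
    have e' := extendNormal_apply hconf K' ⟨β u v, hmem⟩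
    rw [hKw] at e
    rw [hKw'] at e'
    exact e'.trans (congrArg Neg.neg e).symm
  obtain ⟨u, r, hur⟩ := exists_eq_smul_of_orthogonal hdim hsymm hpos
    (fun u v => by rw [hβapp, hβapp, hessian_symm hDM hDN x u v]) horth
  -- The proportionality vector is a multiple of a value of `β`, hence normal.
  exact ⟨r • β u u, Submodule.smul_mem _ _ (normalProj_mem hconf x _), hur⟩

end Final

end Along

end TwistorWeyl

end

/-! ### The proposition. -/

open TwistorWeyl in
theorem proposition3p6 {m k : ℕ} (hm : Even m) (hk : Even k)
    {M : Type*} [TopologicalSpace M] [ChartedSpace (EuclideanSpace ℝ (Fin m)) M]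
    [IsManifold (𝓡 m) ∞ M] [T2Space M] [SecondCountableTopology M]
    {N : Type*} [TopologicalSpace N] [ChartedSpace (EuclideanSpace ℝ (Fin (m + k))) N]
    [IsManifold (𝓡 (m + k)) ∞ N] [T2Space N] [SecondCountableTopology N]
    (gM : Metric m M) (gN : Metric (m + k) N)
    (oM : Π x : M, Orientation ℝ (TangentSpace (𝓡 m) x) (Fin m)) (hoM : IsManifoldOrientation oM)
    (oN : Π y : N, Orientation ℝ (TangentSpace (𝓡 (m + k)) y) (Fin (m + k)))
    (hoN : IsManifoldOrientation oN)
    (DM : Connection m M) (hDM : IsWeylConnection gM DM)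
    (DN : Connection (m + k) N) (hDN : IsWeylConnection gN DN)
    (φ : C^∞⟮𝓡 m, M; 𝓡 (m + k), N⟯) (hφ : Function.Injective φ)
    (hconf : IsConformalImmersion gM gN φ) (hor : k = 0 → PreservesOrientation oM oN φ) :
    -- (i), without the direction `⟹` for surfaces in four-manifolds, where it fails
    ((IsUmbilical gM gN DN φ →
        IsHolomorphic ((𝓡 m).prod 𝓘(ℝ, SumModel m k)) ((𝓡 (m + k)).prod 𝓘(ℝ, EndModel (m + k)))
          (sumTwistorSet gM gN oM oN φ) (sumTwistorDistribution gM gN DM DN φ Complex.I)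
          (twistorSet gN oN) (twistorDistribution gN DN Complex.I) (directSumMap gN φ)) ∧
      (¬ (m = 2 ∧ k = 2) →
        IsHolomorphic ((𝓡 m).prod 𝓘(ℝ, SumModel m k)) ((𝓡 (m + k)).prod 𝓘(ℝ, EndModel (m + k)))
          (sumTwistorSet gM gN oM oN φ) (sumTwistorDistribution gM gN DM DN φ Complex.I)
          (twistorSet gN oN) (twistorDistribution gN DN Complex.I) (directSumMap gN φ) →
        IsUmbilical gM gN DN φ)) ∧
    -- (ii)
    (4 ≤ m →
      (IsHolomorphic ((𝓡 m).prod 𝓘(ℝ, SumModel m k)) ((𝓡 (m + k)).prod 𝓘(ℝ, EndModel (m + k)))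
          (sumTwistorSet gM gN oM oN φ) (sumTwistorDistribution gM gN DM DN φ (-Complex.I))
          (twistorSet gN oN) (twistorDistribution gN DN (-Complex.I)) (directSumMap gN φ) ↔
        IsGeodesicMap DM DN φ)) := by
  refine ⟨⟨fun h => ?_, fun hmk h => ?_⟩, fun h4 => ⟨fun h => ?_, fun h => ?_⟩⟩
  · rw [isHolomorphic_directSumMap_iff hconf hm hDM hDN (σ := 1) (by norm_num) (by simp)]
    intro x B hB₁ hB₂ u v
    obtain ⟨ξ, -, hξ⟩ := (isUmbilical_iff hconf DM).1 h x
    rw [one_smul]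
    exact condition_of_umbilical hconf hB₁ hB₂ hDM hDN hξ u v
  · rw [isHolomorphic_directSumMap_iff hconf hm hDM hDN (σ := 1) (by norm_num) (by simp)] at h
    exact (isUmbilical_iff hconf DM).2 fun x =>
      exists_umbilical_of_condition hconf hm hk hDM hDN hor hmk x (h x)
  · rw [isHolomorphic_directSumMap_iff hconf hm hDM hDN (σ := -1) (by norm_num) (by simp)] at h
    exact isGeodesicMap_iff.2 fun x => hessian_eq_zero_of_condition hconf hm hDM hDN h4 x
      (exists_normalStructure hconf hk hor x) (h x)
  · rw [isHolomorphic_directSumMap_iff hconf hm hDM hDN (σ := -1) (by norm_num) (by simp)]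
    intro x B hB₁ hB₂ u v
    have h0 := isGeodesicMap_iff.1 h x
    rw [h0, h0, h0, h0, map_zero, sub_zero, add_zero, smul_zero]
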